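/- Let $p_\circ,p_\bullet\in[0,1]$, $q\in(0,1)$, $\rho\in(0,\infty)$, put $v_\circ=2p_\circ-1$, $v_\bullet=2p_\bullet-1$, and assume $v_\circ>-1$ and $v_\bullet>0$. Let $(N(z))_{z\in\mathbb Z}$ be i.i.d. Poisson($\rho$) random variables, let $(S^{z,i})_{z\in\mathbb Z,\,i\ge 1}$ be independent two-sided lazy simple random walks on $\mathbb Z$ with $S^{z,i}_0=z$ (steps $-1,0,1$ with probabilities $\frac{1-q}2,q,\frac{1-q}2$; past and future independent), and let $(U_y)_{y\in\mathbb Z^2}$ be i.i.d. uniform on $[0,1]$, the three families being independent; write $\mathbb P$ for their joint law. Let $\omega=\sum_z\sum_{1\le i\le N(z)}\delta_{S^{z,i}}$ and $\mathcal T=\{(S^{z,i}_n,n):\ z\in\mathbb Z,\ 1\le i\le N(z),\ n\in\mathbb Z\}$. For $y\in\mathbb Z^2$ let $Y^y_0=y$ and let $Y^y_{n+1}=Y^y_n+(1,1)$ if either $Y^y_n\in\mathcal T$ and $U_{Y^y_n}\le p_\bullet$, or $Y^y_n\notin\mathcal T$ and $U_{Y^y_n}\le p_\circ$, and $Y^y_{n+1}=Y^y_n+(-1,1)$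 otherwise. Let $Y=Y^0$ and let $X_n$ be the first coordinate of $Y_n$. Let $v_\star\in(0,v_\bullet)$ be such that for some $c>0$ and $\gamma>1$, $$\mathbb P\big(\exists\,n\ge1:\ X_n<nv_\star-L\big)\le c^{-1}e^{-c(\log L)^\gamma}\qquad\text{for all integers }L\ge1 .$$ Put $\bar v=v_\star/3$ and, for $y\in\mathbb Z^2$, $\angle(y)=y+\{(x,n)\in\mathbb Z^2:\ x,n\ge0,\ x\ge\bar vn\}$ and $\angle^-(y)=y+\{(x,n)\in\mathbb Z^2:\ x,n\le0,\ x<\bar vn\}$. Let $W_y$ be the set of trajectories $w:\mathbb Z\to\mathbb Z$ whose trace $\{(w(n),n):n\in\mathbb Z\}$ meets both $\angle(y)$ and $\angle^-(y)$, let $A^y=\{Y^y_n\in\angle(y)\ \forall n\ge0\}$ and $\mathbb P^\angle=\mathbb P(\,\cdot\mid\omega(W_0)=0,\,A^0)$. For $k\ge1$ let $R_k=\inf\{n\ge0:\ X_n\ge(1-\bar v)k+\bar vn\}$, let $$\mathcal I=\inf\{k\ge1:\ R_k<\infty,\ \omega(W_{Y_{R_k}})=0\text{ and }A^{Y_{R_k}}\text{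 occurs}\},$$ and let $\tau=R_{\mathcal I}$ (with $\tau=\infty$ if $\mathcal I=\infty$). Then, on an enlargement of the probability space, there is a sequence $(\tau_n)_{n\ge1}$ of random times with values in $\{0,1,2,\dots\}$ such that $\tau_1=\tau$ almost surely (in particular $\tau<\infty$ almost surely) and, under $\mathbb P$ and with $S_n=\sum_{i=1}^n\tau_i$, the sequence $$\Big(\tau_{n+1},\ (X_{S_n+s}-X_{S_n})_{0\le s\le\tau_{n+1}}\Big)_{n\ge1}$$ is i.i.d., is independent of $(\tau,(X_s)_{0\le s\le\tau})$, and each of its terms is distributed as $(\tau,(X_s)_{0\le s\le\tau})$ under $\mathbb P^\angle$. -/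

import Mathlib

open MeasureTheory ProbabilityTheory Set
open scoped NNReal ENNReal

noncomputable section

namespace RWDRE

/-! ### The dynamic random environment -/

/-- Law of one step of a lazy simple random walk on `ℤ`: the steps `-1`, `0`, `1` have
probabilities `(1 - q) / 2`, `q`, `(1 - q) / 2`. -/
def stepLaw (q : Ioo (0 : ℝ) 1) : Measure ℤ :=
  ENNReal.ofReal ((1 - (q : ℝ)) / 2) • Measure.dirac (-1) +
    ENNReal.ofReal (q : ℝ) • Measure.dirac 0 +
    ENNReal.ofReal ((1 - (q : ℝ)) / 2) • Measure.dirac 1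

instance (q : Ioo (0 : ℝ) 1) : IsProbabilityMeasure (stepLaw q) := by
  constructor
  have h0 : (0 : ℝ) < q := q.2.1
  have h1 : (q : ℝ) < 1 := q.2.2
  simp only [stepLaw, Measure.add_apply, Measure.smul_apply, measure_univ, smul_eq_mul, mul_one]
  rw [← ENNReal.ofReal_add (by linarith) h0.le, ← ENNReal.ofReal_add (by linarith) (by linarith)]
  rw [← ENNReal.ofReal_one]
  congr 1
  ring

/-- Sample points: the initial particle numbers `N(z, 0)`, the steps of the particles labelled
`(z, i)`, and the variables `U_y` attached to the space-time points `y`. -/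
abbrev Sample : Type := (ℤ → ℕ) × (ℤ × ℕ → ℤ → ℤ) × (ℤ × ℤ → unitInterval)

/-- The annealed law with particle density `ρ`: the numbers of particles are Poisson(`ρ`), the
steps are lazy simple random walk steps, the `U_y` are uniform on `[0, 1]`, and all these
variables are independent. -/
def law (q : Ioo (0 : ℝ) 1) (ρ : ℝ≥0) : Measure Sample :=
  (Measure.infinitePi fun _ : ℤ => poissonMeasure ρ).prod
    ((Measure.infinitePi fun _ : ℤ × ℕ => Measure.infinitePi fun _ : ℤ => stepLaw q).prod
      (Measure.infinitePi fun _ : ℤ × ℤ => (volume : Measure unitInterval)))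

/-- The two-sided trajectory `w` with `w 0 = z` built from the steps `e`: the steps
`e 0, e 1, …` drive the future, and `e (-1), e (-2), …` drive the past, read backwards in time. -/
def twoSidedPath (z : ℤ) (e : ℤ → ℤ) : ℤ → ℤ
  | Int.ofNat n => z + ∑ k ∈ Finset.range n, e k
  | Int.negSucc n => z + ∑ k ∈ Finset.range (n + 1), e (-((k : ℤ) + 1))

/-- Trajectory `S^{z,i}` of the environment particle `(z, i)`. -/
def particle (s : Sample) (z : ℤ) (i : ℕ) : ℤ → ℤ := twoSidedPath z (s.2.1 (z, i))

/-- The point measure `ω = ∑_z ∑_{i < N(z,0)} δ_{S^{z,i}}` on the space of trajectories.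
Almost surely, all its atoms are nearest-neighbour trajectories. -/
def omega (s : Sample) : Measure (ℤ → ℤ) :=
  Measure.sum fun z : ℤ => ∑ i ∈ Finset.range (s.1 z), Measure.dirac (particle s z i)

/-- The set `𝒯` of space-time points `(x, n)` covered by the environment particles. -/
def trace (s : Sample) : Set (ℤ × ℤ) :=
  {y | ∃ (z : ℤ) (i : ℕ), i < s.1 z ∧ particle s z i y.2 = y.1}

/-! ### The random walk -/

open Classical in
/-- The space-time process `Y^y`. -/
def walkY (pVac pOcc : ℝ) (s : Sample) (y : ℤ × ℤ) : ℕ → ℤ × ℤ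
  | 0 => y
  | n + 1 =>
    let z := walkY pVac pOcc s y n
    if (z ∈ trace s ∧ (s.2.2 z : ℝ) ≤ pOcc) ∨ (z ∉ trace s ∧ (s.2.2 z : ℝ) ≤ pVac) then
      z + (1, 1)
    else
      z + (-1, 1)

/-- The random walk `X` started at the origin at time zero. -/
def walkX (pVac pOcc : ℝ) (s : Sample) (n : ℕ) : ℤ := (walkY pVac pOcc s 0 n).1

/-- The `vStar`-ballisticity condition. -/
def Ballistic (pVac pOcc : ℝ) (q : Ioo (0 : ℝ) 1) (ρ : ℝ≥0) (vStar : ℝ) : Prop :=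
  ∃ c : ℝ, 0 < c ∧ ∃ γ : ℝ, 1 < γ ∧ ∀ L : ℕ, 1 ≤ L →
    (law q ρ).real {s | ∃ n : ℕ, 1 ≤ n ∧ (walkX pVac pOcc s n : ℝ) < n * vStar - L} ≤
      c⁻¹ * Real.exp (-c * Real.log L ^ γ)

/-! ### Cones, records and the regeneration time -/

/-- The cone `∠(y)` in the first quadrant based at `y`, with angle `vBar`. -/
def cone (vBar : ℝ) (y : ℤ × ℤ) : Set (ℤ × ℤ) :=
  {z | y.1 ≤ z.1 ∧ y.2 ≤ z.2 ∧ vBar * ((z.2 - y.2 : ℤ) : ℝ) ≤ ((z.1 - y.1 : ℤ) : ℝ)}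

/-- The cone in the third quadrant based at `y`, with angle `vBar`. -/
def backCone (vBar : ℝ) (y : ℤ × ℤ) : Set (ℤ × ℤ) :=
  {z | z.1 ≤ y.1 ∧ z.2 ≤ y.2 ∧ ((z.1 - y.1 : ℤ) : ℝ) < vBar * ((z.2 - y.2 : ℤ) : ℝ)}

/-- Trajectories that intersect both cones based at `y`. -/
def crossing (vBar : ℝ) (y : ℤ × ℤ) : Set (ℤ → ℤ) :=
  {w | (∃ n : ℤ, (w n, n) ∈ cone vBar y) ∧ ∃ n : ℤ, (w n, n) ∈ backCone vBar y}

/-- The event `A^y`: the walk started at `y` stays in the cone `∠(y)` forever. -/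
def staysInCone (pVac pOcc vBar : ℝ) (y : ℤ × ℤ) : Set Sample :=
  {s | ∀ n : ℕ, walkY pVac pOcc s y n ∈ cone vBar y}

/-- The event that no environment particle crosses from one cone based at `y` to the other one,
and that `A^y` occurs. -/
def regEvent (pVac pOcc vBar : ℝ) (y : ℤ × ℤ) : Set Sample :=
  {s | omega s (crossing vBar y) = 0} ∩ staysInCone pVac pOcc vBar y

/-- The law `P^∠`. -/
def coneLaw (pVac pOcc : ℝ) (q : Ioo (0 : ℝ) 1) (ρ : ℝ≥0) (vBar : ℝ) : Measure Sample :=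
  ProbabilityTheory.cond (law q ρ) (regEvent pVac pOcc vBar 0)

/-- The record time `R_k`, equal to `⊤` when the record is never reached. -/
def recordTime (pVac pOcc vBar : ℝ) (k : ℕ) (s : Sample) : ℕ∞ :=
  sInf ((fun n : ℕ => (n : ℕ∞)) '' {n | (1 - vBar) * k + vBar * n ≤ (walkX pVac pOcc s n : ℝ)})

/-- The indices `k ≥ 1` such that `R_k` is finite and the regeneration event occurs at the
space-time position of the walk at time `R_k`. -/
def regIndices (pVac pOcc vBar : ℝ) (s : Sample) : Set ℕ :=
  {k | 1 ≤ k ∧ ∃ n : ℕ, recordTime pVac pOcc vBar k s = n ∧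
    s ∈ regEvent pVac pOcc vBar (walkY pVac pOcc s 0 n)}

open Classical in
/-- The regeneration time `τ = R_I`, with `I` the least regeneration index (`τ = ⊤` if there is
none). -/
def regTime (pVac pOcc vBar : ℝ) (s : Sample) : ℕ∞ :=
  if (regIndices pVac pOcc vBar s).Nonempty then
    recordTime pVac pOcc vBar (sInf (regIndices pVac pOcc vBar s)) s
  else ⊤

/-! ### Blocks -/

/-- The pairs of a duration `t` and a path `(x_s)_{0 ≤ s ≤ t}` of that duration. -/
abbrev Block : Type := Σ t : ℕ, (Fin (t + 1) → ℤ)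

/-- The block `(t, (x_{a+s} - x_a)_{0 ≤ s ≤ t})` of the path `x` that starts at time `a`. -/
def block (x : ℕ → ℤ) (a t : ℕ) : Block := ⟨t, fun s => x (a + s) - x a⟩

end RWDRE

end

open RWDRE

/-!
The walk only sees the set of the trajectories and the marks. Seen as a random configuration, the
trajectories form a Poisson point process, so that its law is determined by void probabilities: the
restrictions of the configuration to disjoint sets of trajectories and of sites are independent, and
the law is invariant under space-time shifts.

If no trajectory crosses from the backward cone to the forward cone based at `y` and the walk from
`y` stays in the forward cone, then the future of `y` depends only on the trajectories that meet the
forward cone and on the marks inside it, while the path up to `y`, and the fact that the earlier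
records were not regenerations, depends only on the other trajectories and on the marks of the
backward cone. Summing over the possible blocks, the law of the first block is that of a block
followed by a configuration conditioned to regenerate at the origin, and iterating this renewal
identity gives the independence of the blocks.

There remains the existence of a regeneration. As the walk is ballistic, regeneration at the origin
has positive probability: after enough initial steps to the right, forced by the marks alone, the
walk stays in the cone. Deviation bounds for the trajectories show moreover that, for `l` large, at
most far records no trajectory links the backward cone with the cone based `l` steps to the right.
At such a record, making these `l` steps and then regenerating is independent of the explored part
of the environment, and its probability is bounded below. The event that no regeneration ever occurs
is nearly decided in a finite box, which the walk has left long before a far record, and it excludes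
the success of the attempt there: hence it is null.
-/

namespace RWDRE

/-! ### Measure theory -/

section MeasureTheory

/-- The function `x ↦ e^{-x}` on `[0, ∞]`, which turns the intensity of a set into the probability
that a Poisson point process has no point there. -/
noncomputable def expNeg (x : ℝ≥0∞) : ℝ≥0∞ := (EReal.exp x)⁻¹

lemma expNeg_zero : expNeg 0 = 1 := by simp [expNeg]

lemma expNeg_add (x y : ℝ≥0∞) : expNeg (x + y) = expNeg x * expNeg y := by
  have exp_ne_zero (x : ℝ≥0∞) : EReal.exp x ≠ 0 := by simp
  rw [expNeg, EReal.coe_ennreal_add, EReal.exp_add,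
    ENNReal.mul_inv (Or.inl (exp_ne_zero x)) (Or.inr (exp_ne_zero y)), expNeg, expNeg]

lemma expNeg_sum {ι : Type*} (s : Finset ι) (f : ι → ℝ≥0∞) :
    expNeg (∑ i ∈ s, f i) = ∏ i ∈ s, expNeg (f i) := by
  classical
  induction s using Finset.induction_on with
  | empty => simp [expNeg_zero]
  | insert i s hi ih => rw [Finset.sum_insert hi, Finset.prod_insert hi, expNeg_add, ih]

lemma continuous_expNeg : Continuous expNeg :=
  continuous_inv.comp (ENNReal.continuous_exp.comp continuous_coe_ennreal_ereal)

lemma expNeg_ne_zero {x : ℝ≥0∞} (hx : x ≠ ∞) : expNeg x ≠ 0 := by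
  rw [expNeg, ENNReal.inv_ne_zero, Ne, EReal.exp_eq_top_iff]
  simpa using hx

lemma expNeg_ofReal {x : ℝ} (hx : 0 ≤ x) :
    expNeg (ENNReal.ofReal x) = ENNReal.ofReal (Real.exp (-x)) := by
  rw [expNeg, EReal.coe_ennreal_ofReal, max_eq_left hx, EReal.exp_coe, Real.exp_neg,
    ENNReal.ofReal_inv_of_pos (Real.exp_pos x)]

lemma one_le_expNeg_add (x : ℝ≥0∞) : 1 ≤ expNeg x + x := by
  by_cases hx : x = ∞
  · simp [hx]
  rw [← ENNReal.ofReal_toReal hx, expNeg_ofReal ENNReal.toReal_nonneg,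
    ← ENNReal.ofReal_add (Real.exp_pos _).le ENNReal.toReal_nonneg, ← ENNReal.ofReal_one]
  exact ENNReal.ofReal_le_ofReal (by linarith [Real.add_one_le_exp (-x.toReal)])

lemma lintegral_pow_poissonMeasure (ρ : ℝ≥0) {p r : ℝ≥0∞} (h : p + r = 1) :
    ∫⁻ n, p ^ n ∂(poissonMeasure ρ) = expNeg (ρ * r) := by
  lift p to ℝ≥0 using ne_top_of_le_ne_top ENNReal.one_ne_top (h ▸ le_self_add)
  lift r to ℝ≥0 using ne_top_of_le_ne_top ENNReal.one_ne_top (h ▸ le_add_self)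
  have hpr : (p : ℝ) + r = 1 := by exact_mod_cast h
  have integrand (n : ℕ) : (p : ℝ≥0∞) ^ n * poissonMeasure ρ {n} =
      ENNReal.ofReal (Real.exp (-ρ) * ((p * ρ : ℝ) ^ n / n.factorial)) := by
    rw [poissonMeasure_singleton, ← ENNReal.ofReal_coe_nnreal, ← ENNReal.ofReal_pow (by positivity),
      ← ENNReal.ofReal_mul (by positivity)]
    congr 1
    rw [mul_pow]
    ring
  have series : HasSum (fun n : ℕ => Real.exp (-ρ) * ((p * ρ : ℝ) ^ n / n.factorial))
      (Real.exp (-ρ) * Real.exp (p * ρ)) := by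
    rw [Real.exp_eq_exp_ℝ]
    exact (NormedSpace.expSeries_div_hasSum_exp (p * ρ : ℝ)).mul_left _
  rw [← ENNReal.coe_mul, ← ENNReal.ofReal_coe_nnreal (p := ρ * r), expNeg_ofReal (by positivity),
    lintegral_countable']
  simp_rw [integrand]
  rw [← ENNReal.ofReal_tsum_of_nonneg (fun n => by positivity) series.summable, series.tsum_eq,
    ← Real.exp_add]
  congr 2
  push_cast
  linear_combination ρ * hpr

lemma lintegral_finsetProd_infinitePi {ι : Type*} {X : ι → Type*} [∀ i, MeasurableSpace (X i)]
    (μ : ∀ i, Measure (X i)) [∀ i, IsProbabilityMeasure (μ i)] {f : ∀ i, X i → ℝ≥0∞}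
    (hf : ∀ i, Measurable (f i)) (t : Finset ι) :
    ∫⁻ x, ∏ i ∈ t, f i (x i) ∂Measure.infinitePi μ = ∏ i ∈ t, ∫⁻ y, f i y ∂μ i := by
  have indep : iIndepFun (fun i (x : ∀ i, X i) => f i (x i)) (Measure.infinitePi μ) :=
    iIndepFun_infinitePi fun i => hf i
  rw [lintegral_prod_eq_prod_lintegral_of_indepFun t _ indep
    fun i => (hf i).comp (measurable_pi_apply i)]
  exact Finset.prod_congr rfl fun i _ =>
    (measurePreserving_eval_infinitePi μ i).lintegral_comp (hf i)

lemma measurable_fun_indicator {ι β : Type*} [MeasurableSpace β] [Zero β] (D : Set ι) :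
    Measurable fun u : ι → β => D.indicator u := by
  refine measurable_pi_iff.2 fun i => ?_
  by_cases hi : i ∈ D <;> simp only [hi, indicator_of_mem, indicator_of_notMem, not_false_eq_true]
    <;> fun_prop

lemma comap_indicator_le_iSup_comap_eval {ι β : Type*} [MeasurableSpace β] [Zero β] (D : Set ι) :
    MeasurableSpace.comap (fun u : ι → β => D.indicator u) inferInstance ≤
      ⨆ i ∈ D, MeasurableSpace.comap (fun u : ι → β => u i) inferInstance := by
  rw [← measurable_iff_comap_le, @measurable_pi_iff]
  intro i
  by_cases hi : i ∈ D
  · simp only [hi, indicator_of_mem]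
    exact (comap_measurable _).mono (le_iSup₂_of_le i hi le_rfl) le_rfl
  · simp only [hi, not_false_eq_true, indicator_of_notMem]
    exact measurable_const

lemma indepFun_indicator_infinitePi {ι β : Type*} [MeasurableSpace β] [Zero β]
    (μ : ι → Measure β) [∀ i, IsProbabilityMeasure (μ i)] {D D' : Set ι} (hD : Disjoint D D') :
    IndepFun (fun u : ι → β => D.indicator u) (fun u => D'.indicator u) (Measure.infinitePi μ) := by
  have indep_eval : iIndepFun (fun (i : ι) (u : ι → β) => u i) (Measure.infinitePi μ) :=
    iIndepFun_infinitePi (X := fun (_ : ι) (x : β) => x) (by fun_prop)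
  have indep_iSup := indep_iSup_of_disjoint (fun i => (measurable_pi_apply i).comap_le)
    indep_eval hD
  exact indep_of_indep_of_le_left
    (indep_of_indep_of_le_right indep_iSup (comap_indicator_le_iSup_comap_eval D'))
    (comap_indicator_le_iSup_comap_eval D)

lemma measurable_sInf_nat {α : Type*} [MeasurableSpace α] {p : α → ℕ → Prop}
    (hp : ∀ n, MeasurableSet {x | p x n}) : Measurable fun x => sInf {n | p x n} := by
  refine measurable_of_Iic fun n => ?_
  have sInf_le_iff (x : α) : sInf {m | p x m} ≤ n ↔ (∃ m ≤ n, p x m) ∨ ∀ m, ¬ p x m := by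
    rcases {m | p x m}.eq_empty_or_nonempty with h | h
    · exact iff_of_true (by simp [h]) (Or.inr (eq_empty_iff_forall_notMem.1 h))
    · refine ⟨fun hn => Or.inl ⟨_, hn, Nat.sInf_mem h⟩, ?_⟩
      rintro (⟨m, hmn, hm⟩ | hall)
      exacts [(Nat.sInf_le hm).trans hmn, absurd (Nat.sInf_mem h) (hall _)]
  simp only [preimage, mem_Iic, sInf_le_iff, ofPred_or, ofPred_exists, ofPred_and, ofPred_forall]
  exact (.union (.iUnion fun m => (MeasurableSet.const _).inter (hp m))
    (.iInter fun m => (hp m).compl))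

lemma measure_le_of_forall_inter_le {α ι : Type*} [MeasurableSpace α] [Countable ι]
    {μ ν : Measure α} {S : ι → Set α} (hS : ∀ i, MeasurableSet (S i))
    (hdisj : Pairwise (Function.onFun Disjoint S)) {E E' : Set α} (hE : E ⊆ ⋃ i, S i)
    (hE' : MeasurableSet E') (h : ∀ i, ν (E ∩ S i) ≤ μ (E' ∩ S i)) : ν E ≤ μ E' :=
  calc ν E ≤ ν (⋃ i, E ∩ S i) := by
        rw [← inter_iUnion]
        exact measure_mono (subset_inter subset_rfl hE)
    _ ≤ ∑' i, ν (E ∩ S i) := measure_iUnion_le _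
    _ ≤ ∑' i, μ (E' ∩ S i) := ENNReal.tsum_le_tsum h
    _ ≤ μ (⋃ i, E' ∩ S i) :=
        tsum_meas_le_meas_iUnion_of_disjoint μ (fun i => hE'.inter (hS i))
          fun i j hij => (hdisj hij).mono inter_subset_right inter_subset_right
    _ ≤ μ E' := measure_mono (iUnion_subset fun i => inter_subset_left)

instance {ι : Type*} {X : ι → Type*} [∀ i, MeasurableSpace (X i)]
    [∀ i, DiscreteMeasurableSpace (X i)] : DiscreteMeasurableSpace (Σ i, X i) where
  forall_measurableSet s := by
    change MeasurableSet[⨅ i, MeasurableSpace.map (Sigma.mk i) inferInstance] s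
    rw [MeasurableSpace.measurableSet_iInf]
    exact fun i => (MeasurableSet.of_discrete : MeasurableSet (Sigma.mk i ⁻¹' s))

lemma map_cond_preimage {α β : Type*} [MeasurableSpace α] [MeasurableSpace β] (μ : Measure α)
    {f : α → β} (hf : Measurable f) {E : Set β} (hE : MeasurableSet E) :
    (ProbabilityTheory.cond μ (f ⁻¹' E)).map f = ProbabilityTheory.cond (μ.map f) E := by
  rw [ProbabilityTheory.cond, ProbabilityTheory.cond, Measure.map_smul, Measure.restrict_map hf hE,
    Measure.map_apply hf hE]

lemma map_eq_infinitePi_of_measure_forall_fin {Ω β : Type*} [MeasurableSpace Ω]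
    [MeasurableSpace β] [Countable β] [MeasurableSingletonClass β] {μ : Measure Ω}
    {ν : ℕ → Measure β} [∀ n, IsProbabilityMeasure (ν n)] {f : ℕ → Ω → β}
    (hf : ∀ n, Measurable (f n))
    (h : ∀ n (b : Fin n → β), μ {ω | ∀ i : Fin n, f i ω = b i} = ∏ i : Fin n, ν i {b i}) :
    μ.map (fun ω n => f n ω) = Measure.infinitePi ν := by
  classical
  have measurable_fin (n : ℕ) : Measurable fun ω (i : Fin n) => f i ω :=
    measurable_pi_lambda _ fun i => hf i
  have map_fin (n : ℕ) : μ.map (fun ω (i : Fin n) => f i ω) = Measure.pi fun i : Fin n => ν i := by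
    refine Measure.ext_of_singleton fun b => ?_
    rw [Measure.pi_singleton, Measure.map_apply (measurable_fin n) (measurableSet_singleton b), ← h]
    simp only [preimage, mem_singleton_iff, funext_iff]
  refine Measure.eq_infinitePi _ fun s t ht => ?_
  obtain ⟨n, hn⟩ := s.exists_nat_subset_range
  set u : ℕ → Set β := fun i => if i ∈ s then t i else univ
  have preimage_eq : (fun ω n => f n ω) ⁻¹' (s : Set ℕ).pi t =
      (fun ω (i : Fin n) => f i ω) ⁻¹' univ.pi fun i : Fin n => u i := by
    ext ω
    simp only [u, mem_preimage, Set.mem_pi, Finset.mem_coe, mem_univ, true_imp_iff]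
    refine ⟨fun hω i => ?_, fun hω i hi => ?_⟩
    · split_ifs with hi
      exacts [hω i hi, trivial]
    · simpa only [hi, if_true] using hω ⟨i, Finset.mem_range.1 (hn hi)⟩
  rw [Measure.map_apply (measurable_pi_lambda _ hf) (.pi s.countable_toSet fun i _ => ht i),
    preimage_eq, ← Measure.map_apply (measurable_fin n) .of_discrete, map_fin, Measure.pi_pi,
    ← Finset.prod_range fun i => ν i (u i), ← Finset.prod_subset hn]
  · exact Finset.prod_congr rfl fun i hi => by simp only [u, hi, if_true]
  · intro i _ hi
    simp only [u, hi, if_false, measure_univ]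

lemma iIndepFun_of_map_eq_infinitePi {Ω ι : Type*} {X : ι → Type*} [MeasurableSpace Ω]
    [∀ i, MeasurableSpace (X i)] {μ : Measure Ω} [IsProbabilityMeasure μ]
    {ν : ∀ i, Measure (X i)} [∀ i, IsProbabilityMeasure (ν i)] {f : ∀ i, Ω → X i}
    (hf : ∀ i, Measurable (f i)) (h : μ.map (fun ω i => f i ω) = Measure.infinitePi ν) :
    iIndepFun f μ ∧ ∀ i, μ.map (f i) = ν i := by
  have map_eq (i : ι) : μ.map (f i) = ν i := by
    rw [← Measure.infinitePi_map_eval ν i, ← h,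
      Measure.map_map (measurable_pi_apply i) (measurable_pi_lambda _ hf)]
    rfl
  refine ⟨?_, map_eq⟩
  rw [iIndepFun_iff_map_fun_eq_infinitePi_map hf, h]
  simp only [map_eq]

lemma indepFun_zero_succ {Ω β : Type*} [MeasurableSpace Ω] [MeasurableSpace β] {μ : Measure Ω}
    {f : ℕ → Ω → β} (h : iIndepFun f μ) (hf : ∀ n, Measurable (f n)) :
    IndepFun (f 0) (fun ω n => f (n + 1) ω) μ := by
  have indep := indep_iSup_of_disjoint (fun n => (hf n).comap_le) h
    (disjoint_compl_right (a := ({0} : Set ℕ)))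
  refine (IndepFun_iff_Indep _ _ _).2
    (indep_of_indep_of_le_left (indep_of_indep_of_le_right indep ?_) ?_)
  · rw [← measurable_iff_comap_le, @measurable_pi_iff]
    exact fun n => (comap_measurable (f (n + 1))).mono
      (le_iSup₂_of_le (n + 1) n.succ_ne_zero le_rfl) le_rfl
  · exact le_iSup₂_of_le 0 rfl le_rfl

end MeasureTheory

/-! ### Configurations and their law -/

section Configuration

/-- What the walk sees of a sample: the set of the trajectories of the particles and the marks
`U_y`. The multiplicities of the trajectories are forgotten, as they matter neither for the walk
nor for the events of zero occupation. -/
@[ext]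
structure Config where
  paths : Set (ℤ → ℤ)
  mark : ℤ × ℤ → unitInterval

/-- The event that no trajectory lies in `A` and that the marks are in `B`. These events generate
the σ-algebra on `Config`, so that laws on `Config` are determined by void probabilities. -/
def voidEvent (A : Set (ℤ → ℤ)) (B : Set (ℤ × ℤ → unitInterval)) : Set Config :=
  {c | c.paths ∩ A = ∅ ∧ c.mark ∈ B}

/-- The collection of the void events of measurable sets. -/
def voidEvents : Set (Set Config) :=
  {E | ∃ A B, MeasurableSet A ∧ MeasurableSet B ∧ E = voidEvent A B}

instance : MeasurableSpace Config := MeasurableSpace.generateFrom voidEvents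

/-- The configuration of a sample. -/
def toConfig (s : Sample) : Config := ⟨{w | ∃ z i, i < s.1 z ∧ particle s z i = w}, s.2.2⟩

/-- The event that no particle that starts in `J` has its trajectory in `A`. -/
def avoids (J : Set ℤ) (A : Set (ℤ → ℤ)) : Set Sample :=
  {s | ∀ z ∈ J, ∀ i < s.1 z, particle s z i ∉ A}

variable {A : Set (ℤ → ℤ)} {B : Set (ℤ × ℤ → unitInterval)}

lemma voidEvent_inter (A A' : Set (ℤ → ℤ)) (B B' : Set (ℤ × ℤ → unitInterval)) :
    voidEvent A B ∩ voidEvent A' B' = voidEvent (A ∪ A') (B ∩ B') := by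
  ext c
  simp only [voidEvent, mem_inter_iff, mem_ofPred_eq, inter_union_distrib_left, union_empty_iff]
  tauto

lemma isPiSystem_voidEvents : IsPiSystem voidEvents := by
  rintro _ ⟨A, B, hA, hB, rfl⟩ _ ⟨A', B', hA', hB', rfl⟩ -
  exact ⟨_, _, hA.union hA', hB.inter hB', voidEvent_inter _ _ _ _⟩

lemma measurableSet_voidEvent (hA : MeasurableSet A) (hB : MeasurableSet B) :
    MeasurableSet (voidEvent A B) :=
  MeasurableSpace.measurableSet_generateFrom ⟨A, B, hA, hB, rfl⟩

lemma measurable_of_voidEvent {α : Type*} [MeasurableSpace α] {f : α → Config}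
    (h : ∀ A B, MeasurableSet A → MeasurableSet B → MeasurableSet (f ⁻¹' voidEvent A B)) :
    Measurable f := by
  refine measurable_generateFrom ?_
  rintro _ ⟨A, B, hA, hB, rfl⟩
  exact h A B hA hB

lemma measurableSet_paths_inter_eq_empty (hA : MeasurableSet A) :
    MeasurableSet {c : Config | c.paths ∩ A = ∅} := by
  simpa [voidEvent] using measurableSet_voidEvent hA MeasurableSet.univ

lemma measurable_mark : Measurable Config.mark := by
  intro B hB
  have preimage_eq : Config.mark ⁻¹' B = voidEvent ∅ B := by ext c; simp [voidEvent]
  rw [preimage_eq]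
  exact measurableSet_voidEvent MeasurableSet.empty hB

lemma measurable_twoSidedPath (z : ℤ) : Measurable (twoSidedPath z) := by
  rw [measurable_pi_iff]
  rintro (n | n) <;> simp only [twoSidedPath] <;> fun_prop

lemma measurable_particle (z : ℤ) (i : ℕ) : Measurable fun s => particle s z i :=
  (measurable_twoSidedPath z).comp (by fun_prop)

lemma measurableSet_avoids (J : Set ℤ) (hA : MeasurableSet A) : MeasurableSet (avoids J A) := by
  have avoids_eq : avoids J A =
      ⋂ z ∈ J, ⋂ i, ({s : Sample | i < s.1 z}ᶜ ∪ {s | particle s z i ∈ A}ᶜ) := by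
    ext s
    simp only [avoids, mem_ofPred_eq, mem_iInter, mem_union, mem_compl_iff, ← imp_iff_not_or]
  rw [avoids_eq]
  refine .biInter J.to_countable fun z _ => .iInter fun i =>
    .union (.compl ?_) (measurable_particle z i hA).compl
  exact measurableSet_lt (by fun_prop) (by fun_prop)

lemma toConfig_preimage_voidEvent (A : Set (ℤ → ℤ)) (B : Set (ℤ × ℤ → unitInterval)) :
    toConfig ⁻¹' voidEvent A B = avoids univ A ∩ {s | s.2.2 ∈ B} := by
  ext s
  simp only [toConfig, voidEvent, avoids, mem_preimage, mem_inter_iff, mem_ofPred_eq,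
    eq_empty_iff_forall_notMem, not_and, mem_univ, true_imp_iff]
  refine and_congr_left fun _ => ⟨fun h z i hi => h _ ⟨z, i, hi, rfl⟩, ?_⟩
  rintro h _ ⟨z, i, hi, rfl⟩
  exact h z i hi

lemma measurableSet_marks_mem (hB : MeasurableSet B) : MeasurableSet {s : Sample | s.2.2 ∈ B} :=
  (measurable_snd.comp measurable_snd) hB

lemma measurable_toConfig : Measurable toConfig :=
  measurable_of_voidEvent fun A B hA hB => by
    rw [toConfig_preimage_voidEvent]
    exact (measurableSet_avoids univ hA).inter (measurableSet_marks_mem hB)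

end Configuration

section ConfigurationLaw

variable (q : Ioo (0 : ℝ) 1) (ρ : ℝ≥0)

/-- The law of the steps of one particle. -/
noncomputable abbrev stepsLaw : Measure (ℤ → ℤ) := Measure.infinitePi fun _ : ℤ => stepLaw q

/-- The law of the steps of all the particles. -/
noncomputable abbrev allStepsLaw : Measure (ℤ × ℕ → ℤ → ℤ) :=
  Measure.infinitePi fun _ : ℤ × ℕ => stepsLaw q

/-- The law of the marks. -/
noncomputable abbrev markLaw : Measure (ℤ × ℤ → unitInterval) :=
  Measure.infinitePi fun _ : ℤ × ℤ => (volume : Measure unitInterval)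

/-- The law of the trajectory of a particle that starts at `z`. -/
noncomputable def pathLaw (z : ℤ) : Measure (ℤ → ℤ) :=
  (stepsLaw q).map (twoSidedPath z)

/-- The intensity of the Poisson point process of the trajectories. -/
noncomputable def intensity : Measure (ℤ → ℤ) := (ρ : ℝ≥0∞) • Measure.sum (pathLaw q)

/-- The law of the configuration. -/
noncomputable def configLaw : Measure Config := (law q ρ).map toConfig

instance (z : ℤ) : IsProbabilityMeasure (pathLaw q z) :=
  Measure.isProbabilityMeasure_map (measurable_twoSidedPath z).aemeasurable

instance : IsProbabilityMeasure (law q ρ) := by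
  unfold law; infer_instance

instance : IsProbabilityMeasure (configLaw q ρ) :=
  Measure.isProbabilityMeasure_map measurable_toConfig.aemeasurable

variable {A : Set (ℤ → ℤ)} {B : Set (ℤ × ℤ → unitInterval)}

lemma allStepsLaw_prod_markLaw_avoids (hA : MeasurableSet A) (t : Finset ℤ) (N : ℤ → ℕ) :
    (allStepsLaw q).prod markLaw (Prod.mk N ⁻¹' (avoids t A ∩ {s | s.2.2 ∈ B})) =
      (∏ z ∈ t, pathLaw q z Aᶜ ^ N z) * markLaw B := by
  let particles : Finset (ℤ × ℕ) := (t.sigma fun z => Finset.range (N z)).map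
    (Equiv.sigmaEquivProd ℤ ℕ).toEmbedding
  have preimage_eq : Prod.mk N ⁻¹' (avoids t A ∩ {s : Sample | s.2.2 ∈ B}) =
      (particles : Set (ℤ × ℕ)).pi (fun j => twoSidedPath j.1 ⁻¹' Aᶜ) ×ˢ B := by
    ext ⟨e, u⟩
    simp only [particles, avoids, particle, mem_preimage, mem_inter_iff, mem_ofPred_eq, mem_prod,
      Set.mem_pi, Finset.mem_coe, Finset.mem_map_equiv, Finset.mem_sigma, Finset.mem_range,
      mem_compl_iff, Prod.forall, Equiv.sigmaEquivProd_symm_apply]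
    grind
  rw [preimage_eq, Measure.prod_prod, Measure.infinitePi_pi _ fun j _ =>
    measurable_twoSidedPath j.1 hA.compl, Finset.prod_map, Finset.prod_sigma]
  congr 1
  refine Finset.prod_congr rfl fun z _ => ?_
  simp [pathLaw, Measure.map_apply (measurable_twoSidedPath z) hA.compl]

lemma law_avoids_finset (hA : MeasurableSet A) (hB : MeasurableSet B) (t : Finset ℤ) :
    law q ρ (avoids t A ∩ {s | s.2.2 ∈ B}) =
      expNeg (∑ z ∈ t, ρ * pathLaw q z A) * markLaw B := by
  rw [law, Measure.prod_apply ((measurableSet_avoids t hA).inter (measurableSet_marks_mem hB))]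
  simp_rw [allStepsLaw_prod_markLaw_avoids q hA t]
  rw [lintegral_mul_const _ (by fun_prop), expNeg_sum,
    lintegral_finsetProd_infinitePi (fun _ : ℤ => poissonMeasure ρ)
      (f := fun z n => pathLaw q z Aᶜ ^ n) (by fun_prop)]
  congr 1
  refine Finset.prod_congr rfl fun z _ => lintegral_pow_poissonMeasure ρ ?_
  rw [add_comm, prob_add_prob_compl hA]

lemma avoids_univ_eq_iInter_finset (A : Set (ℤ → ℤ)) :
    avoids univ A = ⋂ t : Finset ℤ, avoids t A := by
  ext s
  simp only [mem_iInter]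
  exact ⟨fun h t z _ => h z (mem_univ z), fun h z _ => h {z} z (by simp)⟩

lemma configLaw_voidEvent (hA : MeasurableSet A) (hB : MeasurableSet B) :
    configLaw q ρ (voidEvent A B) = expNeg (intensity q ρ A) * markLaw B := by
  rw [configLaw, Measure.map_apply measurable_toConfig (measurableSet_voidEvent hA hB),
    toConfig_preimage_voidEvent, avoids_univ_eq_iInter_finset, iInter_inter]
  have antitone_avoids : Antitone fun t : Finset ℤ => avoids t A ∩ {s | s.2.2 ∈ B} :=
    fun t t' htt' s hs => ⟨fun z hz => hs.1 z (htt' hz), hs.2⟩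
  refine tendsto_nhds_unique (tendsto_measure_iInter_atTop (fun t =>
    ((measurableSet_avoids _ hA).inter (measurableSet_marks_mem hB)).nullMeasurableSet)
    antitone_avoids ⟨∅, measure_ne_top _ _⟩) ?_
  simp only [Function.comp_def, law_avoids_finset q ρ hA hB]
  refine ENNReal.Tendsto.mul_const ?_ (Or.inr (measure_ne_top _ _))
  refine (continuous_expNeg.tendsto _).comp ?_
  rw [intensity, Measure.smul_apply, Measure.sum_apply _ hA, smul_eq_mul, ← ENNReal.tsum_mul_left]
  exact ENNReal.summable.hasSum

lemma configLaw_paths_inter_eq_empty (hA : MeasurableSet A) :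
    configLaw q ρ {c | c.paths ∩ A = ∅} = expNeg (intensity q ρ A) := by
  simpa [voidEvent] using configLaw_voidEvent q ρ hA MeasurableSet.univ

end ConfigurationLaw

section Restriction

/-- The configuration that keeps only the trajectories in `B` and the marks in `D`; the other marks
are set to `0`. -/
noncomputable def Config.restrict (B : Set (ℤ → ℤ)) (D : Set (ℤ × ℤ)) (c : Config) : Config :=
  ⟨c.paths ∩ B, D.indicator c.mark⟩

lemma restrict_restrict (B B' : Set (ℤ → ℤ)) (D D' : Set (ℤ × ℤ)) (c : Config) :
    (c.restrict B D).restrict B' D' = c.restrict (B ∩ B') (D' ∩ D) := by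
  simp [Config.restrict, inter_assoc, indicator_indicator]

lemma restrict_preimage_voidEvent (B : Set (ℤ → ℤ)) (D : Set (ℤ × ℤ)) (A : Set (ℤ → ℤ))
    (E : Set (ℤ × ℤ → unitInterval)) :
    Config.restrict B D ⁻¹' voidEvent A E = voidEvent (B ∩ A) ((fun u => D.indicator u) ⁻¹' E) := by
  ext c
  simp [Config.restrict, voidEvent, inter_assoc]

lemma measurable_restrict {B : Set (ℤ → ℤ)} (hB : MeasurableSet B) (D : Set (ℤ × ℤ)) :
    Measurable (Config.restrict B D) :=
  measurable_of_voidEvent fun A E hA hE => by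
    rw [restrict_preimage_voidEvent]
    exact measurableSet_voidEvent (hB.inter hA) (measurable_fun_indicator D hE)

lemma indepFun_of_indepSets_voidEvents {μ : Measure Config} [IsProbabilityMeasure μ]
    {f g : Config → Config} (hf : Measurable f) (hg : Measurable g)
    (h : IndepSets (preimage f '' voidEvents) (preimage g '' voidEvents) μ) : IndepFun f g μ := by
  have isPiSystem_preimage (f : Config → Config) : IsPiSystem (preimage f '' voidEvents) := by
    rintro _ ⟨E, hE, rfl⟩ _ ⟨E', hE', rfl⟩ ⟨c, hc⟩
    exact ⟨E ∩ E', isPiSystem_voidEvents _ hE _ hE' ⟨_, hc⟩, rfl⟩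
  have measurableSet_preimage {f : Config → Config} (hf : Measurable f) :
      ∀ s ∈ preimage f '' voidEvents, MeasurableSet s := by
    rintro _ ⟨E, hE, rfl⟩
    exact hf (MeasurableSpace.measurableSet_generateFrom hE)
  have comap_eq (f : Config → Config) : MeasurableSpace.comap f inferInstance =
      MeasurableSpace.generateFrom (preimage f '' voidEvents) := MeasurableSpace.comap_generateFrom
  rw [IndepFun_iff_Indep, comap_eq, comap_eq]
  exact IndepSets.indep' (measurableSet_preimage hf) (measurableSet_preimage hg)
    (isPiSystem_preimage f) (isPiSystem_preimage g) h

lemma indepFun_restrict (q : Ioo (0 : ℝ) 1) (ρ : ℝ≥0) {B B' : Set (ℤ → ℤ)} {D D' : Set (ℤ × ℤ)}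
    (hB : MeasurableSet B) (hB' : MeasurableSet B') (hBB' : Disjoint B B')
    (hDD' : Disjoint D D') :
    IndepFun (Config.restrict B D) (Config.restrict B' D') (configLaw q ρ) := by
  refine indepFun_of_indepSets_voidEvents (measurable_restrict hB D) (measurable_restrict hB' D') ?_
  rw [IndepSets_iff]
  rintro _ _ ⟨_, ⟨A, E, hA, hE, rfl⟩, rfl⟩ ⟨_, ⟨A', E', hA', hE', rfl⟩, rfl⟩
  have hDE := measurable_fun_indicator D hE
  have hDE' := measurable_fun_indicator D' hE'
  simp only [restrict_preimage_voidEvent, voidEvent_inter]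
  rw [configLaw_voidEvent q ρ ((hB.inter hA).union (hB'.inter hA')) (hDE.inter hDE'),
    configLaw_voidEvent q ρ (hB.inter hA) hDE, configLaw_voidEvent q ρ (hB'.inter hA') hDE',
    measure_union (hBB'.mono inter_subset_left inter_subset_left) (hB'.inter hA'), expNeg_add,
    (indepFun_indicator_infinitePi _ hDD').measure_inter_preimage_eq_mul _ _ hE hE']
  ring

end Restriction

section Shift

/-- The trajectory `w` seen from the space-time point `a`. -/
def translate (a : ℤ × ℤ) (w : ℤ → ℤ) : ℤ → ℤ := fun n => w (n + a.2) - a.1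

/-- The configuration seen from the space-time point `a`. -/
def Config.shift (a : ℤ × ℤ) (c : Config) : Config :=
  ⟨translate (-a) ⁻¹' c.paths, fun z => c.mark (z + a)⟩

lemma translate_translate (a b : ℤ × ℤ) (w : ℤ → ℤ) :
    translate a (translate b w) = translate (a + b) w := by
  funext n
  simp only [translate, Prod.fst_add, Prod.snd_add, add_assoc]
  ring

lemma translate_zero (w : ℤ → ℤ) : translate 0 w = w := by
  funext n; simp [translate]

lemma measurable_translate (a : ℤ × ℤ) : Measurable (translate a) := by
  rw [measurable_pi_iff]
  intro n
  simp only [translate]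
  fun_prop

lemma translate_mem_shift_paths {a : ℤ × ℤ} {c : Config} {w : ℤ → ℤ} :
    translate a w ∈ (c.shift a).paths ↔ w ∈ c.paths := by
  simp [Config.shift, translate_translate, translate_zero]

lemma shift_shift (a b : ℤ × ℤ) (c : Config) : (c.shift a).shift b = c.shift (b + a) := by
  simp only [Config.shift, Config.mk.injEq, add_assoc, and_true]
  ext w
  simp [translate_translate, add_comm]

lemma shift_preimage_voidEvent (a : ℤ × ℤ) (A : Set (ℤ → ℤ)) (B : Set (ℤ × ℤ → unitInterval)) :
    Config.shift a ⁻¹' voidEvent A B =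
      voidEvent (translate a ⁻¹' A) ((fun u z => u (z + a)) ⁻¹' B) := by
  ext c
  simp only [Config.shift, voidEvent, mem_preimage, mem_ofPred_eq, eq_empty_iff_forall_notMem,
    mem_inter_iff, not_and]
  refine and_congr_left fun _ => ⟨fun h w hw => h _ ?_, fun h w hw hA => h _ hw ?_⟩
  · simpa [translate_translate, translate_zero] using hw
  · simpa [translate_translate, translate_zero] using hA

lemma measurable_shift (a : ℤ × ℤ) : Measurable (Config.shift a) :=
  measurable_of_voidEvent fun A E hA hE => by
    rw [shift_preimage_voidEvent]
    exact measurableSet_voidEvent (measurable_translate a hA)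
      ((measurable_pi_lambda _ fun z => measurable_pi_apply _) hE)

end Shift

section ShiftInvariance

variable (q : Ioo (0 : ℝ) 1) (ρ : ℝ≥0)

lemma twoSidedPath_sub (z x : ℤ) (e : ℤ → ℤ) (n : ℤ) :
    twoSidedPath z e n - x = twoSidedPath (z - x) e n := by
  rcases n with n | n <;> simp only [twoSidedPath] <;> ring

lemma measurable_uncurry_twoSidedPath :
    Measurable fun p : (ℤ → ℤ) × ℤ => twoSidedPath p.2 p.1 :=
  measurable_from_prod_countable_left measurable_twoSidedPath

lemma intensity_eq_map_prod_count :
    intensity q ρ =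
      (ρ : ℝ≥0∞) • ((stepsLaw q).prod Measure.count).map fun p => twoSidedPath p.2 p.1 := by
  rw [intensity, Measure.count, Measure.prod_sum_right,
    Measure.map_sum measurable_uncurry_twoSidedPath.aemeasurable]
  congr 2 with z : 1
  rw [Measure.prod_dirac, Measure.map_map measurable_uncurry_twoSidedPath (by fun_prop)]
  rfl

/-- A translation under which the trajectory with steps `e` turns into one with steps `f e`, the
starting point moving by an amount that only depends on `e`, preserves the intensity: the counting
measure of the starting points is translation invariant. -/
lemma measurePreserving_translate_of_twoSidedPath {a : ℤ × ℤ} {f : (ℤ → ℤ) → ℤ → ℤ}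
    {g : (ℤ → ℤ) → ℤ} (hf : MeasurePreserving f (stepsLaw q) (stepsLaw q)) (hg : Measurable g)
    (hfg : ∀ z e, translate a (twoSidedPath z e) = twoSidedPath (z - g e) (f e)) :
    MeasurePreserving (translate a) (intensity q ρ) (intensity q ρ) := by
  have skew : MeasurePreserving (fun p : (ℤ → ℤ) × ℤ => (f p.1, p.2 - g p.1))
      ((stepsLaw q).prod Measure.count) ((stepsLaw q).prod Measure.count) :=
    hf.skew_product (by fun_prop) (ae_of_all _ fun e =>
      (measurePreserving_sub_right Measure.count (g e)).map_eq)
  refine ⟨measurable_translate a, ?_⟩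
  rw [intensity_eq_map_prod_count, Measure.map_smul,
    Measure.map_map (measurable_translate a) measurable_uncurry_twoSidedPath]
  conv_rhs => rw [← skew.map_eq, Measure.map_map measurable_uncurry_twoSidedPath skew.measurable]
  congr 2 with p : 1
  exact hfg p.2 p.1

/-- The steps of a trajectory seen one time unit later: the step `e 0` after time `0` becomes,
reversed, the step of index `-1`, the last one before time `0`. -/
def stepShift (e : ℤ → ℤ) : ℤ → ℤ := fun k => if k = -1 then - e 0 else e (k + 1)

lemma stepLaw_map_neg : (stepLaw q).map Neg.neg = stepLaw q := by
  have measurable_neg_int : Measurable (Neg.neg : ℤ → ℤ) := measurable_neg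
  simp only [stepLaw, Measure.map_add _ _ measurable_neg_int, Measure.map_smul,
    Measure.map_dirac' measurable_neg_int, neg_neg, neg_zero]
  abel

lemma measurePreserving_stepShift : MeasurePreserving stepShift (stepsLaw q) (stepsLaw q) := by
  have reflect (k : ℤ) : MeasurePreserving (if k = -1 then (Neg.neg : ℤ → ℤ) else id)
      (stepLaw q) (stepLaw q) := by
    split_ifs
    exacts [⟨measurable_neg, stepLaw_map_neg q⟩, MeasurePreserving.id _]
  have translation : MeasurePreserving (fun (e : ℤ → ℤ) k => e (k + 1)) (stepsLaw q)
      (stepsLaw q) :=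
    ⟨by fun_prop, Measure.map_infinitePi_infinitePi_of_inj (P := fun _ : ℤ => stepLaw q)
      (add_left_injective 1)⟩
  have reflection : MeasurePreserving
      (fun (e : ℤ → ℤ) k => (if k = -1 then (Neg.neg : ℤ → ℤ) else id) (e k))
      (stepsLaw q) (stepsLaw q) := by
    refine ⟨measurable_pi_lambda _ fun k => (reflect k).measurable.comp (measurable_pi_apply k), ?_⟩
    rw [Measure.infinitePi_map_pi _ fun k => (reflect k).measurable]
    simp only [(reflect _).map_eq]
  convert reflection.comp translation using 1
  funext e k
  by_cases hk : k = -1 <;> simp [stepShift, hk]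

lemma translate_time_twoSidedPath (z : ℤ) (e : ℤ → ℤ) :
    translate (0, 1) (twoSidedPath z e) =
      twoSidedPath (z - stepShift e (-1)) (stepShift e) := by
  have stepShift_of_nonneg (k : ℕ) : stepShift e k = e (k + 1) := if_neg (by omega)
  have stepShift_of_neg (k : ℕ) : stepShift e (-((k + 1 : ℕ) + 1)) = e (-(k + 1)) := by
    rw [stepShift, if_neg (by omega)]
    congr 1
  have stepShift_neg_one : stepShift e (-1) = - e 0 := if_pos rfl
  funext n
  rcases n with n | _ | n
  · have cast_succ : (Int.ofNat n + 1 : ℤ) = Int.ofNat (n + 1) := rfl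
    simp only [translate, cast_succ, twoSidedPath, Finset.sum_range_succ', stepShift_of_nonneg,
      stepShift_neg_one]
    push_cast
    ring
  · simp [translate, twoSidedPath]
  · have cast_succ : (Int.negSucc (n + 1) + 1 : ℤ) = Int.negSucc n := rfl
    simp only [translate, cast_succ, twoSidedPath, Finset.sum_range_succ' _ (n + 1),
      stepShift_of_neg]
    simp

lemma measurePreserving_translate_space (x : ℤ) :
    MeasurePreserving (translate (x, 0)) (intensity q ρ) (intensity q ρ) :=
  measurePreserving_translate_of_twoSidedPath q ρ (.id _) (measurable_const (a := x)) fun z e => by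
    funext n
    simp [translate, twoSidedPath_sub]

lemma measurePreserving_translate_one :
    MeasurePreserving (translate (0, 1)) (intensity q ρ) (intensity q ρ) :=
  measurePreserving_translate_of_twoSidedPath q ρ (measurePreserving_stepShift q)
    ((measurable_pi_apply (-1)).comp (measurePreserving_stepShift q).measurable)
    translate_time_twoSidedPath

variable {q ρ}

lemma measurePreserving_translate_neg {a : ℤ × ℤ}
    (ha : MeasurePreserving (translate a) (intensity q ρ) (intensity q ρ)) :
    MeasurePreserving (translate (-a)) (intensity q ρ) (intensity q ρ) := by
  refine ⟨measurable_translate _, ?_⟩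
  conv_lhs => rw [← ha.map_eq]
  have comp_eq_id : translate (-a) ∘ translate a = id := by
    funext w
    simp [translate_translate, translate_zero]
  rw [Measure.map_map (measurable_translate _) (measurable_translate _), comp_eq_id, Measure.map_id]

lemma measurePreserving_translate_add {a b : ℤ × ℤ}
    (ha : MeasurePreserving (translate a) (intensity q ρ) (intensity q ρ))
    (hb : MeasurePreserving (translate b) (intensity q ρ) (intensity q ρ)) :
    MeasurePreserving (translate (a + b)) (intensity q ρ) (intensity q ρ) := by
  convert ha.comp hb using 1
  funext w
  simp [translate_translate]

variable (q ρ)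

lemma measurePreserving_translate (a : ℤ × ℤ) :
    MeasurePreserving (translate a) (intensity q ρ) (intensity q ρ) := by
  have time (n : ℤ) : MeasurePreserving (translate (0, n)) (intensity q ρ) (intensity q ρ) := by
    induction n using Int.induction_on with
    | zero => exact measurePreserving_translate_space q ρ 0
    | succ n ih =>
      simpa using measurePreserving_translate_add ih (measurePreserving_translate_one q ρ)
    | pred n ih =>
      simpa [sub_eq_add_neg] using measurePreserving_translate_add ih
        (measurePreserving_translate_neg (measurePreserving_translate_one q ρ))
  simpa using measurePreserving_translate_add (measurePreserving_translate_space q ρ a.1) (time a.2)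

lemma measurePreserving_shift_marks (a : ℤ × ℤ) :
    MeasurePreserving (fun (u : ℤ × ℤ → unitInterval) z => u (z + a)) markLaw markLaw :=
  ⟨by fun_prop, Measure.map_infinitePi_infinitePi_of_inj
    (P := fun _ : ℤ × ℤ => (volume : Measure unitInterval)) (add_left_injective a)⟩

lemma measurePreserving_shift (a : ℤ × ℤ) :
    MeasurePreserving (Config.shift a) (configLaw q ρ) (configLaw q ρ) := by
  refine ⟨measurable_shift a, ?_⟩
  have := Measure.isProbabilityMeasure_map (μ := configLaw q ρ) (measurable_shift a).aemeasurable
  refine ext_of_generate_finite _ rfl isPiSystem_voidEvents ?_ (by simp)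
  rintro _ ⟨A, E, hA, hE, rfl⟩
  have marks := measurePreserving_shift_marks a
  rw [Measure.map_apply (measurable_shift a) (measurableSet_voidEvent hA hE),
    shift_preimage_voidEvent,
    configLaw_voidEvent q ρ (measurable_translate a hA) (marks.measurable hE),
    configLaw_voidEvent q ρ hA hE, marks.measure_preimage hE.nullMeasurableSet,
    (measurePreserving_translate q ρ a).measure_preimage hA.nullMeasurableSet]

end ShiftInvariance

/-! ### The walk and the cones -/

section Walk

/-- The jump probabilities outside and inside the occupied sites, and the slope of the cones. -/
structure Params where
  pVac : ℝ
  pOcc : ℝ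
  v : ℝ

variable (P : Params)

/-- The set of the space-time points covered by the trajectories of the configuration. -/
def Config.occupied (c : Config) : Set (ℤ × ℤ) := {y | ∃ w ∈ c.paths, w y.2 = y.1}

open Classical in
/-- The point that the space-time walk visits after `z`. -/
noncomputable def Config.next (c : Config) (z : ℤ × ℤ) : ℤ × ℤ :=
  if (z ∈ c.occupied ∧ (c.mark z : ℝ) ≤ P.pOcc) ∨ (z ∉ c.occupied ∧ (c.mark z : ℝ) ≤ P.pVac) then
    z + (1, 1)
  else
    z + (-1, 1)

/-- The space-time walk started at `y`. -/
noncomputable def Config.walk (c : Config) (y : ℤ × ℤ) (n : ℕ) : ℤ × ℤ := (c.next P)^[n] y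

variable {P}

lemma walk_zero (c : Config) (y : ℤ × ℤ) : c.walk P y 0 = y := rfl

lemma walk_succ (c : Config) (y : ℤ × ℤ) (n : ℕ) :
    c.walk P y (n + 1) = c.next P (c.walk P y n) := Function.iterate_succ_apply' _ _ _

lemma walk_add (c : Config) (y : ℤ × ℤ) (m n : ℕ) :
    c.walk P y (m + n) = c.walk P (c.walk P y m) n := by
  rw [Config.walk, Config.walk, Config.walk, add_comm, Function.iterate_add_apply]

lemma trace_eq_occupied (s : Sample) : trace s = (toConfig s).occupied := by
  ext y
  simp only [trace, Config.occupied, toConfig, mem_ofPred_eq]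
  exact ⟨fun ⟨z, i, hi, h⟩ => ⟨_, ⟨z, i, hi, rfl⟩, h⟩, fun ⟨_, ⟨z, i, hi, hw⟩, h⟩ =>
    ⟨z, i, hi, hw ▸ h⟩⟩

lemma walkY_eq_walk (s : Sample) (y : ℤ × ℤ) (n : ℕ) :
    walkY P.pVac P.pOcc s y n = (toConfig s).walk P y n := by
  induction n with
  | zero => rfl
  | succ n ih =>
    rw [walk_succ, ← ih, Config.next, ← trace_eq_occupied]
    rfl

lemma next_eq_or (c : Config) (z : ℤ × ℤ) :
    c.next P z = z + (1, 1) ∨ c.next P z = z + (-1, 1) := by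
  unfold Config.next
  split_ifs <;> simp

lemma next_snd (c : Config) (z : ℤ × ℤ) : (c.next P z).2 = z.2 + 1 := by
  rcases next_eq_or (P := P) c z with h | h <;> simp [h]

lemma next_fst_le (c : Config) (z : ℤ × ℤ) : (c.next P z).1 ≤ z.1 + 1 := by
  rcases next_eq_or (P := P) c z with h | h <;> simp [h]

lemma walk_snd (c : Config) (y : ℤ × ℤ) (n : ℕ) : (c.walk P y n).2 = y.2 + n := by
  induction n with
  | zero => simp [walk_zero]
  | succ n ih => rw [walk_succ, next_snd, ih]; push_cast; ring

lemma walk_fst_le (c : Config) (y : ℤ × ℤ) (n : ℕ) : (c.walk P y n).1 ≤ y.1 + n := by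
  induction n with
  | zero => simp [walk_zero]
  | succ n ih =>
    rw [walk_succ]
    push_cast
    linarith [next_fst_le (P := P) c (c.walk P y n)]

lemma walk_congr {c c' : Config} {y : ℤ × ℤ} {n : ℕ}
    (h : ∀ m < n, c.next P (c.walk P y m) = c'.next P (c.walk P y m)) :
    ∀ m ≤ n, c.walk P y m = c'.walk P y m := by
  intro m
  induction m with
  | zero => intro _; rfl
  | succ m ih =>
    intro hm
    rw [walk_succ, walk_succ, ← ih (by omega), h m (by omega)]

lemma walk_eq_of_mem {c c' : Config} {S : Set (ℤ × ℤ)}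
    (h : ∀ z ∈ S, c.next P z = c'.next P z) {y : ℤ × ℤ} (hy : ∀ n, c.walk P y n ∈ S) (n : ℕ) :
    c.walk P y n = c'.walk P y n :=
  walk_congr (n := n) (fun m _ => h _ (hy m)) n le_rfl

lemma mem_occupied_shift {a z : ℤ × ℤ} {c : Config} :
    z ∈ (c.shift a).occupied ↔ z + a ∈ c.occupied := by
  simp only [Config.occupied, mem_ofPred_eq]
  constructor
  · rintro ⟨w, hw, h⟩
    exact ⟨translate (-a) w, hw, by simp [translate, h]⟩
  · rintro ⟨w, hw, h⟩
    simp only [Prod.snd_add, Prod.fst_add] at h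
    exact ⟨translate a w, translate_mem_shift_paths.2 hw, by simp [translate, h]⟩

lemma next_shift (a z : ℤ × ℤ) (c : Config) :
    (c.shift a).next P z + a = c.next P (z + a) := by
  have mark_shift : (c.shift a).mark z = c.mark (z + a) := rfl
  classical
  simp only [Config.next, mem_occupied_shift, mark_shift]
  split_ifs <;> abel

lemma walk_shift (a y : ℤ × ℤ) (c : Config) (n : ℕ) :
    (c.shift a).walk P y n + a = c.walk P (y + a) n := by
  induction n with
  | zero => rfl
  | succ n ih => rw [walk_succ, walk_succ, next_shift, ih]

lemma next_restrict {B : Set (ℤ → ℤ)} {D : Set (ℤ × ℤ)} {c : Config} {z : ℤ × ℤ} (hz : z ∈ D)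
    (h : ∀ w ∈ c.paths, w z.2 = z.1 → w ∈ B) : (c.restrict B D).next P z = c.next P z := by
  have occupied_iff : z ∈ (c.restrict B D).occupied ↔ z ∈ c.occupied :=
    ⟨fun ⟨w, hw, hwz⟩ => ⟨w, hw.1, hwz⟩, fun ⟨w, hw, hwz⟩ => ⟨w, ⟨hw, h w hw hwz⟩, hwz⟩⟩
  have mark_eq : (c.restrict B D).mark z = c.mark z := by simp [Config.restrict, hz]
  classical
  simp only [Config.next, occupied_iff, mark_eq]

lemma measurableSet_mem_occupied (z : ℤ × ℤ) : MeasurableSet {c : Config | z ∈ c.occupied} := by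
  have mem_occupied_iff (c : Config) :
      z ∈ c.occupied ↔ ¬ c.paths ∩ {w | w z.2 = z.1} = ∅ := by
    rw [← ne_eq, ← nonempty_iff_ne_empty]
    rfl
  simp only [mem_occupied_iff]
  exact (measurableSet_paths_inter_eq_empty
    (measurable_pi_apply z.2 (measurableSet_singleton z.1))).compl

lemma measurable_next (z : ℤ × ℤ) : Measurable fun c : Config => c.next P z := by
  have measurable_mark_apply : Measurable fun c : Config => (c.mark z : ℝ) :=
    measurable_subtype_coe.comp ((measurable_pi_apply z).comp measurable_mark)
  have mark_le (p : ℝ) := measurableSet_le measurable_mark_apply (measurable_const (a := p))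
  exact Measurable.ite (((measurableSet_mem_occupied z).inter (mark_le _)).union
    ((measurableSet_mem_occupied z).compl.inter (mark_le _))) measurable_const measurable_const

lemma measurable_walk (y : ℤ × ℤ) (n : ℕ) : Measurable fun c : Config => c.walk P y n := by
  induction n with
  | zero => exact measurable_const
  | succ n ih =>
    have measurable_uncurry_next : Measurable fun p : Config × (ℤ × ℤ) => p.1.next P p.2 :=
      measurable_from_prod_countable_left measurable_next
    simp only [walk_succ]
    exact measurable_uncurry_next.comp (measurable_id.prodMk ih)

lemma measurableSet_of_walk {p : Config → ℤ × ℤ → Prop} (hp : ∀ z, MeasurableSet {c | p c z})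
    (y : ℤ × ℤ) (n : ℕ) : MeasurableSet {c : Config | p c (c.walk P y n)} := by
  have eq_iUnion : {c : Config | p c (c.walk P y n)} =
      ⋃ z, {c | c.walk P y n = z} ∩ {c | p c z} := by
    ext c; simp
  rw [eq_iUnion]
  exact .iUnion fun z => (measurable_walk y n (measurableSet_singleton z)).inter (hp z)

end Walk

section Cones

/-- The trajectories whose trace meets `S`. -/
def hits (S : Set (ℤ × ℤ)) : Set (ℤ → ℤ) := {w | ∃ n : ℤ, (w n, n) ∈ S}

lemma hits_mono {S S' : Set (ℤ × ℤ)} (h : S ⊆ S') : hits S ⊆ hits S' :=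
  fun _ ⟨n, hn⟩ => ⟨n, h hn⟩

lemma mem_hits_of_eq {S : Set (ℤ × ℤ)} {z : ℤ × ℤ} (hz : z ∈ S) {w : ℤ → ℤ}
    (h : w z.2 = z.1) : w ∈ hits S :=
  ⟨z.2, by rwa [h]⟩

lemma measurableSet_hits (S : Set (ℤ × ℤ)) : MeasurableSet (hits S) := by
  simp only [hits, ofPred_exists]
  exact .iUnion fun n =>
    (by fun_prop : Measurable fun w : ℤ → ℤ => (w n, n)) (.of_discrete (s := S))

lemma crossing_eq (v : ℝ) (y : ℤ × ℤ) : crossing v y = hits (cone v y) ∩ hits (backCone v y) :=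
  rfl

lemma measurableSet_crossing (v : ℝ) (y : ℤ × ℤ) : MeasurableSet (crossing v y) :=
  (measurableSet_hits _).inter (measurableSet_hits _)

lemma self_mem_cone (v : ℝ) (y : ℤ × ℤ) : y ∈ cone v y := by simp [cone]

lemma cone_subset {v : ℝ} {x y : ℤ × ℤ} (h : y ∈ cone v x) : cone v y ⊆ cone v x := by
  rintro z ⟨hfst, hsnd, hslope⟩
  obtain ⟨hfst', hsnd', hslope'⟩ := h
  refine ⟨hfst'.trans hfst, hsnd'.trans hsnd, ?_⟩
  push_cast at *
  linarith

lemma backCone_subset {v : ℝ} {x y : ℤ × ℤ} (h : y ∈ cone v x) :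
    backCone v x ⊆ backCone v y := by
  rintro z ⟨hfst, hsnd, hslope⟩
  obtain ⟨hfst', hsnd', hslope'⟩ := h
  refine ⟨hfst.trans hfst', hsnd.trans hsnd', ?_⟩
  push_cast at *
  linarith

lemma crossing_subset_hits {v : ℝ} {a y : ℤ × ℤ} (h : y ∈ cone v a) :
    crossing v y ⊆ hits (cone v a) :=
  fun _ hw => hits_mono (cone_subset h) hw.1

lemma disjoint_cone_backCone (v : ℝ) (y : ℤ × ℤ) : Disjoint (cone v y) (backCone v y) :=
  Set.disjoint_left.2 fun _ hz hz' => not_le.2 hz'.2.2 hz.2.2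

lemma add_mem_cone_add {v : ℝ} {y z a : ℤ × ℤ} : z + a ∈ cone v (y + a) ↔ z ∈ cone v y := by
  simp [cone]

lemma add_mem_backCone_add {v : ℝ} {y z a : ℤ × ℤ} :
    z + a ∈ backCone v (y + a) ↔ z ∈ backCone v y := by
  simp [backCone]

lemma translate_mem_hits {S S' : Set (ℤ × ℤ)} {a : ℤ × ℤ} (h : ∀ z, z + a ∈ S' ↔ z ∈ S)
    {w : ℤ → ℤ} : translate a w ∈ hits S ↔ w ∈ hits S' := by
  have mem_iff (n : ℤ) : (translate a w n, n) ∈ S ↔ (w (n + a.2), n + a.2) ∈ S' := by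
    rw [← h]
    simp [translate, Prod.add_def]
  simp only [hits, mem_ofPred_eq, mem_iff]
  exact ⟨fun ⟨n, hn⟩ => ⟨_, hn⟩, fun ⟨n, hn⟩ => ⟨n - a.2, by simpa using hn⟩⟩

lemma translate_mem_hits_cone {v : ℝ} {y a : ℤ × ℤ} {w : ℤ → ℤ} :
    translate a w ∈ hits (cone v y) ↔ w ∈ hits (cone v (y + a)) :=
  translate_mem_hits fun _ => add_mem_cone_add

lemma translate_mem_hits_backCone {v : ℝ} {y a : ℤ × ℤ} {w : ℤ → ℤ} :
    translate a w ∈ hits (backCone v y) ↔ w ∈ hits (backCone v (y + a)) :=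
  translate_mem_hits fun _ => add_mem_backCone_add

end Cones

/-! ### Records and regeneration times -/

section Regeneration

variable (P : Params)

/-- The distance, along the space axis, from the line of slope `v` through the origin. -/
def level (v : ℝ) (z : ℤ × ℤ) : ℝ := z.1 - v * z.2

/-- The regeneration event at `y`. -/
def Config.Regenerates (c : Config) (y : ℤ × ℤ) : Prop :=
  c.paths ∩ crossing P.v y = ∅ ∧ ∀ n, c.walk P y n ∈ cone P.v y

/-- The `k`-th record is reached at time `n`. -/
def Config.IsRecord (c : Config) (k n : ℕ) : Prop :=
  (1 - P.v) * k ≤ level P.v (c.walk P 0 n) ∧ ∀ m < n, level P.v (c.walk P 0 m) < (1 - P.v) * k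

/-- Some record is reached at time `n`. -/
def Config.IsRecordTime (c : Config) (n : ℕ) : Prop := ∃ k, 1 ≤ k ∧ c.IsRecord P k n

/-- The time `n` is a record time at which the regeneration event occurs. -/
def Config.IsRegenerationTime (c : Config) (n : ℕ) : Prop :=
  c.IsRecordTime P n ∧ c.Regenerates P (c.walk P 0 n)

/-- The first regeneration time, equal to `0` if there is none. -/
noncomputable def Config.regenerationTime (c : Config) : ℕ := sInf {n | c.IsRegenerationTime P n}

variable {P}

lemma omega_apply_eq_zero (s : Sample) {A : Set (ℤ → ℤ)} (hA : MeasurableSet A) :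
    omega s A = 0 ↔ (toConfig s).paths ∩ A = ∅ := by
  rw [omega, Measure.sum_apply _ hA, ENNReal.tsum_eq_zero]
  simp only [Measure.coe_finsetSum, Finset.sum_apply, Finset.sum_eq_zero_iff, Finset.mem_range,
    Measure.dirac_apply' _ hA, indicator_apply_eq_zero, Pi.one_apply, one_ne_zero, imp_false,
    eq_empty_iff_forall_notMem, toConfig, mem_inter_iff, mem_ofPred_eq, not_and]
  constructor
  · rintro h _ ⟨z, i, hi, rfl⟩
    exact h z i hi
  · exact fun h z i hi => h _ ⟨z, i, hi, rfl⟩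

lemma mem_regEvent_iff (s : Sample) (y : ℤ × ℤ) :
    s ∈ regEvent P.pVac P.pOcc P.v y ↔ (toConfig s).Regenerates P y := by
  simp only [regEvent, staysInCone, mem_inter_iff, mem_ofPred_eq, Config.Regenerates, walkY_eq_walk,
    omega_apply_eq_zero s (measurableSet_crossing _ _)]

lemma sInf_natCast_image_eq_iff {S : Set ℕ} {n : ℕ} :
    sInf ((fun m : ℕ => (m : ℕ∞)) '' S) = n ↔ n ∈ S ∧ ∀ m < n, m ∉ S := by
  rcases S.eq_empty_or_nonempty with rfl | hS
  · simp
  · rw [sInf_image, ← ENat.natCast_sInf hS, Nat.cast_inj]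
    constructor
    · rintro rfl
      exact ⟨Nat.sInf_mem hS, fun m => Nat.notMem_of_lt_sInf⟩
    · rintro ⟨hn, hlt⟩
      exact le_antisymm (Nat.sInf_le hn) (not_lt.1 fun h => hlt _ h (Nat.sInf_mem hS))

lemma recordTime_eq_iff (s : Sample) (k n : ℕ) :
    recordTime P.pVac P.pOcc P.v k s = n ↔ (toConfig s).IsRecord P k n := by
  have level_iff (m : ℕ) : (1 - P.v) * k + P.v * m ≤ (walkX P.pVac P.pOcc s m : ℝ) ↔
      (1 - P.v) * k ≤ level P.v ((toConfig s).walk P 0 m) := by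
    rw [level, walk_snd, walkX, walkY_eq_walk, le_sub_iff_add_le]
    simp
  rw [recordTime, sInf_natCast_image_eq_iff]
  simp only [mem_ofPred_eq, level_iff, not_le, Config.IsRecord]

lemma mem_regIndices_iff (s : Sample) (k : ℕ) :
    k ∈ regIndices P.pVac P.pOcc P.v s ↔ 1 ≤ k ∧ ∃ n, (toConfig s).IsRecord P k n ∧
      (toConfig s).Regenerates P ((toConfig s).walk P 0 n) := by
  simp only [regIndices, mem_ofPred_eq, recordTime_eq_iff, mem_regEvent_iff, walkY_eq_walk]

lemma nonempty_regIndices_iff (s : Sample) :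
    (regIndices P.pVac P.pOcc P.v s).Nonempty ↔ ∃ n, (toConfig s).IsRegenerationTime P n := by
  simp only [Set.Nonempty, mem_regIndices_iff]
  exact ⟨fun ⟨k, hk, n, hn, hreg⟩ => ⟨n, ⟨k, hk, hn⟩, hreg⟩,
    fun ⟨n, ⟨k, hk, hn⟩, hreg⟩ => ⟨k, hk, n, hn, hreg⟩⟩

lemma isRecord_mono (hv : P.v < 1) {c : Config} {j k m n : ℕ} (hm : c.IsRecord P j m)
    (hn : c.IsRecord P k n) (hjk : j ≤ k) : m ≤ n := by
  by_contra! hnm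
  have barrier_mono : (1 - P.v) * j ≤ (1 - P.v) * k :=
    mul_le_mul_of_nonneg_left (by exact_mod_cast hjk) (by linarith)
  linarith [hm.2 n hnm, hn.1]

lemma regTime_eq_regenerationTime (hv : P.v < 1) {s : Sample}
    (h : ∃ n, (toConfig s).IsRegenerationTime P n) :
    regTime P.pVac P.pOcc P.v s = (toConfig s).regenerationTime P := by
  have nonempty := (nonempty_regIndices_iff s).2 h
  obtain ⟨hk, n, hn, hreg⟩ := (mem_regIndices_iff s _).1 (Nat.sInf_mem nonempty)
  rw [regTime, if_pos nonempty, (recordTime_eq_iff s _ n).2 hn, Nat.cast_inj]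
  refine le_antisymm (le_csInf h ?_) (Nat.sInf_le ⟨⟨_, hk, hn⟩, hreg⟩)
  rintro m ⟨⟨j, hj, hm⟩, hregm⟩
  exact isRecord_mono hv hn hm (Nat.sInf_le ((mem_regIndices_iff s j).2 ⟨hj, m, hm, hregm⟩))

lemma regTime_toNat (hv : P.v < 1) (s : Sample) :
    (regTime P.pVac P.pOcc P.v s).toNat = (toConfig s).regenerationTime P := by
  by_cases h : ∃ n, (toConfig s).IsRegenerationTime P n
  · rw [regTime_eq_regenerationTime hv h, ENat.toNat_natCast]
  · rw [regTime, if_neg ((nonempty_regIndices_iff s).not.2 h), ENat.toNat_top,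
      Config.regenerationTime, Nat.sInf_eq_zero.2]
    exact Or.inr (eq_empty_of_forall_notMem (not_exists.1 h))

lemma measurableSet_regenerates (y : ℤ × ℤ) : MeasurableSet {c : Config | c.Regenerates P y} := by
  simp only [Config.Regenerates, ofPred_and, ofPred_forall]
  exact (measurableSet_paths_inter_eq_empty (measurableSet_crossing _ _)).inter
    (.iInter fun n => measurable_walk y n .of_discrete)

lemma measurableSet_isRecord (k n : ℕ) : MeasurableSet {c : Config | c.IsRecord P k n} := by
  simp only [Config.IsRecord, ofPred_and, ofPred_forall]
  refine .inter ?_ (.iInter fun m => .iInter fun _ => ?_)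
  · exact measurable_walk (P := P) 0 n (.of_discrete (s := {z | (1 - P.v) * k ≤ level P.v z}))
  · exact measurable_walk (P := P) 0 m (.of_discrete (s := {z | level P.v z < (1 - P.v) * k}))

lemma measurableSet_isRecordTime (n : ℕ) : MeasurableSet {c : Config | c.IsRecordTime P n} := by
  simp only [Config.IsRecordTime, ofPred_and, ofPred_exists]
  exact .iUnion fun k => (MeasurableSet.const _).inter (measurableSet_isRecord k n)

lemma measurableSet_isRegenerationTime (n : ℕ) :
    MeasurableSet {c : Config | c.IsRegenerationTime P n} :=
  (measurableSet_isRecordTime n).inter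
    (measurableSet_of_walk (p := fun c z => c.Regenerates P z) measurableSet_regenerates 0 n)

lemma measurable_regenerationTime : Measurable fun c : Config => c.regenerationTime P :=
  measurable_sInf_nat measurableSet_isRegenerationTime

end Regeneration

/-! ### The renewal identity -/

section Renewal

variable (P : Params)

/-- The space-time displacement of a block. -/
def displacement (b : Block) : ℤ × ℤ := (b.2 (Fin.last _), b.1)

/-- There is a regeneration time, and the path up to the first one is the block `b`. -/
def Config.HasFirstBlock (c : Config) (b : Block) : Prop :=
  c.IsRegenerationTime P b.1 ∧ (∀ m < b.1, ¬ c.IsRegenerationTime P m) ∧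
    ∀ i : Fin (b.1 + 1), (c.walk P 0 i).1 = b.2 i

/-- The consecutive blocks of the configuration start with the list. -/
def Config.HasFirstBlocks : List Block → Config → Prop
  | [], _ => True
  | b :: bs, c => c.HasFirstBlock P b ∧ Config.HasFirstBlocks bs (c.shift (displacement b))

/-- The regeneration event at the position of time `m`, with the walk observed up to time `t`. -/
def Config.RegeneratesUpTo (c : Config) (t m : ℕ) : Prop :=
  c.paths ∩ crossing P.v (c.walk P 0 m) = ∅ ∧
    ∀ i, m ≤ i → i ≤ t → c.walk P 0 i ∈ cone P.v (c.walk P 0 m)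

/-- What the events that `b` is the first block and, if `r` holds, that there is a regeneration at
the origin, require of the environment before the end of the block. -/
def Config.HasFirstBlockLocally (c : Config) (b : Block) (r : Prop) : Prop :=
  (∀ i : Fin (b.1 + 1), (c.walk P 0 i).1 = b.2 i) ∧ c.IsRecordTime P b.1 ∧
    (∀ m < b.1, ¬ (c.IsRecordTime P m ∧ c.RegeneratesUpTo P b.1 m)) ∧
    (r → c.RegeneratesUpTo P b.1 0)

/-- The configuration seen from the cone based at `a`: the trajectories that hit it and the marks
inside it. -/
noncomputable def Config.futurePart (a : ℤ × ℤ) (c : Config) : Config :=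
  c.restrict (hits (cone P.v a)) (cone P.v a)

/-- The configuration seen from the backward cone based at `a`, without the trajectories that hit
the forward cone. -/
noncomputable def Config.pastPart (a : ℤ × ℤ) (c : Config) : Config :=
  c.restrict (hits (cone P.v a))ᶜ (backCone P.v a)

variable {P}

lemma mem_backCone_of_isRecord (hv : 0 ≤ P.v) {c : Config} {k m n : ℕ} (hn : c.IsRecord P k n)
    (hm : m < n) : c.walk P 0 m ∈ backCone P.v (c.walk P 0 n) := by
  have level_lt := (hn.2 m hm).trans_le hn.1
  have hmn : (m : ℝ) ≤ n := by exact_mod_cast hm.le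
  simp only [level, walk_snd, Prod.snd_zero, zero_add, Int.cast_natCast] at level_lt
  have slope_mul_le := mul_le_mul_of_nonneg_left hmn hv
  refine ⟨?_, by simp [walk_snd, hm.le], ?_⟩
  · rw [← Int.cast_le (R := ℝ)]
    linarith
  · simp only [walk_snd, Prod.snd_zero, zero_add]
    push_cast
    linarith

lemma walk_eq_displacement {c : Config} {b : Block}
    (h : ∀ i : Fin (b.1 + 1), (c.walk P 0 i).1 = b.2 i) : c.walk P 0 b.1 = displacement b :=
  Prod.ext (h (Fin.last _)) (by simp [walk_snd, displacement])

lemma Config.HasFirstBlock.regenerates {c : Config} {b : Block} (h : c.HasFirstBlock P b) :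
    c.Regenerates P (displacement b) :=
  walk_eq_displacement h.2.2 ▸ h.1.2

lemma regenerates_iff_regeneratesUpTo {c : Config} {m t : ℕ} (hmt : m ≤ t)
    (h : c.Regenerates P (c.walk P 0 t)) :
    c.Regenerates P (c.walk P 0 m) ↔ c.RegeneratesUpTo P t m := by
  refine and_congr_right fun _ => ⟨fun stays i hi _ => ?_, fun stays n => ?_⟩
  · simpa only [← walk_add, Nat.add_sub_cancel' hi] using stays (i - m)
  · rw [← walk_add]
    by_cases hn : m + n ≤ t
    · exact stays _ (by omega) hn
    · obtain ⟨j, hj⟩ := Nat.exists_eq_add_of_lt (not_le.1 hn)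
      rw [hj, add_assoc, walk_add]
      exact cone_subset (stays t hmt le_rfl) (h.2 _)

lemma hasFirstBlock_iff_locally {c : Config} {b : Block} {r : Prop}
    (h : c.Regenerates P (displacement b)) :
    ((r → c.Regenerates P 0) ∧ c.HasFirstBlock P b) ↔ c.HasFirstBlockLocally P b r := by
  constructor
  · rintro ⟨hr, ⟨hrec, hreg⟩, hfirst, hwalk⟩
    exact ⟨hwalk, hrec,
      fun m hm hloc => hfirst m hm ⟨hloc.1, (regenerates_iff_regeneratesUpTo hm.le hreg).2 hloc.2⟩,
      fun r' => (regenerates_iff_regeneratesUpTo (Nat.zero_le _) hreg).1 (hr r')⟩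
  · rintro ⟨hwalk, hrec, hfirst, hr⟩
    have hreg : c.Regenerates P (c.walk P 0 b.1) := by rwa [walk_eq_displacement hwalk]
    exact ⟨fun r' => (regenerates_iff_regeneratesUpTo (Nat.zero_le _) hreg).2 (hr r'),
      ⟨hrec, hreg⟩,
      fun m hm h' => hfirst m hm ⟨h'.1, (regenerates_iff_regeneratesUpTo hm.le hreg).1 h'.2⟩, hwalk⟩

lemma isRecord_congr {c c' : Config} {n : ℕ} (h : ∀ m ≤ n, c.walk P 0 m = c'.walk P 0 m) (k : ℕ) :
    c.IsRecord P k n ↔ c'.IsRecord P k n := by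
  rw [Config.IsRecord, Config.IsRecord, h n le_rfl]
  refine and_congr_right fun _ => forall₂_congr fun m hm => ?_
  rw [h m hm.le]

lemma isRecordTime_congr {c c' : Config} {n : ℕ} (h : ∀ m ≤ n, c.walk P 0 m = c'.walk P 0 m) :
    c.IsRecordTime P n ↔ c'.IsRecordTime P n :=
  exists_congr fun k => and_congr_right fun _ => isRecord_congr h k

lemma hasFirstBlockLocally_of_next_eq (hv : 0 ≤ P.v) {c c' : Config} {b : Block} {r : Prop}
    (hnext : ∀ z ∈ backCone P.v (displacement b), c.next P z = c'.next P z)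
    (hpaths : ∀ y, displacement b ∈ cone P.v y →
      (c.paths ∩ crossing P.v y = ∅ ↔ c'.paths ∩ crossing P.v y = ∅))
    (h : c.HasFirstBlockLocally P b r) : c'.HasFirstBlockLocally P b r := by
  obtain ⟨hblock, hrec, hfirst, hr⟩ := h
  obtain ⟨k, -, hk⟩ := id hrec
  have hwalk : ∀ m ≤ b.1, c.walk P 0 m = c'.walk P 0 m := walk_congr fun m hm =>
    hnext _ (walk_eq_displacement hblock ▸ mem_backCone_of_isRecord hv hk hm)
  have isRecordTime_iff (m) (hm : m ≤ b.1) : c.IsRecordTime P m ↔ c'.IsRecordTime P m :=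
    isRecordTime_congr fun j hj => hwalk j (hj.trans hm)
  have regeneratesUpTo_iff (m) (hm : m ≤ b.1) :
      c.RegeneratesUpTo P b.1 m ↔ c'.RegeneratesUpTo P b.1 m := by
    have stays_iff : (∀ i, m ≤ i → i ≤ b.1 → c.walk P 0 i ∈ cone P.v (c.walk P 0 m)) ↔
        ∀ i, m ≤ i → i ≤ b.1 → c'.walk P 0 i ∈ cone P.v (c'.walk P 0 m) :=
      forall₃_congr fun i _ hi => by rw [hwalk i hi, hwalk m hm]
    rw [Config.RegeneratesUpTo, Config.RegeneratesUpTo, ← stays_iff, ← hwalk m hm]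
    exact and_congr_left fun stays => hpaths _ (walk_eq_displacement hblock ▸ stays _ hm le_rfl)
  refine ⟨fun i => ?_, (isRecordTime_iff _ le_rfl).1 hrec, fun m hm => ?_, fun r' => ?_⟩
  · rw [← hwalk i (by omega), hblock]
  · rw [← isRecordTime_iff m hm.le, ← regeneratesUpTo_iff m hm.le]
    exact hfirst m hm
  · exact (regeneratesUpTo_iff 0 (Nat.zero_le _)).1 (hr r')

lemma hasFirstBlockLocally_iff_pastPart (hv : 0 ≤ P.v) {c : Config} {b : Block} {r : Prop}
    (h : c.paths ∩ crossing P.v (displacement b) = ∅) :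
    c.HasFirstBlockLocally P b r ↔ (c.pastPart P (displacement b)).HasFirstBlockLocally P b r := by
  have notMem_hits_cone (w) (hw : w ∈ c.paths) (hback : w ∈ hits (backCone P.v (displacement b))) :
      w ∈ (hits (cone P.v (displacement b)))ᶜ :=
    fun hcone => eq_empty_iff_forall_notMem.1 h w ⟨hw, hcone, hback⟩
  have next_eq (z) (hz : z ∈ backCone P.v (displacement b)) :
      c.next P z = (c.pastPart P (displacement b)).next P z :=
    (next_restrict hz fun w hw hwz => notMem_hits_cone w hw (mem_hits_of_eq hz hwz)).symm
  have paths_inter_eq (y) (hy : displacement b ∈ cone P.v y) :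
      c.paths ∩ crossing P.v y = (c.pastPart P (displacement b)).paths ∩ crossing P.v y :=
    subset_antisymm (fun w ⟨hw, hwy⟩ =>
      ⟨⟨hw, notMem_hits_cone w hw (hits_mono (backCone_subset hy) hwy.2)⟩, hwy⟩)
      (inter_subset_inter_left _ inter_subset_left)
  exact ⟨hasFirstBlockLocally_of_next_eq hv next_eq fun y hy => by rw [paths_inter_eq y hy],
    hasFirstBlockLocally_of_next_eq hv (fun z hz => (next_eq z hz).symm)
      fun y hy => by rw [paths_inter_eq y hy]⟩

lemma next_futurePart {a z : ℤ × ℤ} (hz : z ∈ cone P.v a) (c : Config) :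
    (c.futurePart P a).next P z = c.next P z :=
  next_restrict hz fun _ _ hwz => mem_hits_of_eq hz hwz

lemma regenerates_of_next_eq {c c' : Config} {y : ℤ × ℤ}
    (hnext : ∀ z ∈ cone P.v y, c.next P z = c'.next P z)
    (hpaths : c.paths ∩ crossing P.v y = ∅ → c'.paths ∩ crossing P.v y = ∅)
    (h : c.Regenerates P y) : c'.Regenerates P y :=
  ⟨hpaths h.1, fun n => walk_eq_of_mem hnext h.2 n ▸ h.2 n⟩

lemma regenerates_futurePart {a y : ℤ × ℤ} (h : y ∈ cone P.v a) (c : Config) :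
    (c.futurePart P a).Regenerates P y ↔ c.Regenerates P y := by
  have paths_inter_eq : (c.futurePart P a).paths ∩ crossing P.v y = c.paths ∩ crossing P.v y := by
    rw [Config.futurePart, Config.restrict, inter_assoc,
      inter_eq_self_of_subset_right (crossing_subset_hits h)]
  have next_eq (z) (hz : z ∈ cone P.v y) : (c.futurePart P a).next P z = c.next P z :=
    next_futurePart (cone_subset h hz) c
  exact ⟨regenerates_of_next_eq next_eq (paths_inter_eq ▸ id),
    regenerates_of_next_eq (fun z hz => (next_eq z hz).symm) (paths_inter_eq ▸ id)⟩

lemma futurePart_futurePart {a a' : ℤ × ℤ} (h : a' ∈ cone P.v a) (c : Config) :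
    (c.futurePart P a).futurePart P a' = c.futurePart P a' := by
  rw [Config.futurePart, Config.futurePart, restrict_restrict,
    inter_eq_self_of_subset_right (hits_mono (cone_subset h)),
    inter_eq_self_of_subset_left (cone_subset h), Config.futurePart]

lemma walk_futurePart {c : Config} (h : c.Regenerates P 0) (n : ℕ) :
    (c.futurePart P 0).walk P 0 n = c.walk P 0 n :=
  (walk_eq_of_mem (fun _ hz => (next_futurePart hz c).symm) h.2 n).symm

lemma isRegenerationTime_futurePart {c : Config} (h : c.Regenerates P 0) (n : ℕ) :
    (c.futurePart P 0).IsRegenerationTime P n ↔ c.IsRegenerationTime P n := by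
  rw [Config.IsRegenerationTime, Config.IsRegenerationTime, walk_futurePart h,
    regenerates_futurePart (h.2 n), isRecordTime_congr fun m _ => walk_futurePart h m]

lemma hasFirstBlock_futurePart {c : Config} (h : c.Regenerates P 0) (b : Block) :
    (c.futurePart P 0).HasFirstBlock P b ↔ c.HasFirstBlock P b := by
  simp only [Config.HasFirstBlock, isRegenerationTime_futurePart h, walk_futurePart h]

lemma regenerates_shift {a y : ℤ × ℤ} {c : Config} :
    (c.shift a).Regenerates P y ↔ c.Regenerates P (y + a) := by
  refine and_congr ?_ (forall_congr' fun n => by rw [← walk_shift, add_mem_cone_add])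
  simp only [eq_empty_iff_forall_notMem, mem_inter_iff, not_and, crossing_eq,
    ← translate_mem_hits_cone, ← translate_mem_hits_backCone]
  refine ⟨fun h w hw => h _ (translate_mem_shift_paths.2 hw), fun h w hw => ?_⟩
  simpa [translate_translate, translate_zero] using h _ hw

lemma futurePart_shift (a : ℤ × ℤ) (c : Config) :
    (c.shift a).futurePart P 0 = (c.futurePart P a).shift a := by
  ext x
  · change translate (-a) x ∈ c.paths ∧ _ ↔ translate (-a) x ∈ c.paths ∧ _
    rw [translate_mem_hits_cone, add_neg_cancel]
  · refine congrArg Subtype.val ?_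
    change (cone P.v 0).indicator (fun z => c.mark (z + a)) x =
      (cone P.v a).indicator c.mark (x + a)
    have mem_cone_iff : x + a ∈ cone P.v a ↔ x ∈ cone P.v 0 := by
      rw [← add_mem_cone_add (a := a) (y := 0), zero_add]
    by_cases hx : x ∈ cone P.v 0 <;> simp [hx, mem_cone_iff]

lemma hasFirstBlocks_futurePart (bs : List Block) {c : Config} (h : c.Regenerates P 0) :
    (c.futurePart P 0).HasFirstBlocks P bs ↔ c.HasFirstBlocks P bs := by
  induction bs generalizing c with
  | nil => simp [Config.HasFirstBlocks]
  | cons b bs ih =>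
    rw [Config.HasFirstBlocks, Config.HasFirstBlocks, hasFirstBlock_futurePart h]
    refine and_congr_right fun hfirst => ?_
    have mem_cone : displacement b ∈ cone P.v 0 := walk_eq_displacement hfirst.2.2 ▸ h.2 _
    have regenerates : (c.shift (displacement b)).Regenerates P 0 := by
      rw [regenerates_shift, zero_add]
      exact hfirst.regenerates
    have regenerates' : ((c.futurePart P 0).shift (displacement b)).Regenerates P 0 := by
      rw [regenerates_shift, zero_add, regenerates_futurePart mem_cone]
      exact hfirst.regenerates
    rw [← ih regenerates, ← ih regenerates', futurePart_shift, futurePart_shift,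
      futurePart_futurePart mem_cone]

lemma measurableSet_hasFirstBlock (b : Block) :
    MeasurableSet {c : Config | c.HasFirstBlock P b} := by
  simp only [Config.HasFirstBlock, ofPred_and, ofPred_forall]
  refine (measurableSet_isRegenerationTime _).inter (.inter (.iInter fun m => .iInter fun _ => ?_)
    (.iInter fun i => ?_))
  · exact (measurableSet_isRegenerationTime m).compl
  · exact measurable_walk (P := P) 0 i (.of_discrete (s := {z | z.1 = b.2 i}))

lemma measurableSet_hasFirstBlocks (bs : List Block) :
    MeasurableSet {c : Config | c.HasFirstBlocks P bs} := by
  induction bs with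
  | nil => simp [Config.HasFirstBlocks]
  | cons b bs ih =>
    simp only [Config.HasFirstBlocks, ofPred_and]
    exact (measurableSet_hasFirstBlock b).inter (measurable_shift (displacement b) ih)

lemma measurableSet_regeneratesUpTo (t m : ℕ) :
    MeasurableSet {c : Config | c.RegeneratesUpTo P t m} := by
  refine measurableSet_of_walk (p := fun c z => c.paths ∩ crossing P.v z = ∅ ∧
    ∀ i, m ≤ i → i ≤ t → c.walk P 0 i ∈ cone P.v z) (fun z => ?_) 0 m
  simp only [ofPred_and, ofPred_forall]
  exact (measurableSet_paths_inter_eq_empty (measurableSet_crossing _ _)).inter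
    (.iInter fun i => .iInter fun _ => .iInter fun _ => measurable_walk 0 i .of_discrete)

lemma measurableSet_hasFirstBlockLocally (b : Block) (r : Prop) :
    MeasurableSet {c : Config | c.HasFirstBlockLocally P b r} := by
  simp only [Config.HasFirstBlockLocally, ofPred_and, ofPred_forall]
  refine .inter (.iInter fun i => ?_) (.inter (measurableSet_isRecordTime _) (.inter
    (.iInter fun m => .iInter fun _ => ?_) (.iInter fun _ => measurableSet_regeneratesUpTo _ _)))
  · exact measurable_walk (P := P) 0 i (.of_discrete (s := {z | z.1 = b.2 i}))
  · exact ((measurableSet_isRecordTime m).inter (measurableSet_regeneratesUpTo _ _)).compl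

lemma regenerates_and_hasFirstBlocks_futurePart (a : ℤ × ℤ) (bs : List Block) (c : Config) :
    (c.futurePart P a).Regenerates P a ∧ ((c.futurePart P a).shift a).HasFirstBlocks P bs ↔
      c.Regenerates P a ∧ (c.shift a).HasFirstBlocks P bs := by
  rw [regenerates_futurePart (self_mem_cone _ a)]
  refine and_congr_right fun h => ?_
  rw [← futurePart_shift, hasFirstBlocks_futurePart]
  rwa [regenerates_shift, zero_add]

lemma hasFirstBlocks_cons_iff (hv : 0 ≤ P.v) (c : Config) (b : Block) (bs : List Block)
    (r : Prop) :
    (r → c.Regenerates P 0) ∧ c.HasFirstBlocks P (b :: bs) ↔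
      (c.pastPart P (displacement b)).HasFirstBlockLocally P b r ∧
        c.Regenerates P (displacement b) ∧ (c.shift (displacement b)).HasFirstBlocks P bs := by
  rw [Config.HasFirstBlocks, ← and_assoc, ← and_assoc]
  refine and_congr_left fun _ => ⟨fun h => ?_, fun ⟨hpast, hreg⟩ => ?_⟩
  · have hreg := h.2.regenerates
    exact ⟨(hasFirstBlockLocally_iff_pastPart hv hreg.1).1
      ((hasFirstBlock_iff_locally hreg).1 h), hreg⟩
  · exact (hasFirstBlock_iff_locally hreg).2 ((hasFirstBlockLocally_iff_pastPart hv hreg.1).2 hpast)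

variable (q : Ioo (0 : ℝ) 1) (ρ : ℝ≥0)

variable (P) in
/-- The weight of the block `b` in the renewal identities: the probability that the environment
before the end of `b` is compatible with `b` and, if `r` holds, with a regeneration at `0`. -/
noncomputable def pastProb (b : Block) (r : Prop) : ℝ≥0∞ :=
  configLaw q ρ {c | (c.pastPart P (displacement b)).HasFirstBlockLocally P b r}

lemma measure_imp_regenerates_hasFirstBlocks_cons (hv : 0 ≤ P.v) (b : Block) (bs : List Block)
    (r : Prop) :
    configLaw q ρ {c | (r → c.Regenerates P 0) ∧ c.HasFirstBlocks P (b :: bs)} =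
      pastProb P q ρ b r * configLaw q ρ {c | c.Regenerates P 0 ∧ c.HasFirstBlocks P bs} := by
  set a := displacement b
  set F : Set Config := {c | c.Regenerates P 0 ∧ c.HasFirstBlocks P bs}
  have measurableSet_F : MeasurableSet F :=
    (measurableSet_regenerates 0).inter (measurableSet_hasFirstBlocks bs)
  have mem_preimage_shift (c : Config) : c ∈ Config.shift a ⁻¹' F ↔
      c.Regenerates P a ∧ (c.shift a).HasFirstBlocks P bs := by
    simp [F, regenerates_shift]
  have preimage_futurePart : Config.futurePart P a ⁻¹' (Config.shift a ⁻¹' F) =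
      Config.shift a ⁻¹' F := by
    ext c
    rw [mem_preimage, mem_preimage_shift, mem_preimage_shift,
      regenerates_and_hasFirstBlocks_futurePart]
  have eq_inter : {c | (r → c.Regenerates P 0) ∧ c.HasFirstBlocks P (b :: bs)} =
      Config.pastPart P a ⁻¹' {c | c.HasFirstBlockLocally P b r} ∩
        Config.futurePart P a ⁻¹' (Config.shift a ⁻¹' F) := by
    ext c
    rw [preimage_futurePart, mem_inter_iff, mem_preimage_shift]
    exact hasFirstBlocks_cons_iff hv c b bs r
  have indep : IndepFun (Config.pastPart P a) (Config.futurePart P a) (configLaw q ρ) :=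
    indepFun_restrict q ρ (measurableSet_hits _).compl (measurableSet_hits _) disjoint_compl_left
      (disjoint_cone_backCone _ _).symm
  rw [eq_inter, indep.measure_inter_preimage_eq_mul _ _ (measurableSet_hasFirstBlockLocally b r)
    (measurable_shift a measurableSet_F), preimage_futurePart,
    (measurePreserving_shift q ρ a).measure_preimage measurableSet_F.nullMeasurableSet]
  rfl

lemma measure_regenerates_hasFirstBlocks (hv : 0 ≤ P.v) (bs : List Block) :
    configLaw q ρ {c | c.Regenerates P 0 ∧ c.HasFirstBlocks P bs} =
      (bs.map fun b => pastProb P q ρ b True).prod * configLaw q ρ {c | c.Regenerates P 0} := by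
  induction bs with
  | nil => simp [Config.HasFirstBlocks]
  | cons b bs ih =>
    simpa only [true_imp_iff, ih, List.map_cons, List.prod_cons, mul_assoc] using
      measure_imp_regenerates_hasFirstBlocks_cons q ρ hv b bs True

lemma measure_hasFirstBlock (hv : 0 ≤ P.v) (b : Block) :
    configLaw q ρ {c | c.HasFirstBlock P b} =
      pastProb P q ρ b False * configLaw q ρ {c | c.Regenerates P 0} := by
  simpa [Config.HasFirstBlocks] using
    measure_imp_regenerates_hasFirstBlocks_cons q ρ hv b [] False

lemma measure_regenerates_hasFirstBlock (hv : 0 ≤ P.v) (b : Block) :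
    configLaw q ρ {c | c.Regenerates P 0 ∧ c.HasFirstBlock P b} =
      pastProb P q ρ b True * configLaw q ρ {c | c.Regenerates P 0} := by
  simpa [Config.HasFirstBlocks] using
    measure_imp_regenerates_hasFirstBlocks_cons q ρ hv b [] True

lemma measure_hasFirstBlocks_cons (hv : 0 ≤ P.v) (b : Block) (bs : List Block) :
    configLaw q ρ {c | c.HasFirstBlocks P (b :: bs)} =
      configLaw q ρ {c | c.HasFirstBlock P b} *
        (bs.map fun b => pastProb P q ρ b True).prod := by
  have renewal := measure_imp_regenerates_hasFirstBlocks_cons q ρ hv b bs False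
  simp only [false_imp_iff, true_and] at renewal
  rw [renewal, measure_regenerates_hasFirstBlocks q ρ hv, measure_hasFirstBlock q ρ hv]
  ring

end Renewal

/-! ### Deviations of the trajectories -/

section Deviation

variable (q : Ioo (0 : ℝ) 1) (ρ : ℝ≥0)

lemma integrable_stepLaw (f : ℤ → ℝ) : Integrable f (stepLaw q) :=
  (((integrable_dirac (by simp)).smul_measure ENNReal.ofReal_ne_top).add_measure
    ((integrable_dirac (by simp)).smul_measure ENNReal.ofReal_ne_top)).add_measure
      ((integrable_dirac (by simp)).smul_measure ENNReal.ofReal_ne_top)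

lemma hasSubgaussianMGF_stepLaw : HasSubgaussianMGF (fun x : ℤ => (x : ℝ)) 1 (stepLaw q) := by
  have mem_Icc : ∀ᵐ x : ℤ ∂stepLaw q, (x : ℝ) ∈ Icc (-1 : ℝ) 1 := by
    simp only [stepLaw, ae_add_measure_iff, and_assoc]
    refine ⟨?_, ?_, ?_⟩ <;> exact Measure.ae_smul_measure (by simp [ae_dirac_eq]) _
  have integral_eq_zero : ∫ x : ℤ, (x : ℝ) ∂stepLaw q = 0 := by
    have integrable := integrable_stepLaw q fun x : ℤ => (x : ℝ)
    rw [stepLaw] at integrable ⊢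
    rw [integral_add_measure integrable.left_of_add_measure integrable.right_of_add_measure,
      integral_add_measure integrable.left_of_add_measure.left_of_add_measure
        integrable.left_of_add_measure.right_of_add_measure]
    simp
  convert hasSubgaussianMGF_of_mem_Icc_of_integral_eq_zero (by fun_prop) mem_Icc integral_eq_zero
  norm_num

/-- A trajectory at time `n` has made `|n|` steps, so it is sub-Gaussian with variance proxy
`|n|`. -/
lemma hasSubgaussianMGF_pathLaw (z n : ℤ) :
    HasSubgaussianMGF (fun w : ℤ → ℤ => (w n : ℝ) - z) n.natAbs (pathLaw q z) := by
  obtain ⟨f, hf, path_eq⟩ : ∃ f : ℕ → ℤ, Function.Injective f ∧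
      ∀ e : ℤ → ℤ, twoSidedPath z e n = z + ∑ k ∈ Finset.range n.natAbs, e (f k) := by
    rcases n with n | n
    · exact ⟨fun k => k, Nat.cast_injective, fun e => rfl⟩
    · exact ⟨fun k => -((k : ℤ) + 1), fun a b h => by simpa using h, fun e => rfl⟩
  have indep : iIndepFun (fun (k : ℕ) (e : ℤ → ℤ) => (e (f k) : ℝ)) (stepsLaw q) :=
    (iIndepFun_infinitePi (P := fun _ : ℤ => stepLaw q) (X := fun _ (x : ℤ) => (x : ℝ))
      fun _ => .of_discrete).precomp hf
  have step (k : ℕ) : HasSubgaussianMGF (fun e : ℤ → ℤ => (e (f k) : ℝ)) 1 (stepsLaw q) :=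
    .of_map (X := fun x : ℤ => (x : ℝ)) (measurable_pi_apply (f k)).aemeasurable <| by
      rw [(measurePreserving_eval_infinitePi (fun _ : ℤ => stepLaw q) (f k)).map_eq]
      exact hasSubgaussianMGF_stepLaw q
  have sum := HasSubgaussianMGF.sum_of_iIndepFun indep (c := fun _ => 1)
    (s := Finset.range n.natAbs) fun k _ => step k
  have measurable : Measurable fun w : ℤ → ℤ => (w n : ℝ) - z :=
    Measurable.of_discrete.comp (g := fun x : ℤ => (x : ℝ) - z) (measurable_pi_apply n)
  rw [← HasSubgaussianMGF.id_map_iff measurable.aemeasurable, pathLaw,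
    Measure.map_map measurable (measurable_twoSidedPath z), HasSubgaussianMGF.id_map_iff
      (measurable.comp (measurable_twoSidedPath z)).aemeasurable]
  simpa [path_eq, Function.comp_def] using sum

lemma measure_line_le {Ω : Type*} [MeasurableSpace Ω] {μ : Measure Ω} [IsFiniteMeasure μ]
    {X : Ω → ℝ} {n : ℕ} (hX : HasSubgaussianMGF X n μ) {v : ℝ} (hv : 0 ≤ v) (u : ℝ) :
    μ {x | v * n + u ≤ X x} ≤
      ENNReal.ofReal (Real.exp (-(v * u)) * Real.exp (-(v ^ 2 / 2)) ^ n) := by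
  rw [← ofReal_measureReal]
  refine ENNReal.ofReal_le_ofReal
    ((measure_ge_le_exp_mul_mgf _ hv (hX.integrable_exp_mul v)).trans ?_)
  refine (mul_le_mul_of_nonneg_left (hX.mgf_le v) (Real.exp_pos _).le).trans_eq ?_
  rw [← Real.exp_nat_mul, ← Real.exp_add, ← Real.exp_add, NNReal.coe_natCast]
  ring_nf

/-- The sum over `n` of the bounds `exp (-v² / 2) ^ n`. -/
noncomputable def devConst (v : ℝ) : ℝ := (1 - Real.exp (-(v ^ 2 / 2)))⁻¹

lemma devConst_nonneg (v : ℝ) : 0 ≤ devConst v :=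
  inv_nonneg.2 (sub_nonneg.2 (Real.exp_le_one_iff.2 (neg_nonpos.2 (by positivity))))

lemma tsum_exp_mul_exp_pow {v : ℝ} (hv : 0 < v) (u : ℝ) :
    ∑' n : ℕ, ENNReal.ofReal (Real.exp (-(v * u)) * Real.exp (-(v ^ 2 / 2)) ^ n) =
      ENNReal.ofReal (devConst v * Real.exp (-(v * u))) := by
  have exp_lt_one : Real.exp (-(v ^ 2 / 2)) < 1 :=
    Real.exp_lt_one_iff.2 (neg_lt_zero.2 (by positivity))
  have hasSum := (hasSum_geometric_of_lt_one (Real.exp_pos _).le exp_lt_one).mul_left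
    (Real.exp (-(v * u)))
  rw [← ENNReal.ofReal_tsum_of_nonneg (fun n => by positivity) hasSum.summable, hasSum.tsum_eq,
    mul_comm, devConst]

lemma pathLaw_future_le {v : ℝ} (hv : 0 < v) (u : ℝ) (z : ℤ) :
    pathLaw q z {w | ∃ n : ℕ, v * n + u ≤ (w n : ℝ) - z} ≤
      ENNReal.ofReal (devConst v * Real.exp (-(v * u))) := by
  rw [← tsum_exp_mul_exp_pow hv, ofPred_exists]
  exact (measure_iUnion_le _).trans (ENNReal.tsum_le_tsum fun n =>
    measure_line_le (hasSubgaussianMGF_pathLaw q z n) hv.le u)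

lemma pathLaw_past_le {v : ℝ} (hv : 0 < v) (u : ℝ) (z : ℤ) :
    pathLaw q z {w | ∃ n : ℕ, v * n + u ≤ -((w (-n) : ℝ) - z)} ≤
      ENNReal.ofReal (devConst v * Real.exp (-(v * u))) := by
  rw [← tsum_exp_mul_exp_pow hv, ofPred_exists]
  refine (measure_iUnion_le _).trans (ENNReal.tsum_le_tsum fun n => ?_)
  have hX := (hasSubgaussianMGF_pathLaw q z (-n)).neg
  rw [Int.natAbs_neg] at hX
  exact measure_line_le hX hv.le u

/-- At time `0` the trajectory is at a distance of order `max |z| l` from one of the two cones. -/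
lemma pathLaw_cross_le {v : ℝ} (hv : 0 < v) (hv1 : v ≤ 1) (l : ℕ) (z : ℤ) :
    pathLaw q z (hits (backCone v 0) ∩ hits (cone v (l, l))) ≤
      ENNReal.ofReal (devConst v * Real.exp (-(v / 3 * (1 - v) * l)) *
        Real.exp (-(v / 3 * |(z : ℝ)|))) := by
  have le_future : pathLaw q z (hits (backCone v 0) ∩ hits (cone v (l, l))) ≤
      ENNReal.ofReal (devConst v * Real.exp (-(v * ((1 - v) * l - z)))) := by
    refine (measure_mono ?_).trans (pathLaw_future_le q hv _ z)
    rintro w ⟨-, n, -, hsnd, hslope⟩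
    lift n to ℕ using le_trans (by positivity) hsnd
    refine ⟨n, ?_⟩
    push_cast at hslope
    linarith
  have le_past : pathLaw q z (hits (backCone v 0) ∩ hits (cone v (l, l))) ≤
      ENNReal.ofReal (devConst v * Real.exp (-(v * z))) := by
    refine (measure_mono ?_).trans (pathLaw_past_le q hv _ z)
    rintro w ⟨⟨n, -, hsnd, hslope⟩, -⟩
    obtain ⟨m, rfl⟩ := Int.exists_eq_neg_ofNat hsnd
    refine ⟨m, ?_⟩
    push_cast at hslope
    simp only [Prod.fst_zero, Prod.snd_zero, Int.cast_zero, sub_zero] at hslope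
    linarith
  have gap_nonneg : 0 ≤ (1 - v) * l := mul_nonneg (by linarith) (by positivity)
  have le_of_exponent_le {a : ℝ} (ha : v / 3 * (1 - v) * l + v / 3 * |(z : ℝ)| ≤ a) :
      ENNReal.ofReal (devConst v * Real.exp (-a)) ≤
        ENNReal.ofReal (devConst v * Real.exp (-(v / 3 * (1 - v) * l)) *
          Real.exp (-(v / 3 * |(z : ℝ)|))) := by
    rw [mul_assoc, ← Real.exp_add]
    gcongr
    · exact devConst_nonneg v
    · linarith
  rcases le_or_gt 0 ((1 - v) * (l : ℝ) - 2 * z) with h | h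
  · refine le_future.trans (le_of_exponent_le ?_)
    rcases abs_cases (z : ℝ) with ⟨hz, _⟩ | ⟨hz, _⟩ <;> rw [hz] <;> nlinarith
  · refine le_past.trans (le_of_exponent_le ?_)
    rw [abs_of_nonneg (by linarith)]
    nlinarith

lemma summable_exp_neg_mul_abs {a : ℝ} (ha : 0 < a) :
    Summable fun z : ℤ => Real.exp (-(a * |(z : ℝ)|)) := by
  have summable_nat : Summable fun n : ℕ => Real.exp (-(a * n)) := by
    simpa only [mul_comm, mul_neg] using Real.summable_exp_nat_mul_of_ge (neg_lt_zero.2 ha)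
      fun i => le_rfl
  exact .of_nat_of_neg (by simpa using summable_nat) (by simpa using summable_nat)

/-- The sum over the starting points of the bounds for a single trajectory. -/
noncomputable def crossConst (v : ℝ) : ℝ :=
  ρ * (devConst v * ∑' z : ℤ, Real.exp (-(v / 3 * |(z : ℝ)|)))

lemma intensity_cross_le {v : ℝ} (hv : 0 < v) (hv1 : v ≤ 1) (l : ℕ) :
    intensity q ρ (hits (backCone v 0) ∩ hits (cone v (l, l))) ≤
      ENNReal.ofReal (crossConst ρ v * Real.exp (-(v / 3 * (1 - v) * l))) := by
  have summable := (summable_exp_neg_mul_abs (by positivity : 0 < v / 3)).mul_left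
    (devConst v * Real.exp (-(v / 3 * (1 - v) * l)))
  have devConst_nonneg := devConst_nonneg v
  have tsum_le := ENNReal.tsum_le_tsum fun z => pathLaw_cross_le q hv hv1 l z
  rw [← ENNReal.ofReal_tsum_of_nonneg (fun n => by positivity) summable, tsum_mul_left] at tsum_le
  rw [intensity, Measure.smul_apply, Measure.sum_apply _
    ((measurableSet_hits _).inter (measurableSet_hits _)), smul_eq_mul]
  refine (mul_le_mul_right tsum_le _).trans_eq ?_
  rw [← ENNReal.ofReal_coe_nnreal, ← ENNReal.ofReal_mul (by positivity), crossConst]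
  congr 1
  ring

lemma intensity_crossing_ne_top {v : ℝ} (hv : 0 < v) (hv1 : v ≤ 1) :
    intensity q ρ (crossing v 0) ≠ ∞ := by
  have le_cross := intensity_cross_le q ρ hv hv1 0
  rw [inter_comm] at le_cross
  exact ne_top_of_le_ne_top ENNReal.ofReal_ne_top le_cross

/-- The trajectories through `y` that later exceed the level of `y` by at least `u`. -/
def exceeds (v : ℝ) (y : ℤ × ℤ) (u : ℝ) : Set (ℤ → ℤ) :=
  {w | w y.2 = y.1 ∧ ∃ n : ℕ, u + level v y ≤ level v (w (y.2 + n), y.2 + n)}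

lemma measurableSet_exceeds (v : ℝ) (y : ℤ × ℤ) (u : ℝ) : MeasurableSet (exceeds v y u) := by
  simp only [exceeds, ofPred_and, ofPred_exists]
  refine MeasurableSet.inter ?_ (.iUnion fun n => ?_)
  · exact measurableSet_eq_fun (measurable_pi_apply _) measurable_const
  · exact measurable_pi_apply (X := fun _ : ℤ => ℤ) (y.2 + n)
      (.of_discrete (s := {x | u + level v y ≤ level v (x, y.2 + n)}))

lemma translate_preimage_exceeds (v : ℝ) (y : ℤ × ℤ) (u : ℝ) :
    translate y ⁻¹' exceeds v 0 u = exceeds v y u := by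
  ext w
  simp only [exceeds, translate, mem_preimage, mem_ofPred_eq, Prod.fst_zero, Prod.snd_zero,
    zero_add, sub_eq_zero, level]
  refine and_congr_right fun _ => exists_congr fun n => ?_
  rw [add_comm (n : ℤ) y.2]
  push_cast
  constructor <;> intro h <;> linarith

lemma intensity_exceeds_le {v : ℝ} (hv : 0 < v) (y : ℤ × ℤ) (u : ℝ) :
    intensity q ρ (exceeds v y u) ≤ ENNReal.ofReal (ρ * devConst v * Real.exp (-(v * u))) := by
  have measurableSet := measurableSet_exceeds v 0 u
  have pathLaw_zero : pathLaw q 0 (exceeds v 0 u) ≤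
      ENNReal.ofReal (devConst v * Real.exp (-(v * u))) := by
    refine (measure_mono ?_).trans (pathLaw_future_le q hv u 0)
    rintro w ⟨-, n, hn⟩
    refine ⟨n, ?_⟩
    simp only [level, Prod.fst_zero, Prod.snd_zero, zero_add] at hn
    push_cast at hn ⊢
    linarith
  have pathLaw_of_ne (z : ℤ) (hz : z ≠ 0) : pathLaw q z (exceeds v 0 u) = 0 := by
    rw [pathLaw, Measure.map_apply (measurable_twoSidedPath z) measurableSet]
    convert measure_empty (μ := stepsLaw q)
    exact eq_empty_of_forall_notMem fun e he => hz (by simpa [twoSidedPath] using he.1)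
  rw [← translate_preimage_exceeds, (measurePreserving_translate q ρ y).measure_preimage
    measurableSet.nullMeasurableSet, intensity, Measure.smul_apply,
    Measure.sum_apply _ measurableSet, smul_eq_mul, tsum_eq_single 0 pathLaw_of_ne, mul_assoc,
    ENNReal.ofReal_mul (by positivity), ENNReal.ofReal_coe_nnreal]
  exact mul_le_mul_right pathLaw_zero _

end Deviation

/-! ### Positivity of the probability of regeneration -/

section Positivity

open Filter Topology

variable (P : Params)

/-- The walk from the origin falls behind the line of slope `vStar` by more than `L`. -/
def Config.FallsBehind (c : Config) (vStar : ℝ) (L : ℕ) : Prop :=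
  ∃ n : ℕ, ((c.walk P 0 n).1 : ℝ) < n * vStar - L

/-- The displacement of the walk after `l` steps to the right. -/
def stepsRight (l : ℕ) : ℤ × ℤ := (l, l)

/-- The points from which the first `l` steps start when the walk from `y` goes to the right. -/
def diagonal (y : ℤ × ℤ) (l : ℕ) : Set (ℤ × ℤ) := {z | ∃ i < l, z = y + stepsRight i}

/-- The marks force `l` successive steps to the right from `y`, wherever the trajectories are. -/
def Config.GoesRight (c : Config) (y : ℤ × ℤ) (l : ℕ) : Prop :=
  ∀ i < l, (c.mark (y + stepsRight i) : ℝ) ≤ min P.pVac P.pOcc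

/-- The probability that `l` given marks force steps to the right. -/
noncomputable def goRightProb (l : ℕ) : ℝ≥0∞ :=
  (volume {u : unitInterval | (u : ℝ) ≤ min P.pVac P.pOcc}) ^ l

variable {P} {q : Ioo (0 : ℝ) 1} {ρ : ℝ≥0}

lemma measurableSet_fallsBehind (vStar : ℝ) (L : ℕ) :
    MeasurableSet {c : Config | c.FallsBehind P vStar L} := by
  simp only [Config.FallsBehind, ofPred_exists]
  exact .iUnion fun n => measurable_walk (P := P) 0 n
    (.of_discrete (s := {z : ℤ × ℤ | (z.1 : ℝ) < n * vStar - L}))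

lemma fallsBehind_shift {a : ℤ × ℤ} {c : Config} {vStar : ℝ} {L : ℕ} :
    (c.shift a).FallsBehind P vStar L ↔
      ∃ n : ℕ, ((c.walk P a n).1 : ℝ) < a.1 + n * vStar - L := by
  refine exists_congr fun n => ?_
  have walk_eq := walk_shift (P := P) a 0 c n
  rw [zero_add] at walk_eq
  rw [← walk_eq, Prod.fst_add, Int.cast_add]
  constructor <;> intro h <;> linarith

lemma add_stepsRight_mem_cone {v : ℝ} (hv : v ≤ 1) (a : ℤ × ℤ) (l : ℕ) :
    a + stepsRight l ∈ cone v a := by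
  refine ⟨by simp [stepsRight], by simp [stepsRight], ?_⟩
  simp only [stepsRight, Prod.fst_add, Prod.snd_add, add_sub_cancel_left, Int.cast_natCast]
  exact mul_le_of_le_one_left l.cast_nonneg hv

lemma next_eq_add_of_mark_le {c : Config} {z : ℤ × ℤ}
    (h : (c.mark z : ℝ) ≤ min P.pVac P.pOcc) : c.next P z = z + (1, 1) := by
  obtain ⟨le_pVac, le_pOcc⟩ := le_min_iff.1 h
  rw [Config.next, if_pos]
  tauto

lemma walk_of_goesRight {c : Config} {y : ℤ × ℤ} {l : ℕ} (h : c.GoesRight P y l) :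
    ∀ i ≤ l, c.walk P y i = y + stepsRight i := by
  intro i
  induction i with
  | zero => exact fun _ => (add_zero y).symm
  | succ i ih =>
    intro hi
    rw [walk_succ, ih (by omega), next_eq_add_of_mark_le (h i (by omega)), add_assoc]
    simp [stepsRight]

lemma measurableSet_goesRight (y : ℤ × ℤ) (l : ℕ) :
    MeasurableSet {c : Config | c.GoesRight P y l} := by
  simp only [Config.GoesRight, ofPred_forall]
  refine .iInter fun i => .iInter fun _ => measurableSet_le ?_ measurable_const
  exact measurable_subtype_coe.comp ((measurable_pi_apply _).comp measurable_mark)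

lemma goRightProb_ne_zero (hVac : 0 < P.pVac) (hOcc : 0 < P.pOcc) (l : ℕ) :
    goRightProb P l ≠ 0 := by
  refine pow_ne_zero _ (ne_of_gt ?_)
  have min_pos : 0 < min P.pVac P.pOcc := lt_min hVac hOcc
  let p : unitInterval := ⟨min (min P.pVac P.pOcc) 1, by positivity, min_le_right _ _⟩
  calc 0 < volume (Set.Iic p) := by
        rw [unitInterval.volume_Iic, ENNReal.ofReal_pos]
        exact lt_min min_pos one_pos
    _ ≤ _ := measure_mono fun u (hu : (u : ℝ) ≤ min (min P.pVac P.pOcc) 1) =>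
        hu.trans (min_le_left _ _)

lemma measure_goesRight (y : ℤ × ℤ) (l : ℕ) :
    configLaw q ρ {c | c.GoesRight P y l} = goRightProb P l := by
  let J : Finset (ℤ × ℤ) := (Finset.range l).image fun i => y + stepsRight i
  let B : Set unitInterval := {u | (u : ℝ) ≤ min P.pVac P.pOcc}
  have hB : MeasurableSet B := measurableSet_le measurable_subtype_coe measurable_const
  have goesRight_eq : {c : Config | c.GoesRight P y l} =
      voidEvent ∅ ((J : Set (ℤ × ℤ)).pi fun _ => B) := by
    ext c
    simp [voidEvent, Config.GoesRight, Set.mem_pi, J, B]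
  have card_J : J.card = l := by
    rw [Finset.card_image_of_injective, Finset.card_range]
    intro i j hij
    simpa [stepsRight] using hij
  rw [goesRight_eq, configLaw_voidEvent q ρ .empty (.pi J.countable_toSet fun _ _ => hB),
    measure_empty, expNeg_zero, one_mul, markLaw, Measure.infinitePi_pi _ (fun _ _ => hB),
    Finset.prod_const, goRightProb, card_J]

lemma measure_goesRight_inter (y : ℤ × ℤ) (l : ℕ) {E : Set Config} (hE : MeasurableSet E)
    (hloc : ∀ c, c.restrict univ (diagonal y l)ᶜ ∈ E ↔ c ∈ E) :
    configLaw q ρ ({c | c.GoesRight P y l} ∩ E) = goRightProb P l * configLaw q ρ E := by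
  have indep := indepFun_restrict q ρ .empty .univ
    (disjoint_bot_left : Disjoint ∅ (univ : Set (ℤ → ℤ)))
    (disjoint_compl_right : Disjoint (diagonal y l) (diagonal y l)ᶜ)
  have goesRight_eq : Config.restrict ∅ (diagonal y l) ⁻¹' {c | c.GoesRight P y l} =
      {c | c.GoesRight P y l} := by
    ext c
    refine forall₂_congr fun i hi => ?_
    have mem_diagonal : y + stepsRight i ∈ diagonal y l := ⟨i, hi, rfl⟩
    simp [Config.restrict, mem_diagonal]
  have E_eq : Config.restrict univ (diagonal y l)ᶜ ⁻¹' E = E := ext hloc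
  have inter_eq := indep.measure_inter_preimage_eq_mul _ _ (measurableSet_goesRight (P := P) y l) hE
  rwa [goesRight_eq, E_eq, measure_goesRight] at inter_eq

lemma regenerates_of_goesRight {c : Config} {vStar : ℝ} {l L : ℕ} (hv0 : 0 ≤ P.v)
    (hv1 : P.v ≤ 1) (hvStar : P.v ≤ vStar) (hL : L ≤ (1 - P.v) * l)
    (hcross : c.paths ∩ crossing P.v 0 = ∅) (hright : c.GoesRight P 0 l)
    (hahead : ¬(c.shift (stepsRight l)).FallsBehind P vStar L) : c.Regenerates P 0 := by
  refine ⟨hcross, fun n => ?_⟩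
  rcases le_total n l with hn | hn
  · rw [walk_of_goesRight hright n hn]
    exact add_stepsRight_mem_cone hv1 0 n
  · obtain ⟨m, rfl⟩ := Nat.exists_eq_add_of_le hn
    rw [fallsBehind_shift] at hahead
    push Not at hahead
    have slope_le : P.v * (l + m) ≤ (c.walk P (stepsRight l) m).1 := by
      have := hahead m
      simp only [stepsRight, Int.cast_natCast] at this ⊢
      nlinarith [mul_le_mul_of_nonneg_left hvStar m.cast_nonneg]
    have fst_nonneg : (0 : ℝ) ≤ (c.walk P (stepsRight l) m).1 := le_trans (by positivity) slope_le
    rw [walk_add, walk_of_goesRight hright l le_rfl, zero_add]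
    refine ⟨by exact_mod_cast fst_nonneg, ?_, ?_⟩ <;> rw [walk_snd]
    · simp only [stepsRight, Prod.snd_zero]
      positivity
    · simpa [stepsRight] using slope_le

lemma shift_restrict_fallsBehind_iff {c : Config} {vStar : ℝ} {l L : ℕ} :
    ((c.restrict univ (diagonal 0 l)ᶜ).shift (stepsRight l)).FallsBehind P vStar L ↔
      (c.shift (stepsRight l)).FallsBehind P vStar L := by
  have notMem_diagonal (n : ℕ) : c.walk P (stepsRight l) n ∈ (diagonal 0 l)ᶜ := by
    rintro ⟨i, hi, h⟩
    have snd_eq := congrArg Prod.snd h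
    simp only [walk_snd, stepsRight, Prod.snd_add, Prod.snd_zero] at snd_eq
    omega
  rw [fallsBehind_shift, fallsBehind_shift]
  refine exists_congr fun n => ?_
  rw [← walk_eq_of_mem (fun z hz => (next_restrict hz fun _ _ _ => mem_univ _).symm)
    notMem_diagonal n]

lemma measure_regenerates_ne_zero {vStar : ℝ} (hv0 : 0 < P.v) (hv1 : P.v < 1)
    (hvStar : P.v ≤ vStar) (hVac : 0 < P.pVac) (hOcc : 0 < P.pOcc)
    (hslow : Tendsto (fun L : ℕ => configLaw q ρ {c | c.FallsBehind P vStar L}) atTop (𝓝 0)) :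
    configLaw q ρ {c | c.Regenerates P 0} ≠ 0 := by
  have crossing_ne_top := intensity_crossing_ne_top q ρ hv0 hv1.le
  obtain ⟨L, hL⟩ := (hslow.eventually (gt_mem_nhds
    (pos_iff_ne_zero.2 (expNeg_ne_zero crossing_ne_top)))).exists
  obtain ⟨l, hl⟩ := exists_nat_ge (L / (1 - P.v))
  rw [div_le_iff₀' (by linarith)] at hl
  set V : Set Config := {c | c.paths ∩ crossing P.v 0 = ∅}
  set F : Set Config := Config.shift (stepsRight l) ⁻¹' {c | c.FallsBehind P vStar L}
  have hV : MeasurableSet V := measurableSet_paths_inter_eq_empty (measurableSet_crossing _ _)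
  have hF : MeasurableSet F := measurable_shift _ (measurableSet_fallsBehind vStar L)
  have measure_diff_ne_zero : configLaw q ρ (V \ F) ≠ 0 := by
    refine (tsub_pos_of_lt ?_).trans_le le_measure_sdiff |>.ne'
    rw [configLaw_paths_inter_eq_empty q ρ (measurableSet_crossing _ _),
      (measurePreserving_shift q ρ _).measure_preimage
        (measurableSet_fallsBehind vStar L).nullMeasurableSet]
    exact hL
  have goesRight_inter := measure_goesRight_inter (P := P) (q := q) (ρ := ρ) 0 l (hV.diff hF)
    fun c => and_congr (by simp [V, Config.restrict]) (not_congr shift_restrict_fallsBehind_iff)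
  have subset_regenerates : {c | c.GoesRight P 0 l} ∩ (V \ F) ⊆ {c | c.Regenerates P 0} :=
    fun c ⟨hright, hcross, hahead⟩ =>
      regenerates_of_goesRight hv0.le hv1.le hvStar hl hcross hright hahead
  refine ne_of_gt (lt_of_lt_of_le ?_ (measure_mono subset_regenerates))
  rw [goesRight_inter]
  exact ENNReal.mul_pos (goRightProb_ne_zero hVac hOcc l) measure_diff_ne_zero

lemma measure_regenerates (a : ℤ × ℤ) :
    configLaw q ρ {c | c.Regenerates P a} = configLaw q ρ {c | c.Regenerates P 0} := by
  rw [← (measurePreserving_shift q ρ a).measure_preimage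
    (measurableSet_regenerates 0).nullMeasurableSet]
  simp only [preimage_ofPred_eq, regenerates_shift, zero_add]

end Positivity

/-! ### Attempts at regeneration -/

section Attempts

open Filter Topology

variable (P : Params)

/-- Finite space-time paths, given by the number of their steps and the points they visit. -/
abbrev LatticePath : Type := Σ n : ℕ, Fin (n + 1) → ℤ × ℤ

/-- The points of the path `p` before its end. -/
def before {n : ℕ} (p : Fin (n + 1) → ℤ × ℤ) : Set (ℤ × ℤ) := range fun i : Fin n => p i.castSucc

/-- The walk from the origin follows the path `p`. -/
def followsPath {n : ℕ} (p : Fin (n + 1) → ℤ × ℤ) : Set Config :=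
  {c | ∀ i : Fin (n + 1), c.walk P 0 i = p i}

/-- The walk from the origin follows the path `x`, at the end of which it reaches the `k`-th
record. -/
def recordPathEvent (k : ℕ) (x : LatticePath) : Set Config :=
  followsPath P x.2 ∩ {c | c.IsRecord P k x.1}

/-- The trajectories that hit both the backward cone based at `a` and the cone based at the point
reached from `a` by `l` steps to the right. -/
def linking (v : ℝ) (a : ℤ × ℤ) (l : ℕ) : Set (ℤ → ℤ) :=
  hits (backCone v a) ∩ hits (cone v (a + stepsRight l))

/-- The `k`-th record is reached, and no trajectory links the backward cone based at its position
with the cone reached after `l` further steps to the right. -/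
def unlinkedRecord (k l : ℕ) : Set Config :=
  {c | ∃ n, c.IsRecord P k n ∧ c.paths ∩ linking P.v (c.walk P 0 n) l = ∅}

/-- The configuration seen from the backward cone based at `a`: the trajectories that hit it and
the marks inside it. -/
noncomputable def Config.exploredPart (a : ℤ × ℤ) (c : Config) : Config :=
  c.restrict (hits (backCone P.v a)) (backCone P.v a)

/-- The configuration seen from the cone based at `a`, without the trajectories that hit the
backward cone. -/
noncomputable def Config.freshPart (a : ℤ × ℤ) (c : Config) : Config :=
  c.restrict (hits (backCone P.v a))ᶜ (cone P.v a)

/-- The success of an attempt at regeneration from `a`: in the fresh part of the configuration, the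
walk makes `l` steps to the right, and then regenerates. -/
def attemptEvent (a : ℤ × ℤ) (l : ℕ) : Set Config :=
  Config.freshPart P a ⁻¹' {c | c.GoesRight P a l ∧ c.Regenerates P (a + stepsRight l)}

variable {P} {q : Ioo (0 : ℝ) 1} {ρ : ℝ≥0}

lemma level_next_le (c : Config) (z : ℤ × ℤ) :
    level P.v (c.next P z) ≤ level P.v z + (1 - P.v) := by
  have fst_le : ((c.next P z).1 : ℝ) ≤ z.1 + 1 := by exact_mod_cast next_fst_le (P := P) c z
  rw [level, level, next_snd]
  push_cast
  linarith

lemma level_walk_le (c : Config) (n : ℕ) : level P.v (c.walk P 0 n) ≤ (1 - P.v) * n := by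
  induction n with
  | zero => simp [walk_zero, level]
  | succ n ih =>
    rw [walk_succ]
    push_cast
    linarith [level_next_le (P := P) c (c.walk P 0 n)]

lemma isRecord_unique {c : Config} {k m n : ℕ} (hm : c.IsRecord P k m) (hn : c.IsRecord P k n) :
    m = n := by
  rcases lt_trichotomy m n with hmn | rfl | hnm
  exacts [absurd hm.1 (hn.2 m hmn).not_ge, rfl, absurd hn.1 (hm.2 n hnm).not_ge]

lemma exists_isRecord {c : Config} {k n : ℕ} (h : (1 - P.v) * k ≤ level P.v (c.walk P 0 n)) :
    ∃ t ≤ n, c.IsRecord P k t := by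
  classical
  have hex : ∃ t, (1 - P.v) * k ≤ level P.v (c.walk P 0 t) := ⟨n, h⟩
  exact ⟨Nat.find hex, Nat.find_min' hex h, Nat.find_spec hex,
    fun m hm => not_le.1 (Nat.find_min hex hm)⟩

lemma le_of_isRecord (hv1 : P.v < 1) {c : Config} {k n : ℕ} (h : c.IsRecord P k n) : k ≤ n := by
  exact_mod_cast le_of_mul_le_mul_left (h.1.trans (level_walk_le c n)) (sub_pos.2 hv1)

lemma level_walk_lt_of_isRecord (hv1 : P.v < 1) {c : Config} {k n : ℕ} (hk : 1 ≤ k)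
    (h : c.IsRecord P k n) : level P.v (c.walk P 0 n) < (1 - P.v) * (k + 1) := by
  obtain ⟨m, rfl⟩ := Nat.exists_eq_add_of_le' (hk.trans (le_of_isRecord hv1 h))
  rw [walk_succ]
  linarith [h.2 m m.lt_succ_self, level_next_le (P := P) c (c.walk P 0 m)]

lemma level_walk_add_of_goesRight {c : Config} {n l : ℕ} (h : c.GoesRight P (c.walk P 0 n) l)
    {i : ℕ} (hi : i ≤ l) :
    level P.v (c.walk P 0 (n + i)) = level P.v (c.walk P 0 n) + (1 - P.v) * i := by
  rw [walk_add, walk_of_goesRight h i hi]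
  simp only [level, stepsRight, Prod.fst_add, Prod.snd_add]
  push_cast
  ring

lemma isRecord_add_of_goesRight (hv1 : P.v < 1) {c : Config} {k n l : ℕ} (hk : 1 ≤ k)
    (h : c.IsRecord P k n) (hright : c.GoesRight P (c.walk P 0 n) l) :
    c.IsRecord P (k + l) (n + l) := by
  refine ⟨?_, fun m hm => ?_⟩
  · rw [level_walk_add_of_goesRight hright le_rfl]
    push_cast
    linarith [h.1]
  rcases lt_or_ge m n with hmn | hmn
  · refine (h.2 m hmn).trans_le (mul_le_mul_of_nonneg_left ?_ (sub_pos.2 hv1).le)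
    exact_mod_cast Nat.le_add_right k l
  · obtain ⟨i, rfl⟩ := Nat.exists_eq_add_of_le hmn
    have hil : (i : ℝ) + 1 ≤ l := by exact_mod_cast (by omega : i + 1 ≤ l)
    rw [level_walk_add_of_goesRight hright (by omega)]
    push_cast
    linarith [level_walk_lt_of_isRecord hv1 hk h,
      mul_le_mul_of_nonneg_left hil (sub_pos.2 hv1).le]

lemma walk_of_mem_followsPath {c : Config} {n : ℕ} {p : Fin (n + 1) → ℤ × ℤ}
    (h : c ∈ followsPath P p) : c.walk P 0 n = p (Fin.last n) :=
  h (Fin.last n)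

lemma measurableSet_followsPath {n : ℕ} (p : Fin (n + 1) → ℤ × ℤ) :
    MeasurableSet (followsPath P p) := by
  simp only [followsPath, ofPred_forall]
  exact .iInter fun i => measurable_walk (P := P) 0 i (measurableSet_singleton (p i))

lemma disjoint_followsPath {n : ℕ} :
    Pairwise (Function.onFun Disjoint fun p : Fin (n + 1) → ℤ × ℤ => followsPath P p) :=
  fun _ _ hne => Set.disjoint_left.2 fun _ h h' => hne (funext fun i => (h i).symm.trans (h' i))

lemma iUnion_followsPath (n : ℕ) : ⋃ p : Fin (n + 1) → ℤ × ℤ, followsPath P p = univ :=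
  eq_univ_of_forall fun c => mem_iUnion.2 ⟨fun i => c.walk P 0 i, fun _ => rfl⟩

lemma mem_followsPath_of_next_eq {c c' : Config} {n : ℕ} {p : Fin (n + 1) → ℤ × ℤ}
    (hnext : ∀ z ∈ before p, c.next P z = c'.next P z) (h : c ∈ followsPath P p) :
    c' ∈ followsPath P p := by
  have walk_eq : ∀ m ≤ n, c.walk P 0 m = c'.walk P 0 m := walk_congr fun m hm =>
    hnext _ ⟨⟨m, hm⟩, (h (Fin.castSucc ⟨m, hm⟩)).symm⟩
  exact fun i => walk_eq i (by omega) ▸ h i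

lemma restrict_mem_followsPath_iff {n : ℕ} {p : Fin (n + 1) → ℤ × ℤ} {B : Set (ℤ → ℤ)}
    {D : Set (ℤ × ℤ)} (hD : before p ⊆ D) (hB : hits (before p) ⊆ B) (c : Config) :
    c.restrict B D ∈ followsPath P p ↔ c ∈ followsPath P p := by
  have next_eq (z) (hz : z ∈ before p) : (c.restrict B D).next P z = c.next P z :=
    next_restrict (hD hz) fun _ _ hwz => hB (mem_hits_of_eq hz hwz)
  exact ⟨mem_followsPath_of_next_eq next_eq,
    mem_followsPath_of_next_eq fun z hz => (next_eq z hz).symm⟩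

lemma measurableSet_recordPathEvent (k : ℕ) (x : LatticePath) :
    MeasurableSet (recordPathEvent P k x) :=
  (measurableSet_followsPath _).inter (measurableSet_isRecord _ _)

lemma disjoint_recordPathEvent (k : ℕ) :
    Pairwise (Function.onFun Disjoint (recordPathEvent P k)) := by
  rintro ⟨n, p⟩ ⟨n', p'⟩ hne
  refine Set.disjoint_left.2 ?_
  rintro c ⟨hp, hn⟩ ⟨hp', hn'⟩
  obtain rfl : n = n' := isRecord_unique hn hn'
  exact hne (congrArg _ (funext fun i => (hp i).symm.trans (hp' i)))

lemma mem_iUnion_recordPathEvent {c : Config} {k n : ℕ} (h : c.IsRecord P k n) :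
    c ∈ ⋃ x, recordPathEvent P k x :=
  mem_iUnion.2 ⟨⟨n, fun i => c.walk P 0 i⟩, fun _ => rfl, h⟩

lemma recordPathEvent_eq (k : ℕ) (x : LatticePath) :
    recordPathEvent P k x = followsPath P x.2 ∩
      {_c | (1 - P.v) * k ≤ level P.v (x.2 (Fin.last _)) ∧
        ∀ i : Fin x.1, level P.v (x.2 i.castSucc) < (1 - P.v) * k} := by
  ext c
  refine and_congr_right fun h => and_congr (by rw [walk_of_mem_followsPath h]) ?_
  rw [Fin.forall_iff]
  refine forall₂_congr fun m hm => ?_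
  rw [← h (Fin.castSucc ⟨m, hm⟩), Fin.val_castSucc]

lemma restrict_mem_recordPathEvent_iff {k : ℕ} {x : LatticePath} {B : Set (ℤ → ℤ)}
    {D : Set (ℤ × ℤ)} (hD : before x.2 ⊆ D) (hB : hits (before x.2) ⊆ B) (c : Config) :
    c.restrict B D ∈ recordPathEvent P k x ↔ c ∈ recordPathEvent P k x := by
  rw [recordPathEvent_eq]
  exact and_congr_left fun _ => restrict_mem_followsPath_iff hD hB c

lemma before_subset_backCone (hv0 : 0 ≤ P.v) {k : ℕ} {x : LatticePath} {c : Config}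
    (h : c ∈ recordPathEvent P k x) : before x.2 ⊆ backCone P.v (x.2 (Fin.last _)) := by
  rintro _ ⟨i, rfl⟩
  beta_reduce
  rw [← h.1 i.castSucc, ← walk_of_mem_followsPath h.1]
  exact mem_backCone_of_isRecord hv0 h.2 i.2

lemma measurableSet_linking (v : ℝ) (a : ℤ × ℤ) (l : ℕ) : MeasurableSet (linking v a l) :=
  (measurableSet_hits _).inter (measurableSet_hits _)

lemma measurableSet_unlinkedRecord (k l : ℕ) : MeasurableSet (unlinkedRecord P k l) := by
  simp only [unlinkedRecord, ofPred_exists, ofPred_and]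
  exact .iUnion fun n => (measurableSet_isRecord k n).inter (measurableSet_of_walk
    (p := fun c z => c.paths ∩ linking P.v z l = ∅)
    (fun z => measurableSet_paths_inter_eq_empty (measurableSet_linking _ _ _)) 0 n)

lemma mem_unlinkedRecord_iff {c : Config} {k l : ℕ} {x : LatticePath}
    (hx : c ∈ recordPathEvent P k x) :
    c ∈ unlinkedRecord P k l ↔ c.paths ∩ linking P.v (x.2 (Fin.last _)) l = ∅ := by
  rw [← walk_of_mem_followsPath hx.1]
  refine ⟨?_, fun h => ⟨x.1, hx.2, h⟩⟩
  rintro ⟨n, hn, h⟩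
  rwa [isRecord_unique hx.2 hn]

lemma goesRight_freshPart (hv1 : P.v ≤ 1) {c : Config} {a : ℤ × ℤ} {l : ℕ} :
    (c.freshPart P a).GoesRight P a l ↔ c.GoesRight P a l :=
  forall₂_congr fun i _ => by
    simp [Config.freshPart, Config.restrict, add_stepsRight_mem_cone hv1 a i]

lemma regenerates_freshPart (hv1 : P.v ≤ 1) {c : Config} {a : ℤ × ℤ} {l : ℕ}
    (h : c.paths ∩ linking P.v a l = ∅) :
    (c.freshPart P a).Regenerates P (a + stepsRight l) ↔ c.Regenerates P (a + stepsRight l) := by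
  set a' := a + stepsRight l
  have futurePart_freshPart : (c.freshPart P a).futurePart P a' = c.futurePart P a' := by
    rw [Config.freshPart, Config.futurePart, restrict_restrict, Config.futurePart,
      inter_eq_self_of_subset_left (cone_subset (add_stepsRight_mem_cone hv1 a l)),
      Config.restrict, Config.restrict, ← inter_assoc]
    congr 1
    refine subset_antisymm (inter_subset_inter_left _ inter_subset_left) ?_
    rintro w ⟨hw, hwa'⟩
    exact ⟨⟨hw, fun hwa => eq_empty_iff_forall_notMem.1 h w ⟨hw, hwa, hwa'⟩⟩, hwa'⟩
  rw [← regenerates_futurePart (self_mem_cone P.v a') (c.freshPart P a), futurePart_freshPart,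
    regenerates_futurePart (self_mem_cone P.v a')]

lemma regenerates_freshPart_of_regenerates (hv1 : P.v ≤ 1) {c : Config} {a : ℤ × ℤ} {l : ℕ}
    (h : c.Regenerates P (a + stepsRight l)) :
    (c.freshPart P a).Regenerates P (a + stepsRight l) := by
  refine (regenerates_freshPart hv1 (eq_empty_of_forall_notMem ?_)).2 h
  rintro w ⟨hw, hwa, hwa'⟩
  exact eq_empty_iff_forall_notMem.1 h.1 w
    ⟨hw, hwa', hits_mono (backCone_subset (add_stepsRight_mem_cone hv1 a l)) hwa⟩

lemma regenerates_freshPart_restrict_compl_diagonal (a : ℤ × ℤ) (l : ℕ) (c : Config) :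
    ((c.restrict univ (diagonal a l)ᶜ).freshPart P a).Regenerates P (a + stepsRight l) ↔
      (c.freshPart P a).Regenerates P (a + stepsRight l) := by
  set a' := a + stepsRight l with ha'
  have disjoint_diagonal : cone P.v a' ⊆ (diagonal a l)ᶜ := by
    rintro z ⟨-, hz, -⟩ ⟨i, hi, rfl⟩
    simp only [ha', stepsRight, Prod.snd_add] at hz
    omega
  rw [← regenerates_futurePart (self_mem_cone P.v a'),
    ← regenerates_futurePart (self_mem_cone P.v a') (c.freshPart P a), Config.freshPart,
    Config.freshPart, restrict_restrict, Config.futurePart, Config.futurePart, restrict_restrict,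
    restrict_restrict, univ_inter, inter_comm (cone P.v a), ← inter_assoc,
    inter_eq_self_of_subset_left disjoint_diagonal]

lemma measurable_freshPart (a : ℤ × ℤ) : Measurable (Config.freshPart P a) :=
  measurable_restrict (measurableSet_hits _).compl _

lemma measure_attemptEvent_ge (hv1 : P.v ≤ 1) (a : ℤ × ℤ) (l : ℕ) :
    goRightProb P l * configLaw q ρ {c | c.Regenerates P 0} ≤
      configLaw q ρ (attemptEvent P a l) := by
  have attemptEvent_eq : attemptEvent P a l = {c | c.GoesRight P a l} ∩
      Config.freshPart P a ⁻¹' {c | c.Regenerates P (a + stepsRight l)} :=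
    ext fun c => and_congr_left' (goesRight_freshPart hv1)
  rw [attemptEvent_eq, measure_goesRight_inter a l
    (measurable_freshPart a (measurableSet_regenerates _))
    (regenerates_freshPart_restrict_compl_diagonal a l), ← measure_regenerates (a + stepsRight l)]
  gcongr
  exact fun c hc => regenerates_freshPart_of_regenerates hv1 hc

lemma measure_inter_attemptEvent {a : ℤ × ℤ} {l : ℕ} {S : Set Config} (hS : MeasurableSet S)
    (hexplored : Config.exploredPart P a ⁻¹' S = S) :
    configLaw q ρ (S ∩ attemptEvent P a l) =
      configLaw q ρ S * configLaw q ρ (attemptEvent P a l) := by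
  have indep : IndepFun (Config.exploredPart P a) (Config.freshPart P a) (configLaw q ρ) :=
    indepFun_restrict q ρ (measurableSet_hits _) (measurableSet_hits _).compl disjoint_compl_right
      (disjoint_cone_backCone _ _).symm
  have inter_eq := indep.measure_inter_preimage_eq_mul S
    {c | c.GoesRight P a l ∧ c.Regenerates P (a + stepsRight l)} hS
    ((measurableSet_goesRight a l).inter (measurableSet_regenerates _))
  rwa [hexplored] at inter_eq

lemma isRegenerationTime_of_attempt (hv1 : P.v < 1) {c : Config} {k l n : ℕ} (hk : 1 ≤ k)
    (hrec : c.IsRecord P k n) (hunlinked : c.paths ∩ linking P.v (c.walk P 0 n) l = ∅)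
    (hattempt : c ∈ attemptEvent P (c.walk P 0 n) l) : c.IsRegenerationTime P (n + l) := by
  have goesRight := (goesRight_freshPart hv1.le).1 hattempt.1
  refine ⟨⟨k + l, by omega, isRecord_add_of_goesRight hv1 hk hrec goesRight⟩, ?_⟩
  rw [walk_add, walk_of_goesRight goesRight l le_rfl]
  exact (regenerates_freshPart hv1.le hunlinked).1 hattempt.2

lemma preimage_exploredPart_eq_self {k l : ℕ} {G : Set Config}
    (hG : ∀ (c : Config) (n : ℕ), c.IsRecord P k n →
      (c.exploredPart P (c.walk P 0 n) ∈ G ↔ c ∈ G)) {x : LatticePath}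
    (hbefore : before x.2 ⊆ backCone P.v (x.2 (Fin.last _))) :
    Config.exploredPart P (x.2 (Fin.last _)) ⁻¹'
      (recordPathEvent P k x ∩ (G ∩ unlinkedRecord P k l)) =
        recordPathEvent P k x ∩ (G ∩ unlinkedRecord P k l) := by
  ext c
  have explored_mem_iff :
      c.exploredPart P (x.2 (Fin.last _)) ∈ recordPathEvent P k x ↔ c ∈ recordPathEvent P k x :=
    restrict_mem_recordPathEvent_iff hbefore (hits_mono hbefore) c
  refine (and_congr_left' explored_mem_iff).trans (and_congr_right fun hc => and_congr ?_ ?_)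
  · rw [← hG c x.1 hc.2, walk_of_mem_followsPath hc.1]
  · rw [mem_unlinkedRecord_iff hc, mem_unlinkedRecord_iff (explored_mem_iff.2 hc),
      Config.exploredPart, Config.restrict, inter_assoc, linking, ← inter_assoc (hits _),
      inter_self]

lemma measure_attempt_inter_recordPathEvent_ge (hv0 : 0 ≤ P.v) (hv1 : P.v < 1) {k l : ℕ}
    (hk : 1 ≤ k) {G : Set Config} (hGm : MeasurableSet G)
    (hG : ∀ (c : Config) (n : ℕ), c.IsRecord P k n →
      (c.exploredPart P (c.walk P 0 n) ∈ G ↔ c ∈ G)) (x : LatticePath) :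
    goRightProb P l * configLaw q ρ {c | c.Regenerates P 0} *
        configLaw q ρ (recordPathEvent P k x ∩ (G ∩ unlinkedRecord P k l)) ≤
      configLaw q ρ (recordPathEvent P k x ∩ (G ∩ {c | ∃ n, c.IsRegenerationTime P n})) := by
  set S : Set Config := recordPathEvent P k x ∩ (G ∩ unlinkedRecord P k l)
  have measurableSet_S : MeasurableSet S :=
    (measurableSet_recordPathEvent k x).inter (hGm.inter (measurableSet_unlinkedRecord k l))
  rcases S.eq_empty_or_nonempty with hempty | ⟨c₀, hc₀⟩
  · simp [hempty]
  have before_subset := before_subset_backCone hv0 hc₀.1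
  have preimage_S := preimage_exploredPart_eq_self (l := l) hG before_subset
  have inter_subset : S ∩ attemptEvent P (x.2 (Fin.last _)) l ⊆
      recordPathEvent P k x ∩ (G ∩ {c | ∃ n, c.IsRegenerationTime P n}) := by
    rintro c ⟨⟨hc, hcG, hunlinked⟩, hattempt⟩
    rw [mem_unlinkedRecord_iff hc, ← walk_of_mem_followsPath hc.1] at hunlinked
    rw [← walk_of_mem_followsPath hc.1] at hattempt
    exact ⟨hc, hcG, _, isRegenerationTime_of_attempt hv1 hk hc.2 hunlinked hattempt⟩
  calc goRightProb P l * configLaw q ρ {c | c.Regenerates P 0} * configLaw q ρ S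
      ≤ configLaw q ρ (attemptEvent P (x.2 (Fin.last _)) l) * configLaw q ρ S := by
        gcongr
        exact measure_attemptEvent_ge hv1.le _ l
    _ = configLaw q ρ (S ∩ attemptEvent P (x.2 (Fin.last _)) l) := by
        rw [measure_inter_attemptEvent measurableSet_S preimage_S, mul_comm]
    _ ≤ _ := measure_mono inter_subset

/-- By `hG`, the event `G` is decided by what has been explored when the `k`-th record is reached,
and the success of the attempt is independent of it. -/
lemma measure_attempt_ge (hv0 : 0 ≤ P.v) (hv1 : P.v < 1) {k l : ℕ} (hk : 1 ≤ k) {G : Set Config}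
    (hGm : MeasurableSet G)
    (hG : ∀ (c : Config) (n : ℕ), c.IsRecord P k n →
      (c.exploredPart P (c.walk P 0 n) ∈ G ↔ c ∈ G)) :
    goRightProb P l * configLaw q ρ {c | c.Regenerates P 0} *
        configLaw q ρ (G ∩ unlinkedRecord P k l) ≤
      configLaw q ρ (G ∩ {c | ∃ n, c.IsRegenerationTime P n}) := by
  rw [← smul_eq_mul, ← Measure.smul_apply]
  refine measure_le_of_forall_inter_le (measurableSet_recordPathEvent k)
    (disjoint_recordPathEvent k) (fun c ⟨_, n, hn, _⟩ => mem_iUnion_recordPathEvent hn) ?_ ?_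
  · rw [ofPred_exists]
    exact hGm.inter (.iUnion measurableSet_isRegenerationTime)
  · intro x
    rw [inter_comm _ (recordPathEvent P k x), inter_comm _ (recordPathEvent P k x)]
    exact measure_attempt_inter_recordPathEvent_ge hv0 hv1 hk hGm hG x

end Attempts

/-! ### Records free of linking trajectories -/

section UnlinkedRecords

open Filter Topology

variable (P : Params)

/-- The points visited by the walk before time `n`. -/
def Config.visited (c : Config) (n : ℕ) : Set (ℤ × ℤ) := {z | ∃ i < n, c.walk P 0 i = z}

/-- The `k`-th record is reached at a position with a linking trajectory that the walk has not met
before. -/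
def unvisitedLink (k l : ℕ) : Set Config :=
  {c | ∃ n, c.IsRecord P k n ∧
    (c.paths ∩ (linking P.v (c.walk P 0 n) l \ hits (c.visited P n))).Nonempty}

/-- At time `m`, below the level of the `k`-th record, the walk meets for the first time a
trajectory that reaches later the level of the `(k + l)`-th record. -/
def visitedLink (k l m : ℕ) : Set Config :=
  {c | level P.v (c.walk P 0 m) < (1 - P.v) * k ∧
    (c.paths ∩ (exceeds P.v (c.walk P 0 m) ((1 - P.v) * (k + l) - level P.v (c.walk P 0 m)) \
      hits (c.visited P m))).Nonempty}

/-- A bound on the probability of `unvisitedLink P k l` for the slope `v`. -/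
noncomputable def unvisitedLinkBound (ρ : ℝ≥0) (v : ℝ) (l : ℕ) : ℝ :=
  crossConst ρ v * Real.exp (-(v / 3 * (1 - v) * l))

/-- A bound on the sum over `k` of the probabilities of `visitedLink P k l m` for the slope `v`. -/
noncomputable def visitedLinkBound (ρ : ℝ≥0) (v : ℝ) (l : ℕ) : ℝ :=
  ρ * devConst v * Real.exp (-(v * (1 - v) * l)) * (1 - Real.exp (-(v * (1 - v))))⁻¹

variable {P} {q : Ioo (0 : ℝ) 1} {ρ : ℝ≥0}

lemma measure_paths_inter_nonempty_le {A : Set (ℤ → ℤ)} (hA : MeasurableSet A) :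
    configLaw q ρ {c | (c.paths ∩ A).Nonempty} ≤ intensity q ρ A := by
  have nonempty_eq : {c : Config | (c.paths ∩ A).Nonempty} = {c | c.paths ∩ A = ∅}ᶜ := by
    ext c
    exact nonempty_iff_ne_empty
  rw [nonempty_eq, prob_compl_eq_one_sub (measurableSet_paths_inter_eq_empty hA),
    configLaw_paths_inter_eq_empty q ρ hA, tsub_le_iff_left]
  exact one_le_expNeg_add _

lemma measure_inter_paths_sdiff_nonempty_le {T A : Set (ℤ → ℤ)} (hT : MeasurableSet T)
    (hA : MeasurableSet A) {S : Set Config} (hSm : MeasurableSet S)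
    (hS : ∀ c : Config, c.restrict T univ ∈ S ↔ c ∈ S) :
    configLaw q ρ (S ∩ {c | (c.paths ∩ (A \ T)).Nonempty}) ≤
      intensity q ρ A * configLaw q ρ S := by
  have indep : IndepFun (Config.restrict T univ) (Config.restrict Tᶜ ∅) (configLaw q ρ) :=
    indepFun_restrict q ρ hT hT.compl disjoint_compl_right (disjoint_empty _)
  have measurableSet_nonempty : MeasurableSet {c : Config | (c.paths ∩ A).Nonempty} := by
    simp only [nonempty_iff_ne_empty]
    exact (measurableSet_paths_inter_eq_empty hA).compl
  have preimage_S : Config.restrict T univ ⁻¹' S = S := ext hS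
  have preimage_nonempty : Config.restrict Tᶜ ∅ ⁻¹' {c | (c.paths ∩ A).Nonempty} =
      {c | (c.paths ∩ (A \ T)).Nonempty} := by
    ext c
    simp only [mem_preimage, mem_ofPred_eq, Config.restrict, inter_assoc, inter_comm Tᶜ,
      sdiff_eq]
  have inter_eq := indep.measure_inter_preimage_eq_mul S _ hSm measurableSet_nonempty
  have preimage_le :
      configLaw q ρ (Config.restrict Tᶜ ∅ ⁻¹' {c | (c.paths ∩ A).Nonempty}) ≤
        intensity q ρ A := by
    rw [preimage_nonempty]
    exact (measure_mono fun c hc => hc.mono (inter_subset_inter_right _ sdiff_subset)).trans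
      (measure_paths_inter_nonempty_le hA)
  rw [preimage_S] at inter_eq
  rw [← preimage_nonempty, inter_eq, mul_comm]
  gcongr

lemma visited_eq_before {c : Config} {n : ℕ} {p : Fin (n + 1) → ℤ × ℤ} (h : c ∈ followsPath P p) :
    c.visited P n = before p := by
  ext z
  constructor
  · rintro ⟨i, hi, rfl⟩
    exact ⟨⟨i, hi⟩, (h (Fin.castSucc ⟨i, hi⟩)).symm⟩
  · rintro ⟨i, rfl⟩
    exact ⟨i, i.2, h i.castSucc⟩

lemma intensity_linking_le (hv : 0 < P.v) (hv1 : P.v ≤ 1) (a : ℤ × ℤ) (l : ℕ) :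
    intensity q ρ (linking P.v a l) ≤ ENNReal.ofReal (unvisitedLinkBound ρ P.v l) := by
  have linking_eq : linking P.v a l =
      translate a ⁻¹' (hits (backCone P.v 0) ∩ hits (cone P.v (stepsRight l))) := by
    ext w
    simp only [linking, mem_inter_iff, mem_preimage, translate_mem_hits_cone,
      translate_mem_hits_backCone, zero_add, add_comm a]
  rw [linking_eq, (measurePreserving_translate q ρ a).measure_preimage
    ((measurableSet_hits _).inter (measurableSet_hits _)).nullMeasurableSet]
  exact intensity_cross_le q ρ hv hv1 l

lemma measure_unvisitedLink_le (hv : 0 < P.v) (hv1 : P.v ≤ 1) (k l : ℕ) :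
    configLaw q ρ (unvisitedLink P k l) ≤ ENNReal.ofReal (unvisitedLinkBound ρ P.v l) := by
  rw [← mul_one (ENNReal.ofReal _), ← measure_univ (μ := configLaw q ρ), ← smul_eq_mul,
    ← Measure.smul_apply]
  refine measure_le_of_forall_inter_le (measurableSet_recordPathEvent (P := P) k)
    (disjoint_recordPathEvent k) (fun c ⟨_, hn, _⟩ => mem_iUnion_recordPathEvent hn) .univ
    fun x => ?_
  set a := x.2 (Fin.last _)
  have subset_paths_inter_nonempty : unvisitedLink P k l ∩ recordPathEvent P k x ⊆
      recordPathEvent P k x ∩ {c | (c.paths ∩ (linking P.v a l \ hits (before x.2))).Nonempty} := by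
    rintro c ⟨⟨n, hn, hne⟩, hc⟩
    obtain rfl := isRecord_unique hn hc.2
    rw [visited_eq_before hc.1, walk_of_mem_followsPath hc.1] at hne
    exact ⟨hc, hne⟩
  calc configLaw q ρ (unvisitedLink P k l ∩ recordPathEvent P k x)
      ≤ intensity q ρ (linking P.v a l) * configLaw q ρ (recordPathEvent P k x) :=
        (measure_mono subset_paths_inter_nonempty).trans <|
          measure_inter_paths_sdiff_nonempty_le (measurableSet_hits _) (measurableSet_linking _ _ _)
            (measurableSet_recordPathEvent k x)
            (restrict_mem_recordPathEvent_iff (subset_univ _) subset_rfl)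
    _ ≤ _ := by
        rw [univ_inter, Measure.smul_apply, smul_eq_mul]
        gcongr
        exact intensity_linking_le hv hv1 a l

lemma measure_visitedLink_inter_followsPath_le (hv : 0 < P.v) (k l m : ℕ)
    (p : Fin (m + 1) → ℤ × ℤ) :
    configLaw q ρ (visitedLink P k l m ∩ followsPath P p) ≤
      ENNReal.ofReal (ρ * devConst P.v * Real.exp (-(P.v * (1 - P.v) * l)) *
        if level P.v (p (Fin.last _)) < (1 - P.v) * k then
          Real.exp (-(P.v * ((1 - P.v) * k - level P.v (p (Fin.last _))))) else 0) *
        configLaw q ρ (followsPath P p) := by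
  set x := level P.v (p (Fin.last _))
  by_cases hx : x < (1 - P.v) * k
  · set A := exceeds P.v (p (Fin.last _)) ((1 - P.v) * (k + l) - x)
    have subset_paths_inter_nonempty : visitedLink P k l m ∩ followsPath P p ⊆
        followsPath P p ∩ {c | (c.paths ∩ (A \ hits (before p))).Nonempty} := by
      rintro c ⟨⟨-, hne⟩, hc⟩
      rw [visited_eq_before hc, walk_of_mem_followsPath hc] at hne
      exact ⟨hc, hne⟩
    calc configLaw q ρ (visitedLink P k l m ∩ followsPath P p)
        ≤ intensity q ρ A * configLaw q ρ (followsPath P p) :=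
          (measure_mono subset_paths_inter_nonempty).trans <|
            measure_inter_paths_sdiff_nonempty_le (measurableSet_hits _)
              (measurableSet_exceeds _ _ _) (measurableSet_followsPath p)
              (restrict_mem_followsPath_iff (subset_univ _) subset_rfl)
      _ ≤ _ := by
          rw [if_pos hx, mul_assoc _ (Real.exp _), ← Real.exp_add]
          gcongr
          refine (intensity_exceeds_le q ρ hv _ _).trans_eq ?_
          congr 3
          ring
  · have inter_eq_empty : visitedLink P k l m ∩ followsPath P p = ∅ := by
      refine eq_empty_of_forall_notMem fun c ⟨⟨hc, _⟩, hp⟩ => hx ?_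
      rwa [walk_of_mem_followsPath hp] at hc
    simp [inter_eq_empty]

lemma sum_ite_exp_le {v δ : ℝ} (hv : 0 < v) (hδ : 0 < δ) (x : ℝ) (F : Finset ℕ) :
    ∑ k ∈ F, (if x < δ * k then Real.exp (-(v * (δ * k - x))) else 0) ≤
      (1 - Real.exp (-(v * δ)))⁻¹ := by
  have exp_lt_one : Real.exp (-(v * δ)) < 1 := Real.exp_lt_one_iff.2 (by nlinarith)
  have exp_nonneg := (Real.exp_pos (-(v * δ))).le
  rw [← Finset.sum_filter]
  set F' := F.filter fun k : ℕ => x < δ * k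
  rcases F'.eq_empty_or_nonempty with hempty | hne
  · rw [hempty, Finset.sum_empty]
    exact inv_nonneg.2 (sub_nonneg.2 exp_lt_one.le)
  set k₀ := F'.min' hne
  have hk₀ : x < δ * k₀ := (Finset.mem_filter.1 (F'.min'_mem hne)).2
  have k₀_le (k) (hk : k ∈ F') : k₀ ≤ k := F'.min'_le k hk
  calc ∑ k ∈ F', Real.exp (-(v * (δ * k - x)))
      ≤ ∑ k ∈ F', Real.exp (-(v * δ)) ^ (k - k₀) := by
        refine Finset.sum_le_sum fun k hk => ?_
        rw [← Real.exp_nat_mul, Real.exp_le_exp, Nat.cast_sub (k₀_le k hk)]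
        nlinarith
    _ = ∑ j ∈ F'.image (· - k₀), Real.exp (-(v * δ)) ^ j :=
        (Finset.sum_image fun i hi j hj => tsub_inj_left (k₀_le i hi) (k₀_le j hj)).symm
    _ ≤ ∑' j, Real.exp (-(v * δ)) ^ j :=
        (summable_geometric_of_lt_one exp_nonneg exp_lt_one).sum_le_tsum _
          fun _ _ => pow_nonneg exp_nonneg _
    _ = (1 - Real.exp (-(v * δ)))⁻¹ := tsum_geometric_of_lt_one exp_nonneg exp_lt_one

lemma sum_measure_visitedLink_le (hv : 0 < P.v) (hv1 : P.v < 1) (l m : ℕ) (F : Finset ℕ) :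
    ∑ k ∈ F, configLaw q ρ (visitedLink P k l m) ≤ ENNReal.ofReal (visitedLinkBound ρ P.v l) := by
  have sum_eq : ∑ k ∈ F, configLaw q ρ (visitedLink P k l m) =
      (∑ k ∈ F, (configLaw q ρ).restrict (visitedLink P k l m)) univ := by
    simp
  have bound_nonneg : 0 ≤ ρ * devConst P.v * Real.exp (-(P.v * (1 - P.v) * l)) :=
    mul_nonneg (mul_nonneg ρ.2 (devConst_nonneg _)) (Real.exp_pos _).le
  rw [sum_eq, ← mul_one (ENNReal.ofReal _), ← measure_univ (μ := configLaw q ρ), ← smul_eq_mul,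
    ← Measure.smul_apply]
  refine measure_le_of_forall_inter_le (measurableSet_followsPath (P := P)) disjoint_followsPath
    (iUnion_followsPath m).ge .univ fun p => ?_
  simp only [univ_inter, Measure.finsetSum_apply, Measure.smul_apply, smul_eq_mul,
    Measure.restrict_apply (measurableSet_followsPath p), inter_comm (followsPath P p)]
  refine (Finset.sum_le_sum fun k _ => measure_visitedLink_inter_followsPath_le hv k l m p).trans ?_
  rw [← Finset.sum_mul, ← ENNReal.ofReal_sum_of_nonneg fun k _ =>
    mul_nonneg bound_nonneg (by split_ifs <;> positivity), ← Finset.mul_sum]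
  gcongr
  exact mul_le_mul_of_nonneg_left (sum_ite_exp_le hv (sub_pos.2 hv1) _ F) bound_nonneg

lemma exists_first_visit {c : Config} {n : ℕ} {w : ℤ → ℤ} (h : w ∈ hits (c.visited P n)) :
    ∃ m < n, w (c.walk P 0 m).2 = (c.walk P 0 m).1 ∧ w ∉ hits (c.visited P m) := by
  classical
  have hex : ∃ m < n, w (c.walk P 0 m).2 = (c.walk P 0 m).1 := by
    obtain ⟨s, m, hm, hs⟩ := h
    exact ⟨m, hm, by rw [hs]⟩
  obtain ⟨hmn, hm⟩ := Nat.find_spec hex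
  refine ⟨Nat.find hex, hmn, hm, ?_⟩
  rintro ⟨s, i, hi, hs⟩
  exact Nat.find_min hex hi ⟨hi.trans hmn, by rw [hs]⟩

lemma mem_exceeds_of_mem_linking {c : Config} {k l m n : ℕ} (hmn : m ≤ n) (hn : c.IsRecord P k n)
    {w : ℤ → ℤ} (hw : w ∈ linking P.v (c.walk P 0 n) l)
    (hm : w (c.walk P 0 m).2 = (c.walk P 0 m).1) :
    w ∈ exceeds P.v (c.walk P 0 m) ((1 - P.v) * (k + l) - level P.v (c.walk P 0 m)) := by
  obtain ⟨s, -, hs, slope_le⟩ := hw.2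
  simp only [stepsRight, Prod.fst_add, Prod.snd_add, walk_snd, Prod.snd_zero, zero_add]
    at hs slope_le
  have time_eq : (c.walk P 0 m).2 + ((s - m).toNat : ℤ) = s := by
    rw [walk_snd, Prod.snd_zero, Int.toNat_of_nonneg (by omega)]
    ring
  refine ⟨hm, (s - m).toNat, ?_⟩
  have level_ge := hn.1
  rw [time_eq]
  simp only [level, walk_snd, Prod.snd_zero, zero_add] at level_ge ⊢
  push_cast at slope_le level_ge ⊢
  linarith

lemma compl_unlinkedRecord_subset (k l n : ℕ) :
    (unlinkedRecord P k l)ᶜ ⊆ {c | level P.v (c.walk P 0 n) < (1 - P.v) * k} ∪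
      (unvisitedLink P k l ∪ ⋃ m ∈ Finset.range n, visitedLink P k l m) := by
  intro c hc
  rcases lt_or_ge (level P.v (c.walk P 0 n)) ((1 - P.v) * k) with hlevel | hlevel
  · exact Or.inl hlevel
  obtain ⟨t, htn, ht⟩ := exists_isRecord hlevel
  obtain ⟨w, hw, hlink⟩ : (c.paths ∩ linking P.v (c.walk P 0 t) l).Nonempty :=
    nonempty_iff_ne_empty.2 fun hempty => hc ⟨t, ht, hempty⟩
  right
  by_cases hvisited : w ∈ hits (c.visited P t)
  · obtain ⟨m, hmt, hm, hfirst⟩ := exists_first_visit hvisited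
    exact Or.inr (mem_iUnion₂.2 ⟨m, Finset.mem_range.2 (hmt.trans_le htn), ht.2 m hmt, w, hw,
      mem_exceeds_of_mem_linking hmt.le ht hlink hm, hfirst⟩)
  · exact Or.inl ⟨t, ht, w, hw, hlink, hvisited⟩

lemma fallsBehind_of_level_lt {vStar : ℝ} (hv : 0 ≤ P.v) {C : ℕ} (hC : 3 ≤ (vStar - P.v) * C)
    {c : Config} {k K : ℕ} (hk : k ≤ 2 * K)
    (h : level P.v (c.walk P 0 (C * K)) < (1 - P.v) * k) : c.FallsBehind P vStar K := by
  refine ⟨C * K, ?_⟩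
  have hk' : (k : ℝ) ≤ 2 * K := by exact_mod_cast hk
  have slope_mul_nonneg : 0 ≤ P.v * k := mul_nonneg hv k.cast_nonneg
  have time_mul_le := mul_le_mul_of_nonneg_right hC K.cast_nonneg (α := ℝ)
  simp only [level, walk_snd, Prod.snd_zero, zero_add] at h
  push_cast at h ⊢
  linarith

lemma sum_measure_compl_unlinkedRecord_le {vStar : ℝ} (hv : 0 < P.v) (hv1 : P.v < 1) {C : ℕ}
    (hC : 3 ≤ (vStar - P.v) * C) (l K : ℕ) :
    ∑ k ∈ Finset.Ioc K (2 * K), configLaw q ρ (unlinkedRecord P k l)ᶜ ≤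
      K * (configLaw q ρ {c | c.FallsBehind P vStar K} +
        (ENNReal.ofReal (unvisitedLinkBound ρ P.v l) +
          C * ENNReal.ofReal (visitedLinkBound ρ P.v l))) := by
  have measure_compl_le (k) (hk : k ∈ Finset.Ioc K (2 * K)) :
      configLaw q ρ (unlinkedRecord P k l)ᶜ ≤
        configLaw q ρ {c | c.FallsBehind P vStar K} +
          (ENNReal.ofReal (unvisitedLinkBound ρ P.v l) +
            ∑ m ∈ Finset.range (C * K), configLaw q ρ (visitedLink P k l m)) :=
    calc configLaw q ρ (unlinkedRecord P k l)ᶜ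
        ≤ _ := measure_mono (compl_unlinkedRecord_subset k l (C * K))
      _ ≤ _ := (measure_union_le _ _).trans (add_le_add_right (measure_union_le _ _) _)
      _ ≤ _ := by
        gcongr
        · exact fallsBehind_of_level_lt hv.le hC (Finset.mem_Ioc.1 hk).2
        · exact measure_unvisitedLink_le hv hv1.le k l
        · exact measure_biUnion_finset_le _ _
  have sum_visitedLink_le : ∑ k ∈ Finset.Ioc K (2 * K), ∑ m ∈ Finset.range (C * K),
      configLaw q ρ (visitedLink P k l m) ≤
        (C * K : ℕ) * ENNReal.ofReal (visitedLinkBound ρ P.v l) := by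
    rw [Finset.sum_comm]
    refine (Finset.sum_le_sum fun m _ => sum_measure_visitedLink_le hv hv1 l m _).trans_eq ?_
    rw [Finset.sum_const, Finset.card_range, nsmul_eq_mul]
  have card_Ioc : (Finset.Ioc K (2 * K)).card = K := by
    rw [Nat.card_Ioc]
    omega
  refine (Finset.sum_le_sum measure_compl_le).trans ?_
  rw [Finset.sum_add_distrib, Finset.sum_add_distrib, Finset.sum_const, Finset.sum_const,
    card_Ioc, nsmul_eq_mul, nsmul_eq_mul]
  refine (add_le_add_right (add_le_add_right sum_visitedLink_le _) _).trans_eq ?_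
  push_cast
  ring

lemma tendsto_ofReal_exp_neg_mul_atTop {a : ℝ} (ha : 0 < a) (b : ℝ) :
    Tendsto (fun l : ℕ => ENNReal.ofReal (b * Real.exp (-(a * l)))) atTop (𝓝 0) := by
  have tendsto_exp : Tendsto (fun l : ℕ => Real.exp (-(a * l))) atTop (𝓝 0) :=
    Real.tendsto_exp_neg_atTop_nhds_zero.comp
      (tendsto_natCast_atTop_atTop.const_mul_atTop ha)
  simpa using ENNReal.tendsto_ofReal (tendsto_exp.const_mul b)

lemma tendsto_unvisitedLinkBound_add_visitedLinkBound (ρ : ℝ≥0) {v : ℝ} (hv : 0 < v) (hv1 : v < 1)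
    (C : ℕ) :
    Tendsto (fun l : ℕ => ENNReal.ofReal (unvisitedLinkBound ρ v l) +
      C * ENNReal.ofReal (visitedLinkBound ρ v l)) atTop (𝓝 0) := by
  have slope_pos : 0 < v * (1 - v) := mul_pos hv (sub_pos.2 hv1)
  have tendsto_unvisited := tendsto_ofReal_exp_neg_mul_atTop (a := v / 3 * (1 - v)) (by linarith)
    (crossConst ρ v)
  have tendsto_visited := ENNReal.Tendsto.const_mul (tendsto_ofReal_exp_neg_mul_atTop slope_pos
    (ρ * devConst v * (1 - Real.exp (-(v * (1 - v))))⁻¹)) (.inr (ENNReal.natCast_ne_top C))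
  simpa only [unvisitedLinkBound, visitedLinkBound, mul_right_comm _ _ (_ : ℝ)⁻¹, mul_zero,
    add_zero] using tendsto_unvisited.add tendsto_visited

lemma exists_measure_compl_unlinkedRecord_le {vStar : ℝ} (hv : 0 < P.v) (hv1 : P.v < 1)
    (hvStar : P.v < vStar)
    (hslow : Tendsto (fun L : ℕ => configLaw q ρ {c | c.FallsBehind P vStar L}) atTop (𝓝 0))
    {ε : ℝ≥0∞} (hε : 0 < ε) :
    ∃ l : ℕ, ∀ K₀ : ℕ, ∃ k > K₀, configLaw q ρ (unlinkedRecord P k l)ᶜ ≤ ε := by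
  obtain ⟨C, hC⟩ := exists_nat_ge (3 / (vStar - P.v))
  rw [div_le_iff₀' (sub_pos.2 hvStar)] at hC
  have half_pos : 0 < ε / 2 := ENNReal.half_pos hε.ne'
  obtain ⟨l, hl⟩ := ((tendsto_unvisitedLinkBound_add_visitedLinkBound ρ hv hv1 C).eventually
    (gt_mem_nhds half_pos)).exists
  refine ⟨l, fun K₀ => ?_⟩
  obtain ⟨K, hK, hK₀⟩ := ((hslow.eventually (gt_mem_nhds half_pos)).and
    (eventually_gt_atTop K₀)).exists
  have sum_le : ∑ k ∈ Finset.Ioc K (2 * K), configLaw q ρ (unlinkedRecord P k l)ᶜ ≤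
      ∑ _k ∈ Finset.Ioc K (2 * K), ε :=
    calc _ ≤ _ := sum_measure_compl_unlinkedRecord_le hv hv1 hC l K
      _ ≤ K * (ε / 2 + ε / 2) := by gcongr
      _ = ∑ _k ∈ Finset.Ioc K (2 * K), ε := by
        rw [ENNReal.add_halves, Finset.sum_const, Nat.card_Ioc, two_mul, Nat.add_sub_cancel,
          nsmul_eq_mul]
  obtain ⟨k, hk, hkε⟩ :=
    ENNReal.exists_le_of_sum_le ⟨2 * K, Finset.mem_Ioc.2 ⟨by omega, le_rfl⟩⟩ sum_le
  exact ⟨k, hK₀.trans (Finset.mem_Ioc.1 hk).1, hkε⟩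

end UnlinkedRecords

/-! ### Almost sure regeneration -/

section AlmostSureRegeneration

open Filter Topology

/-- The space-time box of radius `M`. -/
def box (M : ℕ) : Set (ℤ × ℤ) := {z | |z.1| ≤ M ∧ |z.2| ≤ M}

/-- The σ-algebra of the events that depend only on what happens in the box of radius `M`. -/
@[reducible] noncomputable def localSigma (M : ℕ) : MeasurableSpace Config :=
  .comap (Config.restrict (hits (box M)) (box M)) inferInstance

lemma box_mono {M M' : ℕ} (h : M ≤ M') : box M ⊆ box M' := fun _ hz =>
  ⟨hz.1.trans (by exact_mod_cast h), hz.2.trans (by exact_mod_cast h)⟩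

lemma exists_mem_box (z : ℤ × ℤ) : ∃ M, z ∈ box M :=
  ⟨max z.1.natAbs z.2.natAbs, by simp [box]⟩

lemma localSigma_le (M : ℕ) : localSigma M ≤ (inferInstance : MeasurableSpace Config) :=
  (measurable_restrict (measurableSet_hits _) _).comap_le

lemma restrict_mem_iff_of_localSigma {M : ℕ} {t : Set Config} (ht : MeasurableSet[localSigma M] t)
    {D : Set (ℤ × ℤ)} (hD : box M ⊆ D) (c : Config) : c.restrict (hits D) D ∈ t ↔ c ∈ t := by
  obtain ⟨t', -, rfl⟩ := ht
  rw [mem_preimage, mem_preimage, restrict_restrict,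
    inter_eq_self_of_subset_right (hits_mono hD), inter_eq_self_of_subset_left hD]

lemma localSigma_mono : Monotone localSigma := by
  rintro M M' h t ⟨t', ht', rfl⟩
  exact ⟨_, measurable_restrict (measurableSet_hits _) _ ht',
    ext (restrict_mem_iff_of_localSigma ⟨t', ht', rfl⟩ (box_mono h))⟩

lemma measurable_mark_iSup_localSigma : Measurable[⨆ M, localSigma M] Config.mark := by
  rw [@measurable_pi_iff]
  intro z
  obtain ⟨M, hM⟩ := exists_mem_box z
  have mark_eq : (fun c : Config => c.mark z) =
      (fun c : Config => c.mark z) ∘ Config.restrict (hits (box M)) (box M) := by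
    funext c
    simp [Config.restrict, hM]
  rw [mark_eq]
  exact (((measurable_pi_apply z).comp measurable_mark).comp (comap_measurable _)).mono
    (le_iSup localSigma M) le_rfl

lemma iSup_localSigma : ⨆ M, localSigma M = (inferInstance : MeasurableSpace Config) := by
  refine le_antisymm (iSup_le localSigma_le) (MeasurableSpace.generateFrom_le ?_)
  rintro _ ⟨A, B, hA, hB, rfl⟩
  have voidEvent_eq : voidEvent A B =
      (⋂ M, Config.restrict (hits (box M)) (box M) ⁻¹' {c | c.paths ∩ A = ∅}) ∩
        Config.mark ⁻¹' B := by
    ext c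
    refine and_congr_left fun _ => ?_
    simp only [mem_iInter, mem_preimage, mem_ofPred_eq, Config.restrict,
      eq_empty_iff_forall_notMem, mem_inter_iff, not_and]
    refine ⟨fun h M w hw => h w hw.1, fun h w hw => ?_⟩
    obtain ⟨M, hM⟩ := exists_mem_box (w 0, 0)
    exact h M w ⟨hw, 0, hM⟩
  rw [voidEvent_eq]
  exact .inter (.iInter fun M => le_iSup localSigma M _
    ⟨_, measurableSet_paths_inter_eq_empty hA, rfl⟩) (measurable_mark_iSup_localSigma hB)

lemma isSetAlgebra_iUnion_measurableSet {α : Type*} {m : ℕ → MeasurableSpace α} (hm : Monotone m) :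
    IsSetAlgebra (⋃ n, {t | MeasurableSet[m n] t}) where
  empty_mem := mem_iUnion.2 ⟨0, @MeasurableSet.empty _ (m 0)⟩
  compl_mem t ht := by
    obtain ⟨n, hn⟩ := mem_iUnion.1 ht
    exact mem_iUnion.2 ⟨n, @MeasurableSet.compl _ _ (m n) hn⟩
  union_mem s t hs ht := by
    obtain ⟨n, hn⟩ := mem_iUnion.1 hs
    obtain ⟨n', hn'⟩ := mem_iUnion.1 ht
    exact mem_iUnion.2 ⟨max n n', @MeasurableSet.union _ (m (max n n')) _ _
      (hm (le_max_left _ _) _ hn) (hm (le_max_right _ _) _ hn')⟩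

lemma exists_localSigma_measure_symmDiff_lt (μ : Measure Config) [IsFiniteMeasure μ]
    {C : Set Config} (hC : MeasurableSet C) {η : ℝ≥0} (hη : 0 < η) :
    ∃ M, ∃ t, MeasurableSet[localSigma M] t ∧ μ (symmDiff C t) < η := by
  have generateFrom_eq := iSup_localSigma.symm.trans
    (MeasurableSpace.generateFrom_iUnion_measurableSet localSigma).symm
  obtain ⟨t, ht, hlt⟩ := (Measure.MeasureDense.of_generateFrom_isSetAlgebra_finite (μ := μ)
    (isSetAlgebra_iUnion_measurableSet localSigma_mono) generateFrom_eq).approx C hC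
    (measure_ne_top _ _) η hη
  obtain ⟨M, hM⟩ := mem_iUnion.1 ht
  exact ⟨M, t, hM, by rwa [ENNReal.ofReal_coe_nnreal] at hlt⟩

variable {P : Params} {q : Ioo (0 : ℝ) 1} {ρ : ℝ≥0}

lemma box_subset_backCone (hv0 : 0 ≤ P.v) (hv1 : P.v < 1) {c : Config} {k n M : ℕ}
    (hk : 2 * M < (1 - P.v) * k) (h : c.IsRecord P k n) :
    box M ⊆ backCone P.v (c.walk P 0 n) := by
  rintro z ⟨hz1, hz2⟩
  have fst_le : (z.1 : ℝ) ≤ M := by exact_mod_cast (abs_le.1 hz1).2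
  have le_snd : -(M : ℝ) ≤ z.2 := by exact_mod_cast (abs_le.1 hz2).1
  have snd_le : (z.2 : ℝ) ≤ M := by exact_mod_cast (abs_le.1 hz2).2
  have index_le : (k : ℝ) ≤ n := by exact_mod_cast le_of_isRecord hv1 h
  have M_nonneg : (0 : ℝ) ≤ M := M.cast_nonneg
  have level_ge := h.1
  simp only [level, walk_snd, Prod.snd_zero, zero_add, Int.cast_natCast] at level_ge
  have slope_time_nonneg : 0 ≤ P.v * n := by positivity
  have neg_M_le : -(M : ℝ) ≤ P.v * z.2 := by nlinarith [M_nonneg]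
  refine ⟨?_, ?_, ?_⟩
  · have : (z.1 : ℝ) ≤ (c.walk P 0 n).1 := by linarith
    exact_mod_cast this
  · have : (z.2 : ℝ) ≤ n := by nlinarith
    rw [walk_snd, Prod.snd_zero, zero_add]
    exact_mod_cast this
  · rw [walk_snd, Prod.snd_zero]
    push_cast
    linarith

/-- Up to a small error, the absence of a regeneration time is decided in a finite box. The attempt
made at a far record is independent of that box. -/
lemma measure_not_exists_isRegenerationTime_le (hv0 : 0 ≤ P.v) (hv1 : P.v < 1) {l : ℕ} {ε : ℝ≥0∞}
    (hl : ∀ K : ℕ, ∃ k > K, configLaw q ρ (unlinkedRecord P k l)ᶜ ≤ ε) :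
    goRightProb P l * configLaw q ρ {c | c.Regenerates P 0} *
        configLaw q ρ {c | ∃ n, c.IsRegenerationTime P n}ᶜ ≤
      goRightProb P l * configLaw q ρ {c | c.Regenerates P 0} * ε := by
  set μ := configLaw q ρ
  set κ := goRightProb P l * μ {c | c.Regenerates P 0}
  set C := {c : Config | ∃ n, c.IsRegenerationTime P n}ᶜ
  have measurableSet_C : MeasurableSet C := by
    simp only [C, ofPred_exists]
    exact (MeasurableSet.iUnion measurableSet_isRegenerationTime).compl
  have κ_le_one : κ ≤ 1 := by
    simp only [κ, ← measure_goesRight (q := q) (ρ := ρ) 0 l]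
    exact mul_le_one' prob_le_one prob_le_one
  refine _root_.le_of_forall_pos_le_add fun δ hδ => ?_
  obtain ⟨η, hη, hηδ⟩ := ENNReal.lt_iff_exists_nnreal_btwn.1 (ENNReal.half_pos hδ.ne')
  obtain ⟨M, t, ht, ht_lt⟩ := exists_localSigma_measure_symmDiff_lt μ measurableSet_C
    (ENNReal.coe_pos.1 hη)
  obtain ⟨K, hK⟩ := exists_nat_ge (2 * M / (1 - P.v))
  obtain ⟨k, hKk, hk⟩ := hl K
  have far : 2 * M < (1 - P.v) * k :=
    (div_lt_iff₀' (sub_pos.2 hv1)).1 (hK.trans_lt (by exact_mod_cast hKk))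
  have attempt_le : κ * μ (t ∩ unlinkedRecord P k l) ≤ μ (symmDiff C t) :=
    (measure_attempt_ge hv0 hv1 (by omega) (localSigma_le M t ht) fun c n hn =>
      restrict_mem_iff_of_localSigma ht (box_subset_backCone hv0 hv1 far hn) c).trans
      (measure_mono fun c hc => Or.inr ⟨hc.1, fun hcC => hcC hc.2⟩)
  have C_subset : C ⊆ t ∩ unlinkedRecord P k l ∪ (symmDiff C t ∪ (unlinkedRecord P k l)ᶜ) := by
    intro c hc
    by_cases hct : c ∈ t
    · by_cases hunlinked : c ∈ unlinkedRecord P k l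
      exacts [Or.inl ⟨hct, hunlinked⟩, Or.inr (Or.inr hunlinked)]
    · exact Or.inr (Or.inl (Or.inl ⟨hc, hct⟩))
  calc κ * μ C
      ≤ κ * (μ (t ∩ unlinkedRecord P k l) + (μ (symmDiff C t) + μ (unlinkedRecord P k l)ᶜ)) := by
        gcongr
        exact (measure_mono C_subset).trans ((measure_union_le _ _).trans
          (add_le_add_right (measure_union_le _ _) _))
    _ ≤ μ (symmDiff C t) + (1 * μ (symmDiff C t) + κ * ε) := by
        rw [mul_add, mul_add]
        gcongr
    _ ≤ δ / 2 + (1 * (δ / 2) + κ * ε) := by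
        gcongr <;> exact (ht_lt.trans hηδ).le
    _ = κ * ε + δ := by rw [one_mul, ← add_assoc, ENNReal.add_halves, add_comm]

lemma ae_exists_isRegenerationTime {vStar : ℝ} (hv0 : 0 < P.v) (hv1 : P.v < 1)
    (hvStar : P.v < vStar) (hVac : 0 < P.pVac) (hOcc : 0 < P.pOcc)
    (hslow : Tendsto (fun L : ℕ => configLaw q ρ {c | c.FallsBehind P vStar L}) atTop (𝓝 0)) :
    ∀ᵐ c ∂configLaw q ρ, ∃ n, c.IsRegenerationTime P n := by
  refine le_zero_iff.1 (_root_.le_of_forall_pos_le_add fun ε hε => ?_)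
  obtain ⟨l, hl⟩ := exists_measure_compl_unlinkedRecord_le hv0 hv1 hvStar hslow hε
  have attempt_ne_zero := mul_ne_zero (goRightProb_ne_zero hVac hOcc l)
    (measure_regenerates_ne_zero hv0 hv1 hvStar.le hVac hOcc hslow)
  have attempt_ne_top : goRightProb P l * configLaw q ρ {c | c.Regenerates P 0} ≠ ∞ := by
    rw [← measure_goesRight (q := q) (ρ := ρ) 0 l]
    exact ENNReal.mul_ne_top (measure_ne_top _ _) (measure_ne_top _ _)
  rw [zero_add]
  exact (ENNReal.mul_le_mul_iff_right attempt_ne_zero attempt_ne_top).1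
    (measure_not_exists_isRegenerationTime_le hv0.le hv1 hl)

end AlmostSureRegeneration

/-! ### The sequence of blocks -/

section Blocks

variable (P : Params)

/-- The configuration seen from the position of the walk at the first regeneration time. -/
noncomputable def Config.renewed (c : Config) : Config :=
  c.shift (c.walk P 0 (c.regenerationTime P))

/-- The first block `(τ, (X_s)_{0 ≤ s ≤ τ})`, with `τ` replaced by `0` if there is no regeneration
time. -/
noncomputable def Config.firstBlock (c : Config) : Block :=
  block (fun n => (c.walk P 0 n).1) 0 (c.regenerationTime P)

variable (q : Ioo (0 : ℝ) 1) (ρ : ℝ≥0)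

/-- The law of the `n`-th block: all blocks but the one of index `0` start with a regeneration. -/
noncomputable def blockLaw : ℕ → Measure Block
  | 0 => (configLaw q ρ).map (Config.firstBlock P)
  | _ + 1 =>
    (ProbabilityTheory.cond (configLaw q ρ) {c | c.Regenerates P 0}).map (Config.firstBlock P)

variable {P}

lemma shift_zero (c : Config) : c.shift 0 = c := by
  cases c
  simp only [Config.shift, neg_zero, add_zero, Config.mk.injEq, and_true]
  ext w
  simp [translate_zero]

lemma iterate_renewed_eq_shift (c : Config) (n : ℕ) :
    (Config.renewed P)^[n] c = c.shift
      (c.walk P 0 (∑ i ∈ Finset.range n, ((Config.renewed P)^[i] c).regenerationTime P)) := by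
  induction n with
  | zero => rw [Finset.sum_range_zero, walk_zero, shift_zero, Function.iterate_zero_apply]
  | succ n ih =>
    rw [Function.iterate_succ_apply', Finset.sum_range_succ, walk_add]
    nth_rewrite 1 [Config.renewed]
    set t := ((Config.renewed P)^[n] c).regenerationTime P
    rw [ih, shift_shift, walk_shift, zero_add]

lemma block_shift_walk (c : Config) (m t : ℕ) :
    block (fun n => ((c.shift (c.walk P 0 m)).walk P 0 n).1) 0 t =
      block (fun n => (c.walk P 0 n).1) m t := by
  have walk_fst_eq (n : ℕ) : ((c.shift (c.walk P 0 m)).walk P 0 n).1 + (c.walk P 0 m).1 =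
      (c.walk P 0 (m + n)).1 := by
    rw [← Prod.fst_add, walk_shift, zero_add, walk_add]
  simp only [block, zero_add, walk_zero, Prod.fst_zero, sub_zero, ← walk_fst_eq,
    add_sub_cancel_right]

lemma block_walkX_eq_firstBlock (s : Sample) (n : ℕ) :
    block (walkX P.pVac P.pOcc s)
        (∑ i ∈ Finset.range n, ((Config.renewed P)^[i] (toConfig s)).regenerationTime P)
        (((Config.renewed P)^[n] (toConfig s)).regenerationTime P) =
      ((Config.renewed P)^[n] (toConfig s)).firstBlock P := by
  have walkX_eq : walkX P.pVac P.pOcc s = fun m => ((toConfig s).walk P 0 m).1 :=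
    funext fun m => congrArg Prod.fst (walkY_eq_walk s 0 m)
  rw [walkX_eq, ← block_shift_walk, ← iterate_renewed_eq_shift]
  rfl

lemma firstBlock_eq_iff {c : Config} {b : Block} :
    c.firstBlock P = b ↔
      c.regenerationTime P = b.1 ∧ ∀ i : Fin (b.1 + 1), (c.walk P 0 i).1 = b.2 i := by
  obtain ⟨t, x⟩ := b
  simp only [Config.firstBlock, block, zero_add, walk_zero, Prod.fst_zero, sub_zero]
  refine ⟨fun h => ?_, ?_⟩
  · obtain ⟨rfl, h⟩ := Sigma.mk.inj_iff.1 h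
    exact ⟨rfl, congrFun (eq_of_heq h)⟩
  · rintro ⟨rfl, h⟩
    exact congrArg (Sigma.mk _) (funext h)

lemma hasFirstBlock_iff_firstBlock_eq {c : Config} (h : ∃ n, c.IsRegenerationTime P n) {b : Block} :
    c.HasFirstBlock P b ↔ c.firstBlock P = b := by
  rw [firstBlock_eq_iff, Config.HasFirstBlock, ← and_assoc]
  refine and_congr_left fun _ => ⟨fun ⟨hb, hfirst⟩ => ?_, fun hb => ?_⟩
  · exact le_antisymm (Nat.sInf_le hb) (not_lt.1 fun hlt => hfirst _ hlt (Nat.sInf_mem h))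
  · rw [← hb]
    exact ⟨Nat.sInf_mem h, fun m hm hreg => (Nat.sInf_le hreg).not_gt hm⟩

lemma displacement_firstBlock (c : Config) :
    displacement (c.firstBlock P) = c.walk P 0 (c.regenerationTime P) :=
  (walk_eq_displacement (firstBlock_eq_iff.1 rfl).2).symm

lemma hasFirstBlocks_ofFn_iff {n : ℕ} (b : Fin n → Block) {c : Config}
    (h : ∀ a, ∃ m, (c.shift a).IsRegenerationTime P m) :
    c.HasFirstBlocks P (List.ofFn b) ↔
      ∀ i : Fin n, ((Config.renewed P)^[i] c).firstBlock P = b i := by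
  induction n generalizing c with
  | zero => simp [Config.HasFirstBlocks]
  | succ n ih =>
    rw [List.ofFn_succ, Config.HasFirstBlocks, Fin.forall_fin_succ,
      hasFirstBlock_iff_firstBlock_eq (shift_zero c ▸ h 0)]
    refine and_congr_right fun hb => ?_
    have shift_eq : c.shift (displacement (b 0)) = c.renewed P := by
      rw [← hb, displacement_firstBlock, Config.renewed]
    rw [shift_eq]
    refine ih _ fun a => ?_
    rw [Config.renewed, shift_shift]
    exact h _

lemma measurable_firstBlock : Measurable (Config.firstBlock P) := by
  refine measurable_to_countable' fun b => ?_
  have preimage_eq : Config.firstBlock P ⁻¹' {b} = {c : Config | c.regenerationTime P = b.1} ∩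
      ⋂ i : Fin (b.1 + 1), {c : Config | (c.walk P 0 i).1 = b.2 i} := by
    ext c
    simp [firstBlock_eq_iff]
  rw [preimage_eq]
  exact (measurable_regenerationTime (measurableSet_singleton _)).inter
    (.iInter fun i => measurable_walk (P := P) 0 i (.of_discrete (s := {z : ℤ × ℤ | z.1 = b.2 i})))

lemma measurable_renewed : Measurable (Config.renewed P) := by
  have measurable_uncurry_shift : Measurable fun p : Config × (ℤ × ℤ) => p.1.shift p.2 :=
    measurable_from_prod_countable_left measurable_shift
  have measurable_uncurry_walk : Measurable fun p : Config × ℕ => p.1.walk P 0 p.2 :=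
    measurable_from_prod_countable_left (measurable_walk 0)
  exact measurable_uncurry_shift.comp (measurable_id.prodMk
    (measurable_uncurry_walk.comp (measurable_id.prodMk measurable_regenerationTime)))

lemma measurable_firstBlock_iterate_renewed (n : ℕ) :
    Measurable fun c => ((Config.renewed P)^[n] c).firstBlock P :=
  measurable_firstBlock.comp (measurable_renewed.iterate n)

variable {q ρ}

lemma isProbabilityMeasure_blockLaw (hreg : configLaw q ρ {c | c.Regenerates P 0} ≠ 0) :
    ∀ n, IsProbabilityMeasure (blockLaw P q ρ n)
  | 0 => Measure.isProbabilityMeasure_map measurable_firstBlock.aemeasurable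
  | _ + 1 =>
    have := cond_isProbabilityMeasure hreg
    Measure.isProbabilityMeasure_map measurable_firstBlock.aemeasurable

lemma blockLaw_zero_singleton (hex : ∀ᵐ c ∂configLaw q ρ, ∃ n, c.IsRegenerationTime P n)
    (b : Block) : blockLaw P q ρ 0 {b} = configLaw q ρ {c | c.HasFirstBlock P b} := by
  rw [blockLaw, Measure.map_apply measurable_firstBlock (measurableSet_singleton b)]
  refine measure_congr ?_
  filter_upwards [hex] with c hc
  exact propext (hasFirstBlock_iff_firstBlock_eq hc).symm

lemma blockLaw_succ_singleton (hv : 0 ≤ P.v) (hreg : configLaw q ρ {c | c.Regenerates P 0} ≠ 0)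
    (hex : ∀ᵐ c ∂configLaw q ρ, ∃ n, c.IsRegenerationTime P n) (n : ℕ) (b : Block) :
    blockLaw P q ρ (n + 1) {b} = pastProb P q ρ b True := by
  have measure_inter : configLaw q ρ ({c | c.Regenerates P 0} ∩ Config.firstBlock P ⁻¹' {b}) =
      configLaw q ρ {c | c.Regenerates P 0 ∧ c.HasFirstBlock P b} := by
    refine measure_congr ?_
    filter_upwards [hex] with c hc
    exact propext (and_congr_right fun _ => (hasFirstBlock_iff_firstBlock_eq hc).symm)
  rw [blockLaw, Measure.map_apply measurable_firstBlock (measurableSet_singleton b),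
    cond_apply (measurableSet_regenerates 0), measure_inter,
    measure_regenerates_hasFirstBlock q ρ hv, mul_left_comm,
    ENNReal.inv_mul_cancel hreg (measure_ne_top _ _), mul_one]

lemma measure_forall_firstBlock_eq (hv : 0 ≤ P.v)
    (hreg : configLaw q ρ {c | c.Regenerates P 0} ≠ 0)
    (hex : ∀ᵐ c ∂configLaw q ρ, ∃ n, c.IsRegenerationTime P n) (n : ℕ) (b : Fin n → Block) :
    configLaw q ρ {c | ∀ i : Fin n, ((Config.renewed P)^[i] c).firstBlock P = b i} =
      ∏ i : Fin n, blockLaw P q ρ i {b i} := by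
  have measure_eq : configLaw q ρ {c | ∀ i : Fin n, ((Config.renewed P)^[i] c).firstBlock P = b i} =
      configLaw q ρ {c | c.HasFirstBlocks P (List.ofFn b)} := by
    have hex_shift : ∀ᵐ c ∂configLaw q ρ, ∀ a, ∃ n, (c.shift a).IsRegenerationTime P n :=
      ae_all_iff.2 fun a => (measurePreserving_shift q ρ a).quasiMeasurePreserving.ae hex
    refine measure_congr ?_
    filter_upwards [hex_shift] with c hc
    exact propext (hasFirstBlocks_ofFn_iff b hc).symm
  rw [measure_eq]
  cases n with
  | zero => simp [Config.HasFirstBlocks]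
  | succ n =>
    rw [List.ofFn_succ, measure_hasFirstBlocks_cons q ρ hv, List.map_ofFn, List.prod_ofFn,
      Fin.prod_univ_succ]
    simp only [Fin.val_zero, Fin.val_succ, blockLaw_zero_singleton hex,
      blockLaw_succ_singleton hv hreg hex, Function.comp_apply]

lemma map_firstBlock_iterate_renewed (hv : 0 ≤ P.v)
    (hreg : configLaw q ρ {c | c.Regenerates P 0} ≠ 0)
    (hex : ∀ᵐ c ∂configLaw q ρ, ∃ n, c.IsRegenerationTime P n) :
    (configLaw q ρ).map (fun c n => ((Config.renewed P)^[n] c).firstBlock P) =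
      Measure.infinitePi (blockLaw P q ρ) :=
  have := isProbabilityMeasure_blockLaw hreg
  map_eq_infinitePi_of_measure_forall_fin measurable_firstBlock_iterate_renewed
    (measure_forall_firstBlock_eq hv hreg hex)

end Blocks

/-! ### The renewal structure -/

section RenewalStructure

open Filter Topology

variable {P : Params} {q : Ioo (0 : ℝ) 1} {ρ : ℝ≥0}

lemma measure_fallsBehind (vStar : ℝ) (L : ℕ) :
    configLaw q ρ {c | c.FallsBehind P vStar L} =
      law q ρ {s | ∃ n : ℕ, 1 ≤ n ∧ (walkX P.pVac P.pOcc s n : ℝ) < n * vStar - L} := by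
  rw [configLaw, Measure.map_apply measurable_toConfig (measurableSet_fallsBehind vStar L)]
  congr 1
  ext s
  refine exists_congr fun n => ?_
  rw [walkX, walkY_eq_walk, iff_and_self]
  refine fun h => Nat.one_le_iff_ne_zero.2 fun hn => ?_
  simp only [hn, walk_zero, Prod.fst_zero, Int.cast_zero, Nat.cast_zero, zero_mul, zero_sub,
    neg_pos] at h
  exact h.not_ge L.cast_nonneg

lemma le_one_of_tendsto_measure_fallsBehind {vStar : ℝ}
    (hslow : Tendsto (fun L : ℕ => configLaw q ρ {c | c.FallsBehind P vStar L}) atTop (𝓝 0)) :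
    vStar ≤ 1 := by
  by_contra! hlt
  have fallsBehind_eq_univ (L : ℕ) : {c : Config | c.FallsBehind P vStar L} = univ := by
    refine eq_univ_of_forall fun c => ?_
    obtain ⟨n, hn⟩ := exists_nat_gt (L / (vStar - 1))
    rw [div_lt_iff₀ (sub_pos.2 hlt)] at hn
    have fst_le : ((c.walk P 0 n).1 : ℝ) ≤ n := by
      exact_mod_cast (walk_fst_le c 0 n).trans_eq (zero_add _)
    exact ⟨n, by linarith⟩
  simp only [fallsBehind_eq_univ, measure_univ] at hslow
  exact one_ne_zero (tendsto_nhds_unique tendsto_const_nhds hslow)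

lemma tendsto_measure_of_ballistic {pVac pOcc vStar : ℝ} (h : Ballistic pVac pOcc q ρ vStar) :
    Tendsto (fun L : ℕ =>
      law q ρ {s | ∃ n : ℕ, 1 ≤ n ∧ (walkX pVac pOcc s n : ℝ) < n * vStar - L}) atTop (𝓝 0) := by
  obtain ⟨c, hc, γ, hγ, hbound⟩ := h
  have tendsto_log_rpow : Tendsto (fun L : ℕ => Real.log L ^ γ) atTop atTop :=
    (tendsto_rpow_atTop (by linarith)).comp
      (Real.tendsto_log_atTop.comp tendsto_natCast_atTop_atTop)
  have tendsto_bound : Tendsto (fun L : ℕ => c⁻¹ * Real.exp (-c * Real.log L ^ γ)) atTop (𝓝 0) := by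
    simpa using (Real.tendsto_exp_atBot.comp
      (tendsto_log_rpow.const_mul_atTop_of_neg (neg_lt_zero.2 hc))).const_mul c⁻¹
  refine (ENNReal.tendsto_toReal_zero_iff fun _ => measure_ne_top _ _).1 ?_
  refine squeeze_zero' (.of_forall fun _ => ENNReal.toReal_nonneg) ?_ tendsto_bound
  filter_upwards [eventually_ge_atTop 1] with L hL using hbound L hL

variable (P) in
/-- The random time `τ_{n+1}`: the first regeneration time of the configuration seen from the `n`-th
regeneration. -/
noncomputable def blockDuration (n : ℕ) (s : Sample) : ℕ :=
  ((Config.renewed P)^[n] (toConfig s)).regenerationTime P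

variable (P) in
/-- The block of the walk between its `n`-th and its `(n + 1)`-st regenerations. -/
noncomputable def nthBlock (n : ℕ) (s : Sample) : Block :=
  block (walkX P.pVac P.pOcc s) (∑ i ∈ Finset.range n, blockDuration P i s) (blockDuration P n s)

lemma nthBlock_eq_firstBlock (n : ℕ) :
    nthBlock P n = fun s => ((Config.renewed P)^[n] (toConfig s)).firstBlock P :=
  funext fun s => block_walkX_eq_firstBlock s n

lemma measurable_nthBlock (n : ℕ) : Measurable (nthBlock P n) := by
  rw [nthBlock_eq_firstBlock]
  exact (measurable_firstBlock_iterate_renewed n).comp measurable_toConfig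

lemma measurable_blockDuration (n : ℕ) : Measurable (blockDuration P n) :=
  measurable_regenerationTime.comp ((measurable_renewed.iterate n).comp measurable_toConfig)

lemma ae_blockDuration_zero_eq_regTime (hv : P.v < 1)
    (hex : ∀ᵐ c ∂configLaw q ρ, ∃ n, c.IsRegenerationTime P n) :
    ∀ᵐ s ∂law q ρ, (blockDuration P 0 s : ℕ∞) = regTime P.pVac P.pOcc P.v s := by
  filter_upwards [ae_of_ae_map measurable_toConfig.aemeasurable hex] with s hs
  rw [regTime_eq_regenerationTime hv hs]
  rfl

lemma iIndepFun_nthBlock (hv : 0 ≤ P.v) (hreg : configLaw q ρ {c | c.Regenerates P 0} ≠ 0)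
    (hex : ∀ᵐ c ∂configLaw q ρ, ∃ n, c.IsRegenerationTime P n) :
    iIndepFun (nthBlock P) (law q ρ) ∧ ∀ n, (law q ρ).map (nthBlock P n) = blockLaw P q ρ n := by
  have := isProbabilityMeasure_blockLaw hreg
  refine iIndepFun_of_map_eq_infinitePi measurable_nthBlock ?_
  rw [← map_firstBlock_iterate_renewed hv hreg hex, configLaw, Measure.map_map
    (measurable_pi_lambda _ measurable_firstBlock_iterate_renewed) measurable_toConfig]
  simp only [nthBlock_eq_firstBlock, Function.comp_def]

lemma block_regTime_eq_nthBlock_zero (hv : P.v < 1) :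
    (fun s => block (walkX P.pVac P.pOcc s) 0 (regTime P.pVac P.pOcc P.v s).toNat) =
      nthBlock P 0 := by
  funext s
  rw [regTime_toNat hv, nthBlock, Finset.sum_range_zero]
  rfl

lemma map_nthBlock_zero_coneLaw (n : ℕ) :
    (coneLaw P.pVac P.pOcc q ρ P.v).map (nthBlock P 0) = blockLaw P q ρ (n + 1) := by
  have regEvent_eq : regEvent P.pVac P.pOcc P.v 0 = toConfig ⁻¹' {c | c.Regenerates P 0} :=
    ext fun s => mem_regEvent_iff s 0
  have nthBlock_zero_eq : nthBlock P 0 = Config.firstBlock P ∘ toConfig := nthBlock_eq_firstBlock 0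
  rw [blockLaw, configLaw, ← map_cond_preimage _ measurable_toConfig (measurableSet_regenerates 0),
    Measure.map_map measurable_firstBlock measurable_toConfig, coneLaw, regEvent_eq,
    nthBlock_zero_eq]

end RenewalStructure

end RWDRE

theorem theoremt_general
    (pVac pOcc : ℝ) (q : Set.Ioo (0 : ℝ) 1) (ρ : ℝ≥0) (v vStar : ℝ)
    (hpVac : 0 < pVac) (hpOcc : 0 < pOcc) (hv : v ∈ Set.Ioo 0 vStar)
    (hslow : Filter.Tendsto (fun L : ℕ =>
      law q ρ {s | ∃ n : ℕ, 1 ≤ n ∧ (walkX pVac pOcc s n : ℝ) < n * vStar - L})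
      Filter.atTop (nhds 0)) :
    ∃ (Ω : Type) (_ : MeasurableSpace Ω) (P : Measure Ω) (π : Ω → Sample) (T : ℕ → Ω → ℕ),
      MeasurePreserving π P (law q ρ) ∧
      (∀ k, Measurable (T k)) ∧
      (∀ᵐ ω ∂P, (T 0 ω : ℕ∞) = regTime pVac pOcc v (π ω)) ∧
      let B : ℕ → Ω → Block := fun n ω =>
        block (walkX pVac pOcc (π ω)) (∑ i ∈ Finset.range n, T i ω) (T n ω)
      iIndepFun (fun n => B (n + 1)) P ∧
      IndepFun (B 0) (fun ω n => B (n + 1) ω) P ∧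
      ∀ n, IdentDistrib (B (n + 1))
        (fun s => block (walkX pVac pOcc s) 0 (regTime pVac pOcc v s).toNat)
        P (coneLaw pVac pOcc q ρ v) := by
  let P : Params := ⟨pVac, pOcc, v⟩
  have hslow' : Filter.Tendsto (fun L : ℕ => configLaw q ρ {c | c.FallsBehind P vStar L})
      Filter.atTop (nhds 0) := by simpa only [measure_fallsBehind] using hslow
  have hv1 : P.v < 1 := hv.2.trans_le (le_one_of_tendsto_measure_fallsBehind hslow')
  have hex := ae_exists_isRegenerationTime hv.1 hv1 hv.2 hpVac hpOcc hslow'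
  have hreg := measure_regenerates_ne_zero hv.1 hv1 hv.2.le hpVac hpOcc hslow'
  obtain ⟨indep, map_nthBlock⟩ := iIndepFun_nthBlock hv.1.le hreg hex
  refine ⟨Sample, inferInstance, law q ρ, id, blockDuration P, .id _, measurable_blockDuration,
    ae_blockDuration_zero_eq_regTime hv1 hex, indep.precomp (add_left_injective 1),
    indepFun_zero_succ indep measurable_nthBlock, fun n => ?_⟩
  have nthBlock_zero_eq := block_regTime_eq_nthBlock_zero hv1
  rw [nthBlock_zero_eq]
  exact ⟨(measurable_nthBlock _).aemeasurable, (measurable_nthBlock 0).aemeasurable,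
    (map_nthBlock _).trans (map_nthBlock_zero_coneLaw n).symm⟩

/-- Here `T k` stands for `τ_{k+1}`, so that `∑ i ∈ Finset.range n, T i` is
`S_n = τ_1 + ⋯ + τ_n`; the block with index `0` is the first block, that is
`(τ, (X_s)_{0 ≤ s ≤ τ})`. -/
theorem theoremt
    (pVac pOcc : ℝ) (q : Set.Ioo (0 : ℝ) 1) (ρ : ℝ≥0) (vStar : ℝ)
    (hpVac : pVac ∈ Set.Icc (0 : ℝ) 1) (hpOcc : pOcc ∈ Set.Icc (0 : ℝ) 1)
    (hvVac : -1 < 2 * pVac - 1) (hvOcc : 0 < 2 * pOcc - 1) (hρ : 0 < ρ)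
    (hvStar : vStar ∈ Set.Ioo 0 (2 * pOcc - 1))
    (hball : Ballistic pVac pOcc q ρ vStar) :
    ∃ (Ω : Type) (_ : MeasurableSpace Ω) (P : Measure Ω) (π : Ω → Sample) (T : ℕ → Ω → ℕ),
      MeasurePreserving π P (law q ρ) ∧
      (∀ k, Measurable (T k)) ∧
      (∀ᵐ ω ∂P, (T 0 ω : ℕ∞) = regTime pVac pOcc (vStar / 3) (π ω)) ∧
      let B : ℕ → Ω → Block := fun n ω =>
        block (walkX pVac pOcc (π ω)) (∑ i ∈ Finset.range n, T i ω) (T n ω)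
      iIndepFun (fun n => B (n + 1)) P ∧
      IndepFun (B 0) (fun ω n => B (n + 1) ω) P ∧
      ∀ n, IdentDistrib (B (n + 1))
        (fun s => block (walkX pVac pOcc s) 0 (regTime pVac pOcc (vStar / 3) s).toNat)
        P (coneLaw pVac pOcc q ρ (vStar / 3)) := by
  exact theoremt_general pVac pOcc q ρ (vStar / 3) vStar (by linarith) (by linarith)
    ⟨by linarith [hvStar.1], by linarith [hvStar.1]⟩ (tendsto_measure_of_ballistic hball)
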